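/- **Theorem.** Let $d\in\{1,2,3\}$, let $\Omega=(\mathbb R/\mathbb Z)^d$ be the torus with unit cell $(0,1)^d$, and let $X=H^1(\Omega)$ be the real Sobolev space with inner product $(u,v)_X=\int_\Omega uv+\int_\Omega\nabla u\cdot\nabla v$; the induced norm is denoted $\|\cdot\|_{H^1(\Omega)}$. Let $V\in H^{r_v}(\Omega)$ for some real $r_v\ge 2$ be real-valued with $V\ge V_{\min}$ almost everywhere for some constant $V_{\min}>0$, and let $$\mathcal E(u)=\frac12\int_\Omega|\nabla u|^2+\frac12\int_\Omega V|u|^2+\frac14\int_\Omega|u|^4 ,\qquad u\in X .$$ Let $u^*\in X$ be the positive minimiser of $\mathcal E$ over $\{u\in X:\|u\|_{L^2(\Omega)}=1\}$. For $N\in\mathbb N$, $N\ge1$, let $X_N\subset X$ be the space of real-valued functions in the complex span of the plane waves $x\mapsto e^{2\pi i k\cdot x}$, $k\in\mathbb Z^d$, $|k|\le N$ (Euclidean norm), and let $\Pi_N:X\to X_N$ be the $(\cdot,\cdot)_X$-orthogonal projection. Then there is a constant $C>0$, independent of $N$, such that for every integer $N\ge1$ and every minimiser $u_N^*$ of $\mathcal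 E$ over $\{u\in X_N:\|u\|_{L^2(\Omega)}=1\}$ with $(u_N^*,u^*)_{L^2(\Omega)}\ge0$, $$\|\Pi_Nu^*-u_N^*\|_{L^2(\Omega)}+N^{-1}\|\Pi_Nu^*-u_N^*\|_{H^1(\Omega)}\le C\,N^{-3}\,\|\Pi_Nu^*-u^*\|_{H^1(\Omega)} .$$ -/

import Mathlib

open MeasureTheory UnitAddTorus
open scoped ContDiff

-- The torus `(ℝ/ℤ)^d` carries the product of the Haar probability measures, that is Lebesgue
-- measure of the unit cell `(0,1)^d`, as in Mathlib's theory of multivariate Fourier series.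
attribute [local instance] instMeasureSpaceUnitAddCircle

namespace GrossPitaevskii

/-- The `d`-dimensional torus with unit cell `(0,1)^d`. -/
abbrev Torus (d : ℕ) : Type := UnitAddTorus (Fin d)

instance isProbabilityMeasure_circle : IsProbabilityMeasure (volume : Measure UnitAddCircle) :=
  inferInstanceAs (IsProbabilityMeasure AddCircle.haarAddCircle)

/-- Real-valued square integrable functions on the torus. -/
abbrev L2 (d : ℕ) : Type := Lp ℝ 2 (volume : Measure (Torus d))

/-- Square integrable vector fields on the torus. -/
abbrev L2Vec (d : ℕ) : Type := PiLp 2 (fun _ : Fin d => L2 d)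

/-- The covering map `ℝ^d → (ℝ/ℤ)^d`. -/
def cover (d : ℕ) (x : Fin d → ℝ) : Torus d := fun i => (x i : UnitAddCircle)

/-- Smooth functions on the torus: the periodic lift to `ℝ^d` is `C^∞`. -/
def IsSmooth {d : ℕ} (φ : Torus d → ℝ) : Prop :=
  ContDiff ℝ ∞ (fun x : Fin d → ℝ => φ (cover d x))

/-- The classical partial derivative `∂φ/∂x_j` on the torus. -/
noncomputable def partialDeriv {d : ℕ} (j : Fin d) (φ : Torus d → ℝ) (p : Torus d) : ℝ :=
  deriv (fun t : ℝ => φ (p + Pi.single j (t : UnitAddCircle))) 0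

/-- `g` is the weak partial derivative `∂u/∂x_j` of `u`. -/
def IsWeakPartialDeriv {d : ℕ} (j : Fin d) (u g : L2 d) : Prop :=
  ∀ φ : Torus d → ℝ, IsSmooth φ →
    ∫ x, u x * partialDeriv j φ x = -∫ x, g x * φ x

theorem isOpenQuotientMap_cover (d : ℕ) : IsOpenQuotientMap (cover d) :=
  IsOpenQuotientMap.piMap (fun _ => QuotientAddGroup.isOpenQuotientMap_mk)

theorem IsSmooth.continuous {d : ℕ} {φ : Torus d → ℝ} (h : IsSmooth φ) : Continuous φ :=
  (isOpenQuotientMap_cover d).isQuotientMap.continuous_iff.2 (ContDiff.continuous h)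

theorem IsSmooth.continuous_partialDeriv {d : ℕ} {φ : Torus d → ℝ} (h : IsSmooth φ) (j : Fin d) :
    Continuous (partialDeriv j φ) := by
  refine (isOpenQuotientMap_cover d).isQuotientMap.continuous_iff.2 ?_
  have key : partialDeriv j φ ∘ cover d =
      fun x => fderiv ℝ (fun x : Fin d → ℝ => φ (cover d x)) x (Pi.single j 1) := by
    funext x
    have h1 : HasDerivAt (fun t : ℝ => x + t • (Pi.single j 1 : Fin d → ℝ)) (Pi.single j 1) 0 := by
      simpa using ((hasDerivAt_id (0 : ℝ)).smul_const (Pi.single j 1 : Fin d → ℝ)).const_add x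
    have h2 : HasFDerivAt (fun x : Fin d → ℝ => φ (cover d x))
        (fderiv ℝ (fun x : Fin d → ℝ => φ (cover d x)) x)
        (x + (0 : ℝ) • (Pi.single j 1 : Fin d → ℝ)) := by
      simpa using (ContDiff.differentiable h (by simp) x).hasFDerivAt
    have h3 := h2.comp_hasDerivAt (0 : ℝ) h1
    have h4 : ((fun x : Fin d → ℝ => φ (cover d x)) ∘
        fun t : ℝ => x + t • (Pi.single j 1 : Fin d → ℝ)) =
        fun t : ℝ => φ (cover d x + Pi.single j (t : UnitAddCircle)) := by
      funext t
      simp only [Function.comp]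
      congr 1
      funext i
      by_cases hij : i = j
      · subst hij
        simp [cover]
      · simp [cover, hij]
    rw [h4] at h3
    exact h3.deriv
  rw [key]
  exact (ContDiff.continuous_fderiv h (by simp)).clm_apply continuous_const

theorem integral_mul_eq_inner {d : ℕ} (u : L2 d) (ψ : C(Torus d, ℝ)) :
    ∫ x, u x * ψ x = inner ℝ (ContinuousMap.toLp 2 volume ℝ ψ) u := by
  rw [MeasureTheory.L2.inner_def]
  refine integral_congr_ae ?_
  filter_upwards [ContinuousMap.coeFn_toLp (p := 2) (𝕜 := ℝ)
    (volume : Measure (Torus d)) ψ] with x hx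
  rw [hx]
  simp

/-- The pairing of `(u, g)` with the pair of test functions `(ψ, φ)`, as a continuous functional. -/
noncomputable def testPairing {d : ℕ} (j : Fin d) (ψ φ : C(Torus d, ℝ)) :
    WithLp 2 (L2 d × L2Vec d) →L[ℝ] ℝ :=
  (innerSL ℝ (ContinuousMap.toLp 2 volume ℝ ψ : L2 d)).comp (WithLp.fstL 2 ℝ (L2 d) (L2Vec d)) +
    (innerSL ℝ (ContinuousMap.toLp 2 volume ℝ φ : L2 d)).comp
      ((PiLp.proj 2 (fun _ : Fin d => L2 d) j).comp (WithLp.sndL 2 ℝ (L2 d) (L2Vec d)))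

theorem isWeakPartialDeriv_iff {d : ℕ} (j : Fin d) (z : WithLp 2 (L2 d × L2Vec d)) :
    IsWeakPartialDeriv j z.fst (z.snd j) ↔ ∀ (φ : Torus d → ℝ) (h : IsSmooth φ),
      testPairing j ⟨_, h.continuous_partialDeriv j⟩ ⟨φ, h.continuous⟩ z = 0 := by
  refine forall_congr' fun φ => forall_congr' fun h => ?_
  have h1 := integral_mul_eq_inner z.fst ⟨_, h.continuous_partialDeriv j⟩
  have h2 := integral_mul_eq_inner (z.snd j) ⟨φ, h.continuous⟩
  simp only [ContinuousMap.coe_mk] at h1 h2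
  rw [h1, h2, eq_neg_iff_add_eq_zero]
  simp [testPairing]

/-- The pairs `(u, g)` in `L² ⊕ (L²)^d` such that `g` is the weak gradient of `u`. -/
noncomputable def gradGraph (d : ℕ) : Submodule ℝ (WithLp 2 (L2 d × L2Vec d)) where
  carrier := {z | ∀ j : Fin d, IsWeakPartialDeriv j z.fst (z.snd j)}
  zero_mem' j := (isWeakPartialDeriv_iff j 0).2 fun _ _ => map_zero _
  add_mem' {a b} ha hb j := (isWeakPartialDeriv_iff j (a + b)).2 fun φ h => by
    rw [map_add, (isWeakPartialDeriv_iff j a).1 (ha j) φ h,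
      (isWeakPartialDeriv_iff j b).1 (hb j) φ h, add_zero]
  smul_mem' c a ha j := (isWeakPartialDeriv_iff j (c • a)).2 fun φ h => by
    rw [map_smul, (isWeakPartialDeriv_iff j a).1 (ha j) φ h, smul_zero]

instance completeSpace_gradGraph (d : ℕ) : CompleteSpace (gradGraph d) := by
  refine completeSpace_coe_iff_isComplete.2 (IsClosed.isComplete ?_)
  have : (gradGraph d : Set (WithLp 2 (L2 d × L2Vec d))) =
      ⋂ (j : Fin d) (φ : Torus d → ℝ) (h : IsSmooth φ),
        {z | testPairing j ⟨_, h.continuous_partialDeriv j⟩ ⟨φ, h.continuous⟩ z = 0} := by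
    ext z
    simp only [Set.mem_iInter, Set.mem_ofPred_eq]
    exact forall_congr' fun j => isWeakPartialDeriv_iff j z
  rw [this]
  exact isClosed_iInter fun j => isClosed_iInter fun φ => isClosed_iInter fun h =>
    isClosed_eq (ContinuousLinearMap.continuous _) continuous_const

/-- The space `X = H¹` of the torus. An element is a function `u ∈ L²` together with its weak
gradient, which is required to be in `L²` (and is determined by `u`). -/
def H1 (d : ℕ) : Type := gradGraph d

/-- The norm of `H¹`, inherited from the Hilbert sum `L² ⊕ (L²)^d`. -/
noncomputable instance normedAddCommGroup_H1 (d : ℕ) : NormedAddCommGroup (H1 d) :=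
  inferInstanceAs (NormedAddCommGroup (gradGraph d))

/-- The inner product `(u, v)_X = ∫ u v + ∫ ∇u · ∇v` of `H¹`, inherited from `L² ⊕ (L²)^d`. -/
noncomputable instance innerProductSpace_H1 (d : ℕ) : InnerProductSpace ℝ (H1 d) :=
  inferInstanceAs (InnerProductSpace ℝ (gradGraph d))

instance completeSpace_H1 (d : ℕ) : CompleteSpace (H1 d) :=
  inferInstanceAs (CompleteSpace (gradGraph d))

/-- The underlying `L²` function of an element of `H¹`, as a continuous linear map `H¹ → L²`. -/
noncomputable def toL2 (d : ℕ) : H1 d →L[ℝ] L2 d :=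
  (WithLp.fstL 2 ℝ (L2 d) (L2Vec d)).comp (gradGraph d).subtypeL

/-- The weak partial derivative `∂u/∂x_j` of an element of `H¹`. -/
noncomputable def grad {d : ℕ} (u : H1 d) (j : Fin d) : L2 d :=
  (Subtype.val (p := (· ∈ gradGraph d)) u).snd j

theorem isWeakPartialDeriv_grad {d : ℕ} (u : H1 d) (j : Fin d) :
    IsWeakPartialDeriv j (toL2 d u) (grad u j) :=
  Subtype.property (p := (· ∈ gradGraph d)) u j

theorem inner_H1 {d : ℕ} (u v : H1 d) :
    inner ℝ u v = inner ℝ (toL2 d u) (toL2 d v) + ∑ j, inner ℝ (grad u j) (grad v j) := by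
  change inner ℝ (Subtype.val (p := (· ∈ gradGraph d)) u)
    (Subtype.val (p := (· ∈ gradGraph d)) v) = _
  rw [WithLp.prod_inner_apply, PiLp.inner_apply]
  rfl

/-- The Sobolev space `H^r` of the torus, for real `r ≥ 0`:
the square integrable functions with `∑_k (1 + |2πk|²)^r |v̂_k|² < ∞`. -/
def MemSobolev {d : ℕ} (r : ℝ) (v : Torus d → ℝ) : Prop :=
  MemLp v 2 ∧ Summable fun k : Fin d → ℤ =>
    (1 + ∑ i, (2 * Real.pi * (k i : ℝ)) ^ 2) ^ r * ‖mFourierCoeff (fun x => (v x : ℂ)) k‖ ^ 2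

/-- The energy `½ ∫ |∇u|² + ½ ∫ V u² + ¼ ∫ u⁴`. -/
noncomputable def energy {d : ℕ} (V : Torus d → ℝ) (u : H1 d) : ℝ :=
  1 / 2 * (∫ x, ∑ j, grad u j x ^ 2) + 1 / 2 * (∫ x, V x * toL2 d u x ^ 2)
    + 1 / 4 * (∫ x, toL2 d u x ^ 4)

/-- `u` minimises the energy over the functions of `L²`-norm one in the subspace `S` of `H¹`. -/
def IsConstrainedMinimiser {d : ℕ} (V : Torus d → ℝ) (S : Submodule ℝ (H1 d)) (u : H1 d) : Prop :=
  u ∈ S ∧ ‖toL2 d u‖ = 1 ∧ ∀ v ∈ S, ‖toL2 d v‖ = 1 → energy V u ≤ energy V v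

/-- A real-valued square integrable function, regarded as complex-valued. -/
noncomputable def complexify (d : ℕ) : L2 d →L[ℝ] Lp ℂ 2 (volume : Measure (Torus d)) :=
  Complex.ofRealCLM.compLpL 2 volume

/-- The spectral Fourier space `X_N`: the (real-valued) functions of `H¹` in the complex span of
the plane waves `x ↦ exp(2πi k·x)` with `k ∈ ℤ^d`, `|k| ≤ N`. -/
noncomputable def fourierSpace (d N : ℕ) : Submodule ℝ (H1 d) :=
  ((Submodule.span ℂ (mFourierLp 2 '' {k : Fin d → ℤ | ∑ i, (k i) ^ 2 ≤ (N : ℤ) ^ 2})).restrictScalars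
    ℝ).comap ((complexify d).comp (toL2 d)).toLinearMap

theorem finite_wavenumbers (d N : ℕ) :
    {k : Fin d → ℤ | ∑ i, (k i) ^ 2 ≤ (N : ℤ) ^ 2}.Finite := by
  refine (Set.finite_Icc (fun _ : Fin d => -(N : ℤ)) (fun _ => (N : ℤ))).subset fun k hk => ?_
  have h : ∀ i, |k i| ≤ (N : ℤ) := fun i => abs_le_of_sq_le_sq
    ((Finset.single_le_sum (fun i _ => sq_nonneg (k i)) (Finset.mem_univ i)).trans hk) (by simp)
  exact ⟨fun i => (abs_le.1 (h i)).1, fun i => (abs_le.1 (h i)).2⟩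

instance completeSpace_fourierSpace (d N : ℕ) : CompleteSpace (fourierSpace d N) := by
  have : FiniteDimensional ℂ (Submodule.span ℂ
      (mFourierLp 2 '' {k : Fin d → ℤ | ∑ i, (k i) ^ 2 ≤ (N : ℤ) ^ 2})) :=
    FiniteDimensional.span_of_finite ℂ ((finite_wavenumbers d N).image _)
  exact completeSpace_coe_iff_isComplete.2 (IsClosed.isComplete
    ((Submodule.closed_of_finiteDimensional (Submodule.span ℂ
      (mFourierLp 2 '' {k : Fin d → ℤ | ∑ i, (k i) ^ 2 ≤ (N : ℤ) ^ 2}))).preimage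
      ((complexify d).comp (toL2 d)).continuous))

/-- The `(·,·)_X`-orthogonal projection `Π_N : X → X_N ⊂ X`. -/
noncomputable def fourierProj (d N : ℕ) : H1 d →L[ℝ] H1 d :=
  (fourierSpace d N).starProjection

end GrossPitaevskii

open GrossPitaevskii

/-! Write `u` for the ground state, `uN` for a discrete minimiser, `w = Π_N u`, `s = u - uN`, `λ`
for the Lagrange multiplier of `u`, and `L_c = -Δ + V + c u² - λ`. Then `L_1 u = 0`, and `L_3` is
the second derivative of the constrained energy. The proof is an Aubin–Nitsche duality argument
carried out inside `X_N`. Let `e` be the part of `w - uN` that is `L²`-orthogonal to `uN`, so that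
`w - uN = e + α uN`, and let `ψ ∈ X_N`, `ψ ⊥ uN`, solve `L_3 ψ = e` against that space
(`exists_dual`). Then `‖e‖² = ⟨L_3 s, ψ⟩ - ⟨L_3 (u - w), ψ⟩ - α ⟨L_3 uN, ψ⟩`.

Subtracting the two Euler–Lagrange equations turns the first term into `∫ (3 u s² - s³) ψ`, which is
of higher order (`form_sub_eq`). In the second, `Π_N` is Fourier truncation, so the gradient and `λ`
parts vanish and only `(V + 3u²)(u - w)` against `ψ` remains. Since `V`, `u²` and `ψ` lie in the
algebra `H²`, with a bound on `ψ` uniform in `N`, this pairs an `H²` function with frequencies above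
`N` and gains the factor `N⁻³` (`exists_consistency`). In the third, `α = -½ ‖s‖²` by the
normalisations. Hence `‖w - uN‖ ≤ C (‖s‖² + ‖s‖_{H¹}⁴ + N⁻³ ‖u - w‖_{H¹})`. Quasi-optimality
`‖s‖_{H¹} ≤ Q ‖u - w‖_{H¹}` and `u ∈ H²` absorb the nonlinear terms in two passes (`bootstrap`), and
the inverse inequality on `X_N` supplies the `H¹` part.

Coercivity rests on positivity of `u`. The maximum principle gives `0 < c ≤ u ≤ √λ`, whence `u ∈
H²`; the substitution `v = u q` turns `⟨L_1 v, v⟩` into `∫ u² |∇q|²`, and the Poincaré inequality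
yields a spectral gap (`exists_gap`). The exact identity `energy_sub` for the energy excess converts
the gap into global quasi-optimality, so no step needs `N` large.

The analysis is done on Fourier coefficients. The dimension enters through the convergence of `∑ (1
+ |2πk|²)⁻²`, which gives the embeddings `H² ⊂ L^∞` and `H¹ ⊂ L⁴` and the algebra property. -/

open Complex Filter Topology ComplexConjugate
open scoped ENNReal

namespace GrossPitaevskii

/-! ### Fourier coefficients of real square integrable functions -/

variable {d : ℕ}

/-- The Fourier coefficients of a real-valued square integrable function. -/
noncomputable def fc (f : L2 d) (k : Fin d → ℤ) : ℂ := mFourierBasis.repr (complexify d f) k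

theorem coeFn_complexify (f : L2 d) : complexify d f =ᵐ[volume] fun x => (f x : ℂ) :=
  ContinuousLinearMap.coeFn_compLpL _ _

theorem fc_sub (f g : L2 d) (k : Fin d → ℤ) : fc (f - g) k = fc f k - fc g k := by
  simp [fc]

theorem fc_eq_mFourierCoeff (f : L2 d) (k : Fin d → ℤ) :
    fc f k = mFourierCoeff (fun x => (f x : ℂ)) k := by
  rw [fc, mFourierBasis_repr]
  refine integral_congr_ae ?_
  filter_upwards [coeFn_complexify f] with x hx
  rw [hx]

theorem mFourierCoeff_ofReal_neg (f : Torus d → ℝ) (k : Fin d → ℤ) :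
    mFourierCoeff (fun x => (f x : ℂ)) (-k) = conj (mFourierCoeff (fun x => (f x : ℂ)) k) := by
  rw [mFourierCoeff, mFourierCoeff, ← integral_conj]
  refine integral_congr_ae (ae_of_all _ fun x => ?_)
  simp [← mFourier_neg]

theorem fc_neg_index (f : L2 d) (k : Fin d → ℤ) : fc f (-k) = conj (fc f k) := by
  rw [fc_eq_mFourierCoeff, fc_eq_mFourierCoeff, mFourierCoeff_ofReal_neg]

theorem inner_complexify (f g : L2 d) :
    inner ℂ (complexify d f) (complexify d g) = ((inner ℝ f g : ℝ) : ℂ) := by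
  rw [L2.inner_def, L2.inner_def, ← integral_complex_ofReal]
  refine integral_congr_ae ?_
  filter_upwards [coeFn_complexify f, coeFn_complexify g] with x hx hy
  rw [hx, hy]
  simp

theorem hasSum_inner_fc (f g : L2 d) :
    HasSum (fun k => conj (fc f k) * fc g k) ((inner ℝ f g : ℝ) : ℂ) := by
  rw [← inner_complexify]
  refine (mFourierBasis.hasSum_inner_mul_inner (complexify d f) (complexify d g)).congr_fun
    fun k => ?_
  rw [fc, fc, HilbertBasis.repr_apply_apply, HilbertBasis.repr_apply_apply, inner_conj_symm]

theorem hasSum_re_inner_fc (f g : L2 d) :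
    HasSum (fun k => (conj (fc f k) * fc g k).re) (inner ℝ f g) := by
  simpa using Complex.hasSum_re (hasSum_inner_fc f g)

theorem hasSum_sq_fc (f : L2 d) : HasSum (fun k => ‖fc f k‖ ^ 2) (‖f‖ ^ 2) := by
  have h := hasSum_re_inner_fc f f
  rw [real_inner_self_eq_norm_sq] at h
  refine h.congr_fun fun k => ?_
  rw [← Complex.normSq_eq_conj_mul_self, Complex.ofReal_re, Complex.normSq_eq_norm_sq]

theorem norm_fc_le (f : L2 d) (k : Fin d → ℤ) : ‖fc f k‖ ≤ ‖f‖ := by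
  have := le_hasSum (hasSum_sq_fc f) k fun j _ => sq_nonneg _
  exact abs_le_of_sq_le_sq' this (norm_nonneg _) |>.2

theorem fc_injective {f g : L2 d} (h : ∀ k, fc f k = fc g k) : f = g := by
  have h1 := hasSum_sq_fc (f - g)
  have h2 : (fun k => ‖fc (f - g) k‖ ^ 2) = fun _ => 0 := by
    funext k; rw [fc_sub, h k, sub_self]; simp
  rw [h2] at h1
  have := h1.unique hasSum_zero
  exact sub_eq_zero.1 (norm_eq_zero.1 (pow_eq_zero_iff two_ne_zero |>.1 this))

/-- Taking real parts symmetrises the coefficients under `k ↦ -k` with conjugation. A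
conjugate-symmetric sequence is left unchanged, which is how the complex Riesz–Fischer theorem
descends to real functions. -/
theorem mFourierBasis_repr_ofReal_re (F : Lp ℂ 2 (volume : Measure (Torus d))) (k : Fin d → ℤ) :
    fc (Complex.reCLM.compLpL 2 volume F) k
      = (mFourierBasis.repr F k + conj (mFourierBasis.repr F (-k))) / 2 := by
  rw [fc_eq_mFourierCoeff, mFourierBasis_repr, mFourierBasis_repr, mFourierCoeff, mFourierCoeff,
    mFourierCoeff, ← integral_conj, ← integral_add, ← integral_div]
  · refine integral_congr_ae ?_
    filter_upwards [Complex.reCLM.coeFn_compLpL (p := 2) (μ := volume) F] with x hx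
    have h2 : ((F x).re : ℂ) = (F x + conj (F x)) / 2 := by
      rw [Complex.add_conj]; push_cast; ring
    rw [hx]
    simp only [neg_neg, smul_eq_mul, map_mul, ← mFourier_neg, reCLM_apply, h2]
    ring
  · exact (((Lp.memLp F).integrable (by norm_num)).bdd_mul (c := 1)
      (mFourier (-k)).continuous.aestronglyMeasurable (ae_of_all _ fun x =>
        ((mFourier (-k)).norm_coe_le_norm x).trans mFourier_norm.le))
  · exact LinearIsometryEquiv.integrable_comp_iff Complex.conjLIE |>.2
      (((Lp.memLp F).integrable (by norm_num)).bdd_mul (c := 1)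
      (mFourier (- -k)).continuous.aestronglyMeasurable (ae_of_all _ fun x =>
        ((mFourier (- -k)).norm_coe_le_norm x).trans mFourier_norm.le))

/-- Riesz–Fischer theorem for real-valued functions on the torus. -/
theorem exists_fc_eq (c : (Fin d → ℤ) → ℂ) (hc : ∀ k, c (-k) = conj (c k))
    (hs : Summable fun k => ‖c k‖ ^ 2) : ∃ f : L2 d, ∀ k, fc f k = c k := by
  have hm : Memℓp c 2 := by
    rw [memℓp_gen_iff (by norm_num)]
    simpa using hs
  refine ⟨Complex.reCLM.compLpL 2 volume (mFourierBasis.repr.symm ⟨c, hm⟩), fun k => ?_⟩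
  rw [mFourierBasis_repr_ofReal_re]
  simp only [LinearIsometryEquiv.apply_symm_apply]
  rw [hc k]
  simp

theorem integrable_mul_L2 (f g : L2 d) : Integrable (fun x => f x * g x) :=
  (Lp.memLp f).integrable_mul (Lp.memLp g)

theorem inner_eq_integral (f g : L2 d) : inner ℝ f g = ∫ x, f x * g x := by
  rw [L2.inner_def]
  refine integral_congr_ae (ae_of_all _ fun x => ?_)
  simp [mul_comm]

/-- The Fourier coefficients of a product are the convolution of the coefficients. -/
theorem hasSum_fc_mul (f g : L2 d) (k : Fin d → ℤ) :
    HasSum (fun l => fc f l * fc g (k - l))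
      (mFourierCoeff (fun x => ((f x * g x : ℝ) : ℂ)) k) := by
  -- The `k`-th coefficient of `f g` is the `L²` pairing of the real function `f` with `g` modulated
  -- by the wave of index `-k`; Parseval applied to this pairing is the convolution, up to `l ↦ -l`.
  have hG : MemLp (fun x => mFourier (-k) x * complexify d g x) 2 volume := by
    refine MemLp.of_le (Lp.memLp (complexify d g)) ((mFourier
      (-k)).continuous.aestronglyMeasurable.mul (Lp.aestronglyMeasurable _))
      (ae_of_all _ fun x => ?_)
    rw [norm_mul]
    exact mul_le_of_le_one_left (norm_nonneg _)
      (((mFourier (-k)).norm_coe_le_norm x).trans mFourier_norm.le)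
  have h1 := mFourierBasis.hasSum_inner_mul_inner (complexify d f) hG.toLp
  have h2 : inner ℂ (complexify d f) hG.toLp
      = mFourierCoeff (fun x => ((f x * g x : ℝ) : ℂ)) k := by
    rw [L2.inner_def, mFourierCoeff]
    refine integral_congr_ae ?_
    filter_upwards [coeFn_complexify f, coeFn_complexify g, hG.coeFn_toLp] with x hx hy hz
    rw [hz, hx, hy]
    simp
    ring
  have h3 : ∀ l, inner ℂ (mFourierBasis l) hG.toLp = fc g (k + l) := fun l => by
    rw [← HilbertBasis.repr_apply_apply, mFourierBasis_repr, fc, mFourierBasis_repr]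
    refine integral_congr_ae ?_
    filter_upwards [hG.coeFn_toLp] with x hz
    rw [hz, smul_eq_mul, smul_eq_mul, ← mul_assoc, ← mFourier_add]
    congr 2
    rw [neg_add_rev]
  rw [h2] at h1
  rw [← (Equiv.neg _).hasSum_iff]
  refine h1.congr_fun fun l => ?_
  rw [h3, ← inner_conj_symm, ← HilbertBasis.repr_apply_apply]
  change _ = conj (fc f l) * _
  simp only [Function.comp, Equiv.neg_apply, fc_neg_index, sub_neg_eq_add]

/-! ### Weak derivatives as Fourier multipliers -/

/-- The integral over the torus of a continuous directional derivative vanishes. -/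
theorem integral_deriv_eq_zero {E : Type*} [NormedAddCommGroup E] [NormedSpace ℝ E]
    [CompleteSpace E] (j : Fin d) {ψ ψ' : Torus d → E} (hψ : Continuous ψ) (hψ' : Continuous ψ')
    (h : ∀ p, HasDerivAt (fun t : ℝ => ψ (p + Pi.single j (t : UnitAddCircle))) (ψ' p) 0) :
    ∫ x, ψ' x = 0 := by
  set e : ℝ → Torus d := fun t => Pi.single j (t : UnitAddCircle) with he
  obtain ⟨B, hB⟩ := isCompact_univ.exists_bound_of_continuousOn hψ'.continuousOn
  have hd : ∀ p (t : ℝ), HasDerivAt (fun t : ℝ => ψ (p + e t))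
      (ψ' (p + e t)) t := fun p t => by
    have h1 := h (p + e t)
    have h2 : HasDerivAt (fun s : ℝ => s - t) 1 t := (hasDerivAt_id t).sub_const t
    have h3 := HasDerivAt.scomp (h := fun s : ℝ => s - t) t (by rwa [← sub_self t] at h1) h2
    rw [one_smul] at h3
    refine h3.congr_of_eventuallyEq (Eventually.of_forall fun s => ?_)
    simp only [Function.comp]
    rw [add_assoc, show e t + e (s - t) = e s by rw [he]; simp only [← Pi.single_add, ← AddCircle.coe_add, add_sub_cancel]]
  have hcont : ∀ t : ℝ, Continuous fun p : Torus d => p + e t :=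
    fun t => continuous_id.add continuous_const
  have key := hasDerivAt_integral_of_dominated_loc_of_deriv_le (μ := (volume : Measure (Torus d)))
    (F := fun (t : ℝ) p => ψ (p + e t))
    (F' := fun (t : ℝ) p => ψ' (p + e t)) (x₀ := 0)
    (s := Set.univ) (bound := fun _ => B) Filter.univ_mem
    (Eventually.of_forall fun t => (hψ.comp (hcont t)).aestronglyMeasurable)
    ((hψ.comp (hcont 0)).integrable_of_hasCompactSupport (HasCompactSupport.of_compactSpace _))
    (hψ'.comp (hcont 0)).aestronglyMeasurable
    (ae_of_all _ fun p t _ => hB _ trivial) (integrable_const _)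
    (ae_of_all _ fun p t _ => hd p t)
  -- Translation invariance: the integral does not depend on `t`, so its derivative, the integral of
  -- `ψ'`, is zero.
  have h4 : (fun t : ℝ => ∫ p, ψ (p + e t)) = fun _ => ∫ p, ψ p := by
    funext t
    have : Measure.IsAddHaarMeasure (volume : Measure UnitAddCircle) :=
      inferInstanceAs (Measure.IsAddHaarMeasure AddCircle.haarAddCircle)
    have : (volume : Measure (Torus d)).IsAddHaarMeasure :=
      inferInstanceAs (Measure.pi fun _ : Fin d => (volume : Measure UnitAddCircle)).IsAddHaarMeasure
    exact integral_add_right_eq_self ψ _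
  rw [h4] at key
  have h5 := key.2.unique (hasDerivAt_const _ _)
  have h6 : e 0 = 0 := by simp [he]
  simpa [h6] using h5

theorem IsSmooth.hasDerivAt {φ : Torus d → ℝ} (h : IsSmooth φ) (j : Fin d) (p : Torus d) :
    HasDerivAt (fun t : ℝ => φ (p + Pi.single j (t : UnitAddCircle))) (partialDeriv j φ p) 0 := by
  obtain ⟨x, rfl⟩ := (isOpenQuotientMap_cover d).surjective p
  refine DifferentiableAt.hasDerivAt ?_
  have h1 : DifferentiableAt ℝ (fun t : ℝ => x + t • (Pi.single j 1 : Fin d → ℝ)) 0 := by fun_prop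
  have h2 := (ContDiff.differentiable h (by simp) (x + (0 : ℝ) • (Pi.single j 1 : Fin d → ℝ))).comp
    (0 : ℝ) h1
  refine h2.congr_of_eventuallyEq (Eventually.of_forall fun t => ?_)
  simp only [Function.comp]
  congr 1
  funext i
  by_cases hij : i = j
  · subst hij
    simp [cover]
  · simp [cover, hij]

theorem mFourier_add_arg (k : Fin d → ℤ) (p q : Torus d) :
    mFourier k (p + q) = mFourier k p * mFourier k q := by
  simp only [mFourier, ContinuousMap.coe_mk, ← Finset.prod_mul_distrib]
  refine Finset.prod_congr rfl fun i _ => ?_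
  simp [fourier_apply, smul_add, AddCircle.toCircle_add]

theorem mFourier_cover (k : Fin d → ℤ) (x : Fin d → ℝ) :
    mFourier k (cover d x) = Complex.exp (2 * Real.pi * I * ∑ i, (k i : ℂ) * x i) := by
  simp only [mFourier, ContinuousMap.coe_mk, cover, fourier_coe_apply, Finset.mul_sum,
    Complex.exp_sum]
  refine Finset.prod_congr rfl fun i _ => ?_
  congr 1
  simp
  ring

theorem mFourier_single_arg (k : Fin d → ℤ) (j : Fin d) (t : ℝ) :
    mFourier k (Pi.single j (t : UnitAddCircle)) = Complex.exp (2 * Real.pi * I * k j * t) := by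
  have : (Pi.single j (t : UnitAddCircle) : Torus d) = cover d (Pi.single j t) := by
    funext i
    by_cases hij : i = j
    · subst hij
      simp [cover]
    · simp [cover, hij]
  rw [this, mFourier_cover, Finset.sum_eq_single j]
  · simp; ring_nf
  · intro b _ hb
    simp [hb]
  · simp

theorem hasDerivAt_mFourier (k : Fin d → ℤ) (j : Fin d) (p : Torus d) :
    HasDerivAt (fun t : ℝ => mFourier k (p + Pi.single j (t : UnitAddCircle)))
      (2 * Real.pi * I * k j * mFourier k p) 0 := by
  simp only [mFourier_add_arg, mFourier_single_arg]
  have h1 : HasDerivAt (fun t : ℝ => 2 * Real.pi * I * k j * (t : ℂ))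
      (2 * Real.pi * I * k j * 1) 0 := (Complex.ofRealCLM.hasDerivAt (x := 0)).const_mul _
  have h2 := (h1.cexp).const_mul (mFourier k p)
  convert! h2 using 1
  simp
  ring

theorem isSmooth_re_mFourier (z : ℂ) (k : Fin d → ℤ) :
    IsSmooth fun p : Torus d => (z * mFourier k p).re := by
  simp only [IsSmooth, mFourier_cover]
  refine Complex.reCLM.contDiff.comp (contDiff_const.mul ?_)
  refine ContDiff.cexp (contDiff_const.mul (ContDiff.sum fun i _ => contDiff_const.mul ?_))
  exact Complex.ofRealCLM.contDiff.comp (contDiff_apply ℝ ℝ i)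

theorem partialDeriv_re_mFourier (z : ℂ) (k : Fin d → ℤ) (j : Fin d) (p : Torus d) :
    partialDeriv j (fun p : Torus d => (z * mFourier k p).re) p
      = (z * (2 * Real.pi * I * k j * mFourier k p)).re :=
  (Complex.reCLM.hasFDerivAt.comp_hasDerivAt 0 ((hasDerivAt_mFourier k j p).const_mul z)).deriv

theorem integrable_mFourier_mul (k : Fin d → ℤ) (f : L2 d) :
    Integrable fun x => mFourier k x * (f x : ℂ) :=
  (((Lp.memLp f).integrable (by norm_num)).ofReal (𝕜 := ℂ)).bdd_mul (c := 1)
      (mFourier k).continuous.aestronglyMeasurable (ae_of_all _ fun x =>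
        ((mFourier k).norm_coe_le_norm x).trans mFourier_norm.le)

theorem re_mul_fc (z : ℂ) (f : L2 d) (k : Fin d → ℤ) :
    (z * fc f k).re = ∫ x, f x * (z * mFourier (-k) x).re := by
  rw [fc_eq_mFourierCoeff, mFourierCoeff, ← integral_const_mul, ← reCLM_apply,
    ← ContinuousLinearMap.integral_comp_comm]
  · refine integral_congr_ae (ae_of_all _ fun x => ?_)
    simp only [smul_eq_mul, reCLM_apply]
    rw [← mul_assoc, mul_comm, re_ofReal_mul]
  · exact (integrable_mFourier_mul (-k) f).const_mul z

/-- Integration by parts against a plane wave: the total derivative of `φ` times the wave has zero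
integral. -/
theorem IsSmooth.fc_partialDeriv {φ : Torus d → ℝ} (h : IsSmooth φ) (j : Fin d) (k : Fin d → ℤ) :
    fc (ContinuousMap.toLp 2 volume ℝ ⟨_, h.continuous_partialDeriv j⟩ : L2 d) k
      = 2 * Real.pi * I * k j * fc (ContinuousMap.toLp 2 volume ℝ ⟨φ, h.continuous⟩ : L2 d) k := by
  have hφ := h.continuous
  have hφ' := h.continuous_partialDeriv j
  have key := integral_deriv_eq_zero j
    (ψ := fun p => mFourier (-k) p * (φ p : ℂ))
    (ψ' := fun p => 2 * Real.pi * I * ((-k) j : ℤ) * mFourier (-k) p * (φ p : ℂ)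
      + mFourier (-k) p * (partialDeriv j φ p : ℂ)) (by fun_prop) (by fun_prop)
    (fun p => by
      have := (hasDerivAt_mFourier (-k) j p).mul (h.hasDerivAt j p).ofReal_comp
      convert! this using 1
      simp)
  have hi : ∀ g : Torus d → ℂ, Continuous g → Integrable g := fun g hg =>
    hg.integrable_of_hasCompactSupport (HasCompactSupport.of_compactSpace _)
  rw [integral_add (hi _ (by fun_prop)) (hi _ (by fun_prop))] at key
  simp only [mul_assoc (2 * Real.pi * I * ((-k) j : ℤ) : ℂ)] at key
  rw [integral_const_mul] at key
  have hc : ∀ (g : Torus d → ℝ) (hg : Continuous g),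
      fc (ContinuousMap.toLp 2 volume ℝ ⟨g, hg⟩ : L2 d) k
        = ∫ x, mFourier (-k) x * (g x : ℂ) := fun g hg => by
    rw [fc_eq_mFourierCoeff, mFourierCoeff]
    refine integral_congr_ae ?_
    filter_upwards [ContinuousMap.coeFn_toLp (p := 2) (𝕜 := ℝ)
      (volume : Measure (Torus d)) ⟨g, hg⟩] with x hx
    rw [hx]
    rfl
  rw [hc, hc, eq_comm]
  simp only [Pi.neg_apply, Int.cast_neg] at key
  linear_combination -key

/-- The weak partial derivative in terms of Fourier coefficients. -/
theorem isWeakPartialDeriv_iff_fc (j : Fin d) (u g : L2 d) :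
    IsWeakPartialDeriv j u g ↔ ∀ k, fc g k = 2 * Real.pi * I * k j * fc u k := by
  constructor
  · intro h k
    -- The test functions are the real parts of `z` times a plane wave. Taking `z = 1` and `z = -I`
    -- recovers the real and the imaginary part.
    have key : ∀ z : ℂ, (z * fc g k).re = (z * (2 * Real.pi * I * k j * fc u k)).re := fun z => by
      have h1 := h _ (isSmooth_re_mFourier z (-k))
      simp only [partialDeriv_re_mFourier] at h1
      have h2 := re_mul_fc (z * (2 * Real.pi * I * ((-k) j : ℤ))) u k
      simp only [mul_assoc] at h1 h2
      rw [← h2, ← re_mul_fc] at h1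
      rw [← neg_eq_iff_eq_neg.2 h1, ← neg_re]
      congr 1
      simp only [Pi.neg_apply, Int.cast_neg]
      ring
    refine Complex.ext ?_ ?_
    · simpa using key 1
    · simpa using key (-I)
  · intro h φ hφ
    have h1 := integral_mul_eq_inner u ⟨_, hφ.continuous_partialDeriv j⟩
    have h2 := integral_mul_eq_inner g ⟨φ, hφ.continuous⟩
    simp only [ContinuousMap.coe_mk] at h1 h2
    rw [h1, h2, ← Complex.ofReal_inj, Complex.ofReal_neg]
    refine (hasSum_inner_fc _ _).unique ((hasSum_inner_fc _ _).neg.congr_fun fun k => ?_)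
    rw [hφ.fc_partialDeriv, h k]
    simp only [map_mul, conj_I, conj_ofReal, map_ofNat, map_intCast]
    ring

/-! ### `H¹`, the spaces `X_N` and the projections in Fourier variables -/

/-- The Fourier symbol `1 + |2πk|²` of `1 - Δ`. -/
noncomputable def wt (k : Fin d → ℤ) : ℝ := 1 + ∑ i, (2 * Real.pi * (k i : ℝ)) ^ 2

theorem one_le_wt (k : Fin d → ℤ) : 1 ≤ wt k :=
  le_add_of_nonneg_right (Finset.sum_nonneg fun _ _ => sq_nonneg _)

theorem wt_pos (k : Fin d → ℤ) : 0 < wt k := zero_lt_one.trans_le (one_le_wt k)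

theorem wt_neg (k : Fin d → ℤ) : wt (-k) = wt k := by simp [wt]

theorem wt_zero : wt (0 : Fin d → ℤ) = 1 := by simp [wt]

theorem grad_add (u v : H1 d) (j : Fin d) : grad (u + v) j = grad u j + grad v j := rfl

theorem grad_sub (u v : H1 d) (j : Fin d) : grad (u - v) j = grad u j - grad v j := rfl

theorem grad_smul (c : ℝ) (u : H1 d) (j : Fin d) : grad (c • u) j = c • grad u j := rfl

theorem fc_grad (u : H1 d) (j : Fin d) (k : Fin d → ℤ) :
    fc (grad u j) k = 2 * Real.pi * I * k j * fc (toL2 d u) k :=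
  (isWeakPartialDeriv_iff_fc j _ _).1 (isWeakPartialDeriv_grad u j) k

theorem exists_H1 (f : L2 d) (g : Fin d → L2 d) (h : ∀ j, IsWeakPartialDeriv j f (g j)) :
    ∃ v : H1 d, toL2 d v = f ∧ ∀ j, grad v j = g j :=
  ⟨(⟨WithLp.toLp 2 (f, WithLp.toLp 2 g), h⟩ : gradGraph d), rfl, fun _ => rfl⟩

theorem hasSum_inner_H1 (u v : H1 d) :
    HasSum (fun k => wt k * (conj (fc (toL2 d u) k) * fc (toL2 d v) k).re) (inner ℝ u v) := by
  rw [inner_H1]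
  refine ((hasSum_re_inner_fc (toL2 d u) (toL2 d v)).add
    (hasSum_sum fun j _ => hasSum_re_inner_fc (grad u j) (grad v j))).congr_fun fun k => ?_
  rw [wt, add_mul, one_mul, Finset.sum_mul]
  congr 1
  refine Finset.sum_congr rfl fun j _ => ?_
  rw [fc_grad, fc_grad, ← re_ofReal_mul]
  congr 1
  simp only [map_mul, conj_I, conj_ofReal, map_ofNat, map_intCast]
  push_cast
  linear_combination (4 * (Real.pi : ℂ) ^ 2 * k j ^ 2 * conj (fc (toL2 d u) k) * fc (toL2 d v) k)
    * (Complex.I_sq)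

theorem hasSum_norm_H1 (u : H1 d) :
    HasSum (fun k => wt k * ‖fc (toL2 d u) k‖ ^ 2) (‖u‖ ^ 2) := by
  have h := hasSum_inner_H1 u u
  rw [real_inner_self_eq_norm_sq] at h
  refine h.congr_fun fun k => ?_
  rw [← Complex.normSq_eq_conj_mul_self, Complex.ofReal_re, Complex.normSq_eq_norm_sq]

theorem norm_sq_H1 (u : H1 d) : ‖u‖ ^ 2 = ‖toL2 d u‖ ^ 2 + ∑ j, ‖grad u j‖ ^ 2 := by
  simp only [← real_inner_self_eq_norm_sq, inner_H1]

theorem norm_toL2_le (u : H1 d) : ‖toL2 d u‖ ≤ ‖u‖ := by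
  refine abs_le_of_sq_le_sq' ?_ (norm_nonneg _) |>.2
  rw [norm_sq_H1]
  exact le_add_of_nonneg_right (Finset.sum_nonneg fun _ _ => sq_nonneg _)

theorem norm_grad_le (u : H1 d) (j : Fin d) : ‖grad u j‖ ≤ ‖u‖ := by
  refine abs_le_of_sq_le_sq' ?_ (norm_nonneg _) |>.2
  rw [norm_sq_H1]
  exact (Finset.single_le_sum (f := fun j => ‖grad u j‖ ^ 2) (fun _ _ => sq_nonneg _)
    (Finset.mem_univ j)).trans (le_add_of_nonneg_left (sq_nonneg _))

theorem exists_H1_fc_eq (c : (Fin d → ℤ) → ℂ) (hc : ∀ k, c (-k) = conj (c k))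
    (hs : Summable fun k => wt k * ‖c k‖ ^ 2) : ∃ v : H1 d, ∀ k, fc (toL2 d v) k = c k := by
  obtain ⟨f, hf⟩ := exists_fc_eq c hc (hs.of_nonneg_of_le (fun _ => sq_nonneg _)
    fun k => le_mul_of_one_le_left (sq_nonneg _) (one_le_wt k))
  have hg : ∀ j, ∃ g : L2 d, ∀ k, fc g k = 2 * Real.pi * I * k j * c k := fun j => by
    refine exists_fc_eq _ (fun k => ?_) (hs.of_nonneg_of_le (fun _ => sq_nonneg _) fun k => ?_)
    · simp only [Pi.neg_apply, Int.cast_neg, hc, map_mul, conj_I, conj_ofReal, map_ofNat,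
        map_intCast]
      ring
    · rw [norm_mul, mul_pow]
      refine mul_le_mul_of_nonneg_right ?_ (sq_nonneg _)
      have : ‖(2 * Real.pi * I * k j : ℂ)‖ ^ 2 = (2 * Real.pi * (k j : ℝ)) ^ 2 := by
        simp [mul_pow]
      rw [this, wt]
      exact (Finset.single_le_sum (f := fun j => (2 * Real.pi * (k j : ℝ)) ^ 2)
        (fun _ _ => sq_nonneg _) (Finset.mem_univ j)).trans (by simp)
  choose g hg using hg
  obtain ⟨v, hv, -⟩ := exists_H1 f g fun j => (isWeakPartialDeriv_iff_fc j _ _).2 fun k => by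
    rw [hg, hf]
  exact ⟨v, fun k => by rw [hv, hf]⟩

theorem mem_fourierSpace_iff {N : ℕ} {v : H1 d} :
    v ∈ fourierSpace d N ↔ ∀ k, (N : ℤ) ^ 2 < ∑ i, k i ^ 2 → fc (toL2 d v) k = 0 := by
  constructor
  · intro hv k hk
    change complexify d (toL2 d v) ∈ Submodule.span ℂ _ at hv
    rw [fc]
    generalize complexify d (toL2 d v) = F at hv
    induction hv using Submodule.span_induction with
    | mem x hx =>
      obtain ⟨l, hl, rfl⟩ := hx
      rw [← coe_mFourierBasis, HilbertBasis.repr_self]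
      refine lp.single_apply_ne _ _ _ ?_
      rintro rfl
      exact absurd hl (not_le.2 hk)
    | zero => simp
    | add x y _ _ hx hy => simp [hx, hy]
    | smul a x _ hx => simp [hx]
  · intro hv
    change complexify d (toL2 d v) ∈ Submodule.span ℂ _
    have h1 := mFourierBasis.hasSum_repr (complexify d (toL2 d v))
    have h2 : HasSum (fun k => mFourierBasis.repr (complexify d (toL2 d v)) k •
        mFourierBasis (d := Fin d) k) (∑ k ∈ (finite_wavenumbers d N).toFinset,
          mFourierBasis.repr (complexify d (toL2 d v)) k • mFourierBasis (d := Fin d) k) :=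
      hasSum_sum_of_ne_finset_zero (fun k hk => by
        have : fc (toL2 d v) k = 0 := hv k (by simpa using hk)
        rw [fc] at this
        rw [this, zero_smul])
    rw [h1.unique h2]
    refine Submodule.sum_mem _ fun k hk => Submodule.smul_mem _ _ (Submodule.subset_span ?_)
    exact ⟨k, by simpa using hk, by simp⟩

open Classical in
/-- The indicator of the low wavenumbers. -/
theorem exists_fourierSpace_fc_eq (N : ℕ) (c : (Fin d → ℤ) → ℂ) (hc : ∀ k, c (-k) = conj (c k)) :
    ∃ v ∈ fourierSpace d N, ∀ k, fc (toL2 d v) k = if ∑ i, k i ^ 2 ≤ (N : ℤ) ^ 2 then c k else 0 := by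
  obtain ⟨v, hv⟩ := exists_H1_fc_eq (fun k => if ∑ i, k i ^ 2 ≤ (N : ℤ) ^ 2 then c k else 0)
    (fun k => by simp only [Pi.neg_apply, neg_sq, hc]; split_ifs <;> simp)
    (summable_of_hasFiniteSupport ((finite_wavenumbers d N).subset fun k hk => by
      by_contra h
      exact hk (by simp [show ¬ ∑ i, k i ^ 2 ≤ (N : ℤ) ^ 2 from h])))
  exact ⟨v, mem_fourierSpace_iff.2 fun k hk => by rw [hv, if_neg (not_le.2 hk)], hv⟩

-- Plane waves are orthogonal in `H¹` as well as in `L²`, so the `H¹` projection is plain truncation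
-- and coincides with the `L²` one.
open Classical in
theorem fc_fourierProj (N : ℕ) (u : H1 d) (k : Fin d → ℤ) :
    fc (toL2 d (fourierProj d N u)) k
      = if ∑ i, k i ^ 2 ≤ (N : ℤ) ^ 2 then fc (toL2 d u) k else 0 := by
  obtain ⟨v, hv, hvc⟩ := exists_fourierSpace_fc_eq N (fc (toL2 d u)) (fc_neg_index _)
  have : fourierProj d N u = v := by
    refine Submodule.eq_starProjection_of_mem_of_inner_eq_zero hv fun z hz => ?_
    refine (hasSum_inner_H1 (u - v) z).unique (hasSum_zero.congr_fun fun l => ?_)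
    rw [map_sub, fc_sub, hvc]
    split_ifs with h
    · simp
    · rw [mem_fourierSpace_iff.1 hz l (not_le.1 h)]
      simp
  rw [this, hvc]

theorem fourierProj_mem (N : ℕ) (u : H1 d) : fourierProj d N u ∈ fourierSpace d N :=
  Submodule.starProjection_apply_mem _ _

theorem norm_fourierProj_le (N : ℕ) (u : H1 d) : ‖fourierProj d N u‖ ≤ ‖u‖ :=
  Submodule.norm_starProjection_apply_le _ _

/-- If `(1 - Δ) z = f` holds weakly against `X_N`, it holds for the Fourier coefficients up to `N`. -/
theorem wt_mul_fc_eq {N : ℕ} {z : H1 d} {f : L2 d}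
    (h : ∀ v ∈ fourierSpace d N, inner ℝ z v = inner ℝ f (toL2 d v)) (k : Fin d → ℤ)
    (hk : ∑ i, k i ^ 2 ≤ (N : ℤ) ^ 2) : (wt k : ℂ) * fc (toL2 d z) k = fc f k := by
  classical
  -- The test function is the truncated residual itself, so the hypothesis says that its squared
  -- `L²` norm vanishes.
  obtain ⟨v, hv, hvc⟩ := exists_fourierSpace_fc_eq N
    (fun k => (wt k : ℂ) * fc (toL2 d z) k - fc f k) (fun k => by
      rw [fc_neg_index, fc_neg_index, wt_neg]; simp [conj_ofReal])
  have h1 := (hasSum_inner_H1 z v).sub (hasSum_re_inner_fc f (toL2 d v))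
  rw [h v hv, sub_self] at h1
  have h2 : HasSum (fun k => ‖fc (toL2 d v) k‖ ^ 2) 0 := h1.congr_fun fun l => by
    rw [hvc]
    split_ifs
    · rw [← re_ofReal_mul, ← sub_re, ← Complex.normSq_eq_norm_sq,
        ← Complex.ofReal_re (Complex.normSq _), Complex.normSq_eq_conj_mul_self]
      congr 1
      simp only [map_sub, map_mul, conj_ofReal]
      ring
    · simp
  have h3 := (hasSum_zero_iff_of_nonneg fun _ => sq_nonneg _).1 h2
  have h4 := congrFun h3 k
  simp only [hvc, if_pos hk, Pi.zero_apply] at h4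
  exact sub_eq_zero.1 (norm_eq_zero.1 (pow_eq_zero_iff two_ne_zero |>.1 h4))

theorem wt_mul_fc_eq_of_forall {z : H1 d} {f : L2 d}
    (h : ∀ v, inner ℝ z v = inner ℝ f (toL2 d v)) (k : Fin d → ℤ) :
    (wt k : ℂ) * fc (toL2 d z) k = fc f k := by
  have h0 : 0 ≤ ∑ i, k i ^ 2 := Finset.sum_nonneg fun _ _ => sq_nonneg _
  -- The choice `N = |k|²` suffices because `n ≤ n²` for integers.
  refine wt_mul_fc_eq (N := (∑ i, k i ^ 2).toNat) (fun v _ => h v) k ?_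
  rw [Int.toNat_of_nonneg h0]
  exact Int.le_self_sq _

theorem tendsto_fourierProj (u : H1 d) :
    Tendsto (fun n : ℕ => fourierProj d n u) atTop (𝓝 u) := by
  classical
  rw [tendsto_iff_norm_sub_tendsto_zero]
  suffices h : Tendsto (fun n : ℕ => ‖fourierProj d n u - u‖ ^ 2) atTop (𝓝 0) by
    have := (Real.continuous_sqrt.tendsto _).comp h
    simpa [Function.comp_def, Real.sqrt_sq (norm_nonneg _)] using this
  have h1 : ∀ n : ℕ, ‖fourierProj d n u - u‖ ^ 2 = ∑' k, wt k *
      ‖(if ∑ i, k i ^ 2 ≤ (n : ℤ) ^ 2 then fc (toL2 d u) k else 0) - fc (toL2 d u) k‖ ^ 2 :=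
    fun n => by
      rw [← (hasSum_norm_H1 _).tsum_eq]
      simp only [map_sub, fc_sub, fc_fourierProj]
  simp only [h1]
  suffices h : Tendsto (fun n : ℕ => ∑' k, wt k *
      ‖(if ∑ i, k i ^ 2 ≤ (n : ℤ) ^ 2 then fc (toL2 d u) k else 0) - fc (toL2 d u) k‖ ^ 2)
      atTop (𝓝 (∑' _ : Fin d → ℤ, (0 : ℝ))) by rwa [tsum_zero] at h
  refine tendsto_tsum_of_dominated_convergence (hasSum_norm_H1 u).summable (fun k => ?_)
    (Eventually.of_forall fun n k => ?_)
  · refine tendsto_const_nhds.congr' ?_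
    filter_upwards [eventually_ge_atTop (∑ i, k i ^ 2).toNat] with n hn
    have h0 : 0 ≤ ∑ i, k i ^ 2 := Finset.sum_nonneg fun _ _ => sq_nonneg _
    have : ∑ i, k i ^ 2 ≤ (n : ℤ) ^ 2 := by
      have : ∑ i, k i ^ 2 ≤ (n : ℤ) := by omega
      exact this.trans (Int.le_self_sq _)
    simp [this]
  · rw [Real.norm_of_nonneg (mul_nonneg (wt_pos k).le (sq_nonneg _))]
    refine mul_le_mul_of_nonneg_left ?_ (wt_pos k).le
    split_ifs <;> simp

/-! ### Weighted convolution inequalities -/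

/-- Comparison with the lattice sum of `|k|⁻⁴`, which converges because the rank `d` is less than
`4`. The restriction on the dimension enters through this sum. -/
theorem summable_wt_sq_inv (hd : d ≤ 3) : Summable fun k : Fin d → ℤ => (wt k ^ 2)⁻¹ := by
  let L := Submodule.span ℤ (Set.range (Pi.basisFun ℝ (Fin d)))
  have hrank : Module.finrank ℤ L = d := by
    rw [ZLattice.rank ℝ L]; simp
  have h1 := ZLattice.summable_norm_pow_inv L 4 (by omega)
  let ι : (Fin d → ℤ) → L := fun k => ⟨fun i => (k i : ℝ), by
    rw [(Pi.basisFun ℝ (Fin d)).mem_span_iff_repr_mem ℤ]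
    intro i
    exact ⟨k i, by simp⟩⟩
  have hι : Function.Injective ι := fun k l h => by
    funext i
    have h2 : (k i : ℝ) = l i := congrFun (congrArg Subtype.val h) i
    exact_mod_cast h2
  -- The comparison fails only at `k = 0`, where the inverse norm takes the value `0`.
  refine Summable.of_norm_bounded_eventually (h1.comp_injective hι) ?_
  refine (Set.finite_singleton (0 : Fin d → ℤ)).subset fun k hk => ?_
  by_contra hk0
  refine hk ?_
  have hn : 0 < ‖ι k‖ := norm_pos_iff.2 fun h => hk0 (by
    funext i
    have h2 : (k i : ℝ) = 0 := congrFun (congrArg Subtype.val h) i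
    exact_mod_cast h2)
  have hle : ‖ι k‖ ^ 2 ≤ wt k := by
    have hpos : 0 ≤ wt k := (wt_pos k).le
    refine (Real.le_sqrt (norm_nonneg _) hpos).1 ?_
    refine (pi_norm_le_iff_of_nonneg (Real.sqrt_nonneg _)).2 fun i => ?_
    refine Real.le_sqrt (norm_nonneg _) hpos |>.2 ?_
    rw [Real.norm_eq_abs, sq_abs, wt]
    have h2 := Finset.single_le_sum (f := fun i => (2 * Real.pi * (k i : ℝ)) ^ 2)
      (fun _ _ => sq_nonneg _) (Finset.mem_univ i)
    have h3 : (k i : ℝ) ^ 2 ≤ (2 * Real.pi * (k i : ℝ)) ^ 2 := by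
      rw [mul_pow]
      refine le_mul_of_one_le_left (sq_nonneg _) ?_
      nlinarith [Real.pi_gt_three]
    change (k i : ℝ) ^ 2 ≤ _
    linarith
  change ‖(wt k ^ 2)⁻¹‖ ≤ ‖ι k‖⁻¹ ^ 4
  rw [Real.norm_of_nonneg (by positivity), inv_pow]
  refine inv_anti₀ (by positivity) ?_
  calc ‖ι k‖ ^ 4 = (‖ι k‖ ^ 2) ^ 2 := by ring
    _ ≤ _ := by gcongr

/-- The Cauchy–Schwarz inequality for infinite sums of extended nonnegative numbers. -/
theorem tsum_mul_sq_le {ι : Type*} (a b : ι → ℝ≥0∞) :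
    (∑' i, a i * b i) ^ 2 ≤ (∑' i, a i ^ 2) * ∑' i, b i ^ 2 := by
  have h : ∑' i, a i * b i ≤ (∑' i, a i ^ 2) ^ (1 / 2 : ℝ) * (∑' i, b i ^ 2) ^ (1 / 2 : ℝ) := by
    rw [ENNReal.tsum_eq_iSup_sum]
    refine iSup_le fun s => ?_
    refine (ENNReal.inner_le_Lp_mul_Lq s a b Real.HolderConjugate.two_two).trans ?_
    simp only [ENNReal.rpow_ofNat]
    gcongr <;> exact ENNReal.sum_le_tsum s
  calc (∑' i, a i * b i) ^ 2
      ≤ ((∑' i, a i ^ 2) ^ (1 / 2 : ℝ) * (∑' i, b i ^ 2) ^ (1 / 2 : ℝ)) ^ 2 := by gcongr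
    _ = _ := by
      rw [mul_pow, ← ENNReal.rpow_natCast, ← ENNReal.rpow_natCast, ← ENNReal.rpow_mul,
        ← ENNReal.rpow_mul]
      norm_num

/-- Cauchy–Schwarz for the splitting `x = p^{1/2} · p^{-1/2} x`; the conditions on `p` are what
makes the two powers cancel. -/
theorem tsum_sq_le_weighted {ι : Type*} (p x : ι → ℝ≥0∞) (hp : ∀ i, p i ≠ 0)
    (hp' : ∀ i, p i ≠ ⊤) : (∑' i, x i) ^ 2 ≤ (∑' i, p i) * ∑' i, (p i)⁻¹ * x i ^ 2 := by
  have h := tsum_mul_sq_le (fun i => p i ^ (1 / 2 : ℝ)) fun i => p i ^ (-(1 / 2) : ℝ) * x i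
  refine le_trans (le_of_eq ?_) (h.trans (le_of_eq ?_))
  · congr 1
    refine tsum_congr fun i => ?_
    rw [← mul_assoc, ← ENNReal.rpow_add _ _ (hp i) (hp' i)]
    simp
  · congr 1 <;> refine tsum_congr fun i => ?_
    · rw [← ENNReal.rpow_natCast, ← ENNReal.rpow_mul]; norm_num
    · rw [mul_pow, ← ENNReal.rpow_natCast, ← ENNReal.rpow_mul]
      norm_num
      rw [ENNReal.rpow_neg_one]

/-- The symbol `1 + |2πk|²` as an extended nonnegative number. -/
noncomputable def ewt (k : Fin d → ℤ) : ℝ≥0∞ := ENNReal.ofReal (wt k)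

theorem ewt_ne_zero (k : Fin d → ℤ) : ewt k ≠ 0 := by simp [ewt, wt_pos k]

theorem ewt_ne_top (k : Fin d → ℤ) : ewt k ≠ ⊤ := ENNReal.ofReal_ne_top

/-- The convolution of two sequences of extended nonnegative numbers. -/
noncomputable def conv (a b : (Fin d → ℤ) → ℝ≥0∞) (k : Fin d → ℤ) : ℝ≥0∞ :=
  ∑' l, a l * b (k - l)

/-- The square of the weighted `ℓ²` norm of order `s`. -/
noncomputable def sobSq (s : ℕ) (a : (Fin d → ℤ) → ℝ≥0∞) : ℝ≥0∞ := ∑' k, ewt k ^ s * a k ^ 2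

/-- The sum `∑ (1 + |2πk|²)⁻²`. -/
noncomputable def sobConst (d : ℕ) : ℝ≥0∞ := ∑' k : Fin d → ℤ, (ewt k ^ 2)⁻¹

theorem sobConst_ne_top (hd : d ≤ 3) : sobConst d ≠ ⊤ := by
  have h : ∀ k : Fin d → ℤ, (ewt k ^ 2)⁻¹ = ENNReal.ofReal ((wt k ^ 2)⁻¹) := fun k => by
    rw [ewt, ENNReal.ofReal_inv_of_pos (by have := wt_pos k; positivity),
      ENNReal.ofReal_pow (wt_pos k).le]
  simp only [sobConst, h]
  exact (summable_wt_sq_inv hd).tsum_ofReal_ne_top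

/-- The two extreme cases are translates or reflections of the defining sum, and Cauchy–Schwarz
reduces the mixed case to them. The bound is uniform in `k`. -/
theorem sum_weights_le {s t : ℕ} (hst : s = 2 ∧ t = 0 ∨ s = 1 ∧ t = 1 ∨ s = 0 ∧ t = 2)
    (k : Fin d → ℤ) : ∑' l, (ewt l ^ s)⁻¹ * (ewt (k - l) ^ t)⁻¹ ≤ sobConst d := by
  have hsub : ∑' l, (ewt (k - l) ^ 2)⁻¹ = sobConst d :=
    (Equiv.subLeft k).tsum_eq fun l => (ewt l ^ 2)⁻¹
  rcases hst with ⟨rfl, rfl⟩ | ⟨rfl, rfl⟩ | ⟨rfl, rfl⟩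
  · simp [sobConst]
  · have h := tsum_mul_sq_le (fun l => (ewt l ^ 1)⁻¹) fun l => (ewt (k - l) ^ 1)⁻¹
    simp only [pow_one] at h ⊢
    simp only [← ENNReal.inv_pow] at h
    rw [hsub, ← sobConst, ← sq] at h
    exact (ENNReal.pow_le_pow_left_iff two_ne_zero).1 h
  · simp [hsub]

/-- Products in Sobolev spaces, in terms of Fourier coefficients. -/
theorem tsum_conv_sq_le {s t : ℕ} (hst : s = 2 ∧ t = 0 ∨ s = 1 ∧ t = 1 ∨ s = 0 ∧ t = 2)
    (a b : (Fin d → ℤ) → ℝ≥0∞) :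
    ∑' k, conv a b k ^ 2 ≤ sobConst d * (sobSq s a * sobSq t b) := by
  have hpt : ∀ k, conv a b k ^ 2 ≤ sobConst d *
      ∑' l, (ewt l ^ s * a l ^ 2) * (ewt (k - l) ^ t * b (k - l) ^ 2) := fun k => by
    -- Cauchy–Schwarz with these weights puts the Sobolev factors on `a` and `b` and leaves a sum
    -- bounded uniformly in `k`.
    refine (tsum_sq_le_weighted (fun l => (ewt l ^ s)⁻¹ * (ewt (k - l) ^ t)⁻¹) _
      (fun l => ?_) (fun l => ?_)).trans ?_
    · exact mul_ne_zero (ENNReal.inv_ne_zero.2 (ENNReal.pow_ne_top (ewt_ne_top l)))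
        (ENNReal.inv_ne_zero.2 (ENNReal.pow_ne_top (ewt_ne_top _)))
    · exact ENNReal.mul_ne_top (ENNReal.inv_ne_top.2 (pow_ne_zero _ (ewt_ne_zero l)))
        (ENNReal.inv_ne_top.2 (pow_ne_zero _ (ewt_ne_zero _)))
    · refine mul_le_mul' (sum_weights_le hst k) (le_of_eq (tsum_congr fun l => ?_))
      rw [ENNReal.mul_inv
        (Or.inl (ENNReal.inv_ne_zero.2 (ENNReal.pow_ne_top (ewt_ne_top l))))
        (Or.inl (ENNReal.inv_ne_top.2 (pow_ne_zero _ (ewt_ne_zero l)))), inv_inv, inv_inv]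
      ring
  refine (ENNReal.tsum_le_tsum hpt).trans (le_of_eq ?_)
  rw [ENNReal.tsum_mul_left, ENNReal.tsum_comm]
  congr 1
  simp only [ENNReal.tsum_mul_left]
  have : ∀ l, ∑' k, ewt (k - l) ^ t * b (k - l) ^ 2 = sobSq t b := fun l =>
    (Equiv.subRight l).tsum_eq fun k => ewt k ^ t * b k ^ 2
  simp only [this, ENNReal.tsum_mul_right]
  rfl

theorem wt_le_add (k l : Fin d → ℤ) : wt k ≤ 2 * (wt l + wt (k - l)) := by
  have : ∑ i, (2 * Real.pi * (k i : ℝ)) ^ 2 ≤ ∑ i, 2 * ((2 * Real.pi * (l i : ℝ)) ^ 2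
      + (2 * Real.pi * ((k - l) i : ℤ)) ^ 2) := by
    refine Finset.sum_le_sum fun i _ => ?_
    have h : (2 * Real.pi * (k i : ℝ)) = 2 * Real.pi * (l i : ℝ)
      + 2 * Real.pi * ((k - l) i : ℤ) := by simp; ring
    rw [h]
    exact add_sq_le
  rw [← Finset.mul_sum, Finset.sum_add_distrib] at this
  simp only [wt]
  linarith

theorem ewt_le_add (k l : Fin d → ℤ) : ewt k ≤ 2 * (ewt l + ewt (k - l)) := by
  simp only [ewt]
  rw [← ENNReal.ofReal_add (wt_pos _).le (wt_pos _).le, ← ENNReal.ofReal_ofNat,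
    ← ENNReal.ofReal_mul (by norm_num)]
  exact ENNReal.ofReal_le_ofReal (wt_le_add k l)

theorem add_sq_le_ennreal (x y : ℝ≥0∞) : (x + y) ^ 2 ≤ 2 * (x ^ 2 + y ^ 2) := by
  have := ENNReal.rpow_add_le_mul_rpow_add_rpow x y (p := 2) (by norm_num)
  norm_num at this
  exact this

/-- The Sobolev space of order two is an algebra, in terms of Fourier coefficients. -/
theorem sobSq_two_conv_le (a b : (Fin d → ℤ) → ℝ≥0∞) :
    sobSq 2 (conv a b) ≤ 16 * sobConst d * (sobSq 2 a * sobSq 2 b) := by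
  have hpt : ∀ k, ewt k ^ 2 * conv a b k ^ 2 ≤
      8 * (conv (fun l => ewt l * a l) b k ^ 2 + conv a (fun l => ewt l * b l) k ^ 2) :=
    fun k => by
      -- A substitute for the Leibniz rule: the weight at `k` is shared between `l` and `k - l`, so
      -- only one factor of each product carries it and the other keeps its full `H²` norm.
      have h1 : ewt k * conv a b k ≤
          2 * (conv (fun l => ewt l * a l) b k + conv a (fun l => ewt l * b l) k) := by
        simp only [conv]
        rw [← ENNReal.tsum_add, ← ENNReal.tsum_mul_left, ← ENNReal.tsum_mul_left]
        refine ENNReal.tsum_le_tsum fun l => ?_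
        calc ewt k * (a l * b (k - l)) ≤ 2 * (ewt l + ewt (k - l)) * (a l * b (k - l)) := by
              gcongr; exact ewt_le_add k l
          _ = _ := by ring
      rw [← mul_pow]
      calc (ewt k * conv a b k) ^ 2
          ≤ (2 * (conv (fun l => ewt l * a l) b k + conv a (fun l => ewt l * b l) k)) ^ 2 := by
            gcongr
        _ = 4 * (conv (fun l => ewt l * a l) b k + conv a (fun l => ewt l * b l) k) ^ 2 := by
            rw [mul_pow]; norm_num
        _ ≤ 4 * (2 * (conv (fun l => ewt l * a l) b k ^ 2
              + conv a (fun l => ewt l * b l) k ^ 2)) := by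
            gcongr; exact add_sq_le_ennreal _ _
        _ = _ := by rw [← mul_assoc]; norm_num
  have h0 : ∀ c : (Fin d → ℤ) → ℝ≥0∞, sobSq 0 (fun l => ewt l * c l) = sobSq 2 c := fun c => by
    simp [sobSq, mul_pow]
  refine (ENNReal.tsum_le_tsum hpt).trans ?_
  rw [ENNReal.tsum_mul_left, ENNReal.tsum_add]
  calc 8 * (∑' k, conv (fun l => ewt l * a l) b k ^ 2 + ∑' k, conv a (fun l => ewt l * b l) k ^ 2)
      ≤ 8 * (sobConst d * (sobSq 0 (fun l => ewt l * a l) * sobSq 2 b)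
        + sobConst d * (sobSq 2 a * sobSq 0 fun l => ewt l * b l)) := by
        gcongr
        · exact tsum_conv_sq_le (by simp) _ _
        · exact tsum_conv_sq_le (by simp) _ _
    _ = _ := by rw [h0, h0]; ring

/-- The weights of the Cauchy–Schwarz inequality are the inverse `H²` weights. This gives absolutely
convergent Fourier series, hence boundedness, for `H²` functions. -/
theorem tsum_sq_le_sobSq_two (a : (Fin d → ℤ) → ℝ≥0∞) :
    (∑' k, a k) ^ 2 ≤ sobConst d * sobSq 2 a := by
  have := tsum_sq_le_weighted (fun k : Fin d → ℤ => (ewt k ^ 2)⁻¹) a (by simp [ewt_ne_top])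
    (by simp [ewt_ne_zero])
  simpa [sobConst, sobSq] using this

theorem sobSq_eq_ofReal {s : ℕ} {f : L2 d} {x : ℝ}
    (h : HasSum (fun k => wt k ^ s * ‖fc f k‖ ^ 2) x) :
    sobSq s (fun k => ‖fc f k‖ₑ) = ENNReal.ofReal x := by
  rw [← h.tsum_eq, ENNReal.ofReal_tsum_of_nonneg (fun k => by have := wt_pos k; positivity)
    h.summable]
  refine tsum_congr fun k => ?_
  rw [ENNReal.ofReal_mul (by have := wt_pos k; positivity), ENNReal.ofReal_pow (wt_pos k).le,
    ENNReal.ofReal_pow (norm_nonneg _), ofReal_norm, ewt]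

theorem sobSq_zero_fc (f : L2 d) : sobSq 0 (fun k => ‖fc f k‖ₑ) = ENNReal.ofReal (‖f‖ ^ 2) :=
  sobSq_eq_ofReal (by simpa using hasSum_sq_fc f)

theorem sobSq_one_fc (v : H1 d) :
    sobSq 1 (fun k => ‖fc (toL2 d v) k‖ₑ) = ENNReal.ofReal (‖v‖ ^ 2) :=
  sobSq_eq_ofReal (by simpa using hasSum_norm_H1 v)

/-! ### The algebra `H²` and its embedding into bounded functions -/

/-- The Sobolev space of order two, in terms of Fourier coefficients. -/
def MemH2 (f : L2 d) : Prop := Summable fun k => wt k ^ 2 * ‖fc f k‖ ^ 2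

/-- The square of the norm of the Sobolev space of order two. -/
noncomputable def h2Sq (f : L2 d) : ℝ := ∑' k, wt k ^ 2 * ‖fc f k‖ ^ 2

theorem h2Sq_nonneg (f : L2 d) : 0 ≤ h2Sq f :=
  tsum_nonneg fun k => by have := wt_pos k; positivity

theorem MemH2.sobSq_eq {f : L2 d} (h : MemH2 f) :
    sobSq 2 (fun k => ‖fc f k‖ₑ) = ENNReal.ofReal (h2Sq f) := sobSq_eq_ofReal h.hasSum

theorem memH2_of_sobSq_ne_top {f : L2 d} (h : sobSq 2 (fun k => ‖fc f k‖ₑ) ≠ ⊤) : MemH2 f := by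
  have h1 := ENNReal.summable_toReal h
  refine h1.congr fun k => ?_
  rw [ENNReal.toReal_mul, ENNReal.toReal_pow, ENNReal.toReal_pow, toReal_enorm, ewt,
    ENNReal.toReal_ofReal (wt_pos k).le]

theorem fc_mul_eq_tsum {f g h : L2 d} (hh : h =ᵐ[volume] fun x => f x * g x) (k : Fin d → ℤ) :
    HasSum (fun l => fc f l * fc g (k - l)) (fc h k) := by
  rw [fc_eq_mFourierCoeff]
  convert! hasSum_fc_mul f g k using 1
  refine integral_congr_ae ?_
  filter_upwards [hh] with x hx
  rw [hx]

/-- The triangle inequality in the convolution formula. Passing to extended nonnegative sequences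
removes all summability conditions from the product estimates. -/
theorem enorm_fc_mul_le {f g h : L2 d} (hh : h =ᵐ[volume] fun x => f x * g x) (k : Fin d → ℤ) :
    ‖fc h k‖ₑ ≤ conv (fun k => ‖fc f k‖ₑ) (fun k => ‖fc g k‖ₑ) k := by
  rw [← (fc_mul_eq_tsum hh k).tsum_eq]
  refine enorm_tsum_le_tsum_enorm.trans (le_of_eq (tsum_congr fun l => ?_))
  rw [enorm_mul]

/-- The Sobolev space of order two is an algebra. -/
theorem MemH2.mul (hd : d ≤ 3) {f g h : L2 d} (hf : MemH2 f) (hg : MemH2 g)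
    (hh : h =ᵐ[volume] fun x => f x * g x) :
    MemH2 h ∧ h2Sq h ≤ 16 * (sobConst d).toReal * (h2Sq f * h2Sq g) := by
  have h1 : sobSq 2 (fun k => ‖fc h k‖ₑ)
      ≤ 16 * sobConst d * (ENNReal.ofReal (h2Sq f) * ENNReal.ofReal (h2Sq g)) := by
    rw [← hf.sobSq_eq, ← hg.sobSq_eq]
    refine le_trans ?_ (sobSq_two_conv_le _ _)
    exact ENNReal.tsum_le_tsum fun k => by gcongr; exact enorm_fc_mul_le hh k
  have h2 : 16 * sobConst d * (ENNReal.ofReal (h2Sq f) * ENNReal.ofReal (h2Sq g))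
      = ENNReal.ofReal (16 * (sobConst d).toReal * (h2Sq f * h2Sq g)) := by
    rw [ENNReal.ofReal_mul (by positivity), ENNReal.ofReal_mul (by positivity),
      ENNReal.ofReal_mul (h2Sq_nonneg f), ENNReal.ofReal_toReal (sobConst_ne_top hd)]
    norm_num
  rw [h2] at h1
  have h3 := memH2_of_sobSq_ne_top (h1.trans_lt ENNReal.ofReal_lt_top).ne
  refine ⟨h3, ?_⟩
  rw [h3.sobSq_eq] at h1
  exact (ENNReal.ofReal_le_ofReal_iff (mul_nonneg (by positivity)
    (mul_nonneg (h2Sq_nonneg _) (h2Sq_nonneg _)))).1 h1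

/-- A function with summable Fourier coefficients is the sum of its Fourier series. -/
theorem ae_hasSum_fourier {f : L2 d} (hs : Summable fun k => ‖fc f k‖) :
    ∀ᵐ x, HasSum (fun k => fc f k * mFourier k x) (f x : ℂ) := by
  have h1 : Summable fun k => fc f k • (mFourier k : C(Torus d, ℂ)) :=
    .of_norm (by simpa [norm_smul, mFourier_norm] using hs)
  obtain ⟨g, hg⟩ := h1
  have h2 : HasSum (fun k => fc f k • mFourierBasis (d := Fin d) k)
      (ContinuousMap.toLp 2 volume ℂ g) := by
    convert! (ContinuousMap.toLp (E := ℂ) 2 (volume : Measure (Torus d)) ℂ).hasSum hg using 2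
    simp
  have h3 := (mFourierBasis.hasSum_repr (complexify d f)).unique h2
  filter_upwards [coeFn_complexify f, ContinuousMap.coeFn_toLp (p := 2) (𝕜 := ℂ)
    (volume : Measure (Torus d)) g] with x hx hy
  rw [← hx, h3, hy]
  exact (ContinuousMap.evalCLM ℂ x).hasSum hg

theorem norm_mFourier_apply (k : Fin d → ℤ) (x : Torus d) : ‖mFourier k x‖ = 1 := by
  simp only [mFourier, ContinuousMap.coe_mk, norm_prod, fourier_apply, Circle.norm_coe,
    Finset.prod_const_one]

theorem ae_abs_le_tsum {f : L2 d} (hs : Summable fun k => ‖fc f k‖) :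
    ∀ᵐ x, |f x| ≤ ∑' k, ‖fc f k‖ := by
  filter_upwards [ae_hasSum_fourier hs] with x hx
  have h2 := hx.norm_le_of_bounded hs.hasSum fun k => by
    rw [norm_mul, norm_mFourier_apply, mul_one]
  simpa using h2

theorem MemH2.summable (hd : d ≤ 3) {f : L2 d} (hf : MemH2 f) : Summable fun k => ‖fc f k‖ := by
  have h := tsum_sq_le_sobSq_two fun k => ‖fc f k‖ₑ
  rw [hf.sobSq_eq] at h
  have h1 := h.trans_lt (ENNReal.mul_lt_top (sobConst_ne_top hd).lt_top ENNReal.ofReal_lt_top)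
  have h2 : ∑' k, ‖fc f k‖ₑ ≠ ⊤ := fun h' => by simp [h'] at h1
  simpa using ENNReal.summable_toReal h2

/-- The embedding of the Sobolev space of order two into the bounded functions. -/
theorem MemH2.ae_abs_le (hd : d ≤ 3) {f : L2 d} (hf : MemH2 f) :
    ∀ᵐ x, |f x| ≤ √((sobConst d).toReal * h2Sq f) := by
  filter_upwards [ae_abs_le_tsum (hf.summable hd)] with x hx
  refine hx.trans (Real.le_sqrt_of_sq_le ?_)
  have h := tsum_sq_le_sobSq_two fun k => ‖fc f k‖ₑ
  rw [hf.sobSq_eq] at h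
  have h3 : ∑' k, ‖fc f k‖ₑ = ENNReal.ofReal (∑' k, ‖fc f k‖) := by
    rw [ENNReal.ofReal_tsum_of_nonneg (fun _ => norm_nonneg _) (hf.summable hd)]
    simp
  rw [h3, ← ENNReal.ofReal_pow (tsum_nonneg fun _ => norm_nonneg _),
    ← ENNReal.ofReal_toReal (sobConst_ne_top hd), ← ENNReal.ofReal_mul (by positivity)] at h
  exact (ENNReal.ofReal_le_ofReal_iff (mul_nonneg (by positivity) (h2Sq_nonneg _))).1 h

theorem summable_of_mem_fourierSpace {N : ℕ} {v : H1 d} (hv : v ∈ fourierSpace d N)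
    {F : (Fin d → ℤ) → ℝ} (hF : ∀ k, fc (toL2 d v) k = 0 → F k = 0) : Summable F := by
  refine summable_of_hasFiniteSupport ((finite_wavenumbers d N).subset fun k hk => ?_)
  by_contra h
  exact hk (hF k (mem_fourierSpace_iff.1 hv k (not_le.1 h)))

theorem memH2_of_mem_fourierSpace {N : ℕ} {v : H1 d} (hv : v ∈ fourierSpace d N) :
    MemH2 (toL2 d v) :=
  summable_of_mem_fourierSpace hv fun k hk => by simp [hk]

/-! ### The embedding of `H¹` into `L⁴` -/

/-- `u` is essentially bounded. -/
def AEBdd (f : L2 d) : Prop := ∃ B, ∀ᵐ x, |f x| ≤ B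

theorem aeBdd_of_mem_fourierSpace {N : ℕ} {v : H1 d} (hv : v ∈ fourierSpace d N) :
    AEBdd (toL2 d v) :=
  ⟨_, ae_abs_le_tsum (summable_of_mem_fourierSpace hv fun k hk => by simp [hk])⟩

theorem memLp_mul_of_bdd {f : L2 d} (hf : AEBdd f) (g : L2 d) :
    MemLp (fun x => f x * g x) 2 volume := by
  obtain ⟨B, hB⟩ := hf
  refine MemLp.of_le_mul (c := B) (Lp.memLp g)
    ((Lp.aestronglyMeasurable f).mul (Lp.aestronglyMeasurable g)) ?_
  filter_upwards [hB] with x hx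
  rw [norm_mul, Real.norm_eq_abs]
  gcongr

theorem norm_sq_eq_integral (f : L2 d) : ‖f‖ ^ 2 = ∫ x, f x ^ 2 := by
  rw [← real_inner_self_eq_norm_sq, inner_eq_integral]
  simp only [sq]

theorem exists_subseq_ae_tendsto {f : ℕ → L2 d} {g : L2 d} (h : Tendsto f atTop (𝓝 g)) :
    ∃ ns : ℕ → ℕ, StrictMono ns ∧ ∀ᵐ x, Tendsto (fun i => f (ns i) x) atTop (𝓝 (g x)) :=
  (tendstoInMeasure_of_tendsto_Lp h).exists_seq_tendsto_ae

/-- The integral is the squared `L²` norm of `v²`, whose coefficients are a convolution; the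
convolution inequality is used with one weight on each factor. Boundedness of `v` provides `v² ∈ L²`
beforehand. -/
theorem integral_pow_four_le_of_mem (hd : d ≤ 3) {N : ℕ} {v : H1 d} (hv : v ∈ fourierSpace d N) :
    Integrable (fun x => toL2 d v x ^ 4) ∧
      ∫ x, toL2 d v x ^ 4 ≤ (sobConst d).toReal * ‖v‖ ^ 4 := by
  have hm := memLp_mul_of_bdd (aeBdd_of_mem_fourierSpace hv) (toL2 d v)
  have h1 : ‖hm.toLp‖ ^ 2 = ∫ x, toL2 d v x ^ 4 := by
    rw [norm_sq_eq_integral]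
    refine integral_congr_ae ?_
    filter_upwards [hm.coeFn_toLp] with x hx
    rw [hx]
    ring
  refine ⟨hm.integrable_sq.congr (ae_of_all _ fun x => by ring), ?_⟩
  have h2 : ENNReal.ofReal (‖hm.toLp‖ ^ 2)
      ≤ sobConst d * (ENNReal.ofReal (‖v‖ ^ 2) * ENNReal.ofReal (‖v‖ ^ 2)) := by
    rw [← sobSq_zero_fc, ← sobSq_one_fc]
    refine le_trans ?_ (tsum_conv_sq_le (by simp) _ _)
    exact ENNReal.tsum_le_tsum fun k => by
      rw [pow_zero, one_mul]; gcongr; exact enorm_fc_mul_le hm.coeFn_toLp k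
  rw [← ENNReal.ofReal_toReal (sobConst_ne_top hd), ← ENNReal.ofReal_mul (by positivity),
    ← ENNReal.ofReal_mul (by positivity), ENNReal.ofReal_le_ofReal_iff (by positivity), h1] at h2
  exact h2.trans (le_of_eq (by ring))

/-- The embedding of `H¹` into `L⁴`. -/
theorem integral_pow_four_le (hd : d ≤ 3) (v : H1 d) :
    Integrable (fun x => toL2 d v x ^ 4) ∧
      ∫ x, toL2 d v x ^ 4 ≤ (sobConst d).toReal * ‖v‖ ^ 4 := by
  obtain ⟨ns, hns, hlim⟩ := exists_subseq_ae_tendsto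
    (((toL2 d).continuous.tendsto v).comp (tendsto_fourierProj v))
  have hm : AEStronglyMeasurable (fun x => toL2 d v x ^ 4) volume :=
    (Lp.aestronglyMeasurable _).pow 4
  have hb : ∀ n, ∫⁻ x, ENNReal.ofReal (toL2 d (fourierProj d n v) x ^ 4)
      ≤ ENNReal.ofReal ((sobConst d).toReal * ‖v‖ ^ 4) := fun n => by
    obtain ⟨h1, h2⟩ := integral_pow_four_le_of_mem hd (fourierProj_mem n v)
    rw [← ofReal_integral_eq_lintegral_ofReal h1 (ae_of_all _ fun x => by positivity)]
    refine ENNReal.ofReal_le_ofReal (h2.trans ?_)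
    gcongr
    exact norm_fourierProj_le n v
  -- Fatou's lemma along an almost everywhere convergent subsequence of the truncations.
  have hF : ∫⁻ x, ENNReal.ofReal (toL2 d v x ^ 4)
      ≤ ENNReal.ofReal ((sobConst d).toReal * ‖v‖ ^ 4) := by
    calc ∫⁻ x, ENNReal.ofReal (toL2 d v x ^ 4)
        = ∫⁻ x, liminf (fun i => ENNReal.ofReal (toL2 d (fourierProj d (ns i) v) x ^ 4)) atTop := by
          refine lintegral_congr_ae ?_
          filter_upwards [hlim] with x hx
          exact ((ENNReal.continuous_ofReal.tendsto _).comp (hx.pow 4)).liminf_eq.symm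
      _ ≤ liminf (fun i => ∫⁻ x, ENNReal.ofReal (toL2 d (fourierProj d (ns i) v) x ^ 4)) atTop :=
          lintegral_liminf_le' fun i =>
            ((Lp.aestronglyMeasurable _).aemeasurable.pow_const 4).ennreal_ofReal
      _ ≤ _ := liminf_le_of_le (by isBoundedDefault) fun b hb' => by
          obtain ⟨i, hi⟩ := hb'.exists
          exact hi.trans (hb _)
  have hi : Integrable (fun x => toL2 d v x ^ 4) :=
    (lintegral_ofReal_ne_top_iff_integrable hm (ae_of_all _ fun x => by positivity)).1
      (hF.trans_lt ENNReal.ofReal_lt_top).ne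
  refine ⟨hi, ?_⟩
  rwa [← ofReal_integral_eq_lintegral_ofReal hi (ae_of_all _ fun x => by positivity),
    ENNReal.ofReal_le_ofReal_iff (by positivity)] at hF

/-! ### Product and chain rules for weak derivatives -/

theorem integrable_mul_fourier {f : Torus d → ℝ} (hf : Integrable f) (k : Fin d → ℤ) :
    Integrable fun x => mFourier k x • (f x : ℂ) :=
  (hf.ofReal (𝕜 := ℂ)).bdd_mul (c := 1) (mFourier k).continuous.aestronglyMeasurable
    (ae_of_all _ fun x => (norm_mFourier_apply k x).le)

/-- The product rule for weak derivatives. -/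
theorem isWeakPartialDeriv_mul (f g : H1 d) (j : Fin d) {h p : L2 d}
    (hh : h =ᵐ[volume] fun x => toL2 d f x * toL2 d g x)
    (hp : p =ᵐ[volume] fun x => grad f j x * toL2 d g x + toL2 d f x * grad g j x) :
    IsWeakPartialDeriv j h p := by
  rw [isWeakPartialDeriv_iff_fc]
  intro k
  have h1 : fc p k = mFourierCoeff (fun x => ((grad f j x * toL2 d g x : ℝ) : ℂ)) k
      + mFourierCoeff (fun x => ((toL2 d f x * grad g j x : ℝ) : ℂ)) k := by
    rw [fc_eq_mFourierCoeff, mFourierCoeff, mFourierCoeff, mFourierCoeff,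
      ← integral_add (integrable_mul_fourier (integrable_mul_L2 _ _) _)
        (integrable_mul_fourier (integrable_mul_L2 _ _) _)]
    refine integral_congr_ae ?_
    filter_upwards [hp] with x hx
    rw [hx]
    push_cast
    rw [smul_add]
  rw [h1]
  -- Under the convolution sum the Leibniz rule is the identity `k_j = l_j + (k_j - l_j)`.
  refine ((hasSum_fc_mul _ _ k).add (hasSum_fc_mul _ _ k)).unique
    (((fc_mul_eq_tsum hh k).mul_left (2 * Real.pi * I * k j)).congr_fun fun l => ?_)
  rw [fc_grad, fc_grad]
  simp only [Pi.sub_apply, Int.cast_sub]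
  ring

/-- The product of bounded functions in `H¹` is in `H¹`. -/
theorem exists_H1_mul {f g : H1 d} (hf : AEBdd (toL2 d f)) (hg : AEBdd (toL2 d g)) :
    ∃ h : H1 d, toL2 d h =ᵐ[volume] (fun x => toL2 d f x * toL2 d g x) ∧
      ∀ j, grad h j =ᵐ[volume] fun x => grad f j x * toL2 d g x + toL2 d f x * grad g j x := by
  have h0 := memLp_mul_of_bdd hf (toL2 d g)
  have h1 : ∀ j, MemLp (fun x => grad f j x * toL2 d g x + toL2 d f x * grad g j x) 2 volume :=
    fun j => by
      refine MemLp.add ?_ (memLp_mul_of_bdd hf _)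
      simpa only [mul_comm] using memLp_mul_of_bdd hg (grad f j)
  obtain ⟨h, hh, hgr⟩ := exists_H1 h0.toLp (fun j => (h1 j).toLp) fun j =>
    isWeakPartialDeriv_mul f g j h0.coeFn_toLp (h1 j).coeFn_toLp
  exact ⟨h, by rw [hh]; exact h0.coeFn_toLp, fun j => by rw [hgr]; exact (h1 j).coeFn_toLp⟩

/-- The Fourier series is a finite sum. Truncations therefore serve as the smooth approximants in
the chain rule. -/
theorem exists_isSmooth_of_mem {N : ℕ} {v : H1 d} (hv : v ∈ fourierSpace d N) :
    ∃ φ : Torus d → ℝ, IsSmooth φ ∧ toL2 d v =ᵐ[volume] φ ∧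
      ∀ j, grad v j =ᵐ[volume] partialDeriv j φ := by
  let s := (finite_wavenumbers d N).toFinset
  let φ : Torus d → ℝ := fun p => ∑ k ∈ s, (fc (toL2 d v) k * mFourier k p).re
  have hφ : IsSmooth φ := ContDiff.sum fun k _ => isSmooth_re_mFourier _ k
  have hvφ : toL2 d v =ᵐ[volume] φ := by
    filter_upwards [ae_hasSum_fourier (f := toL2 d v)
      (summable_of_mem_fourierSpace hv fun k hk => by simp [hk])] with x hx
    have h2 : HasSum (fun k => fc (toL2 d v) k * mFourier k x)
        (∑ k ∈ s, fc (toL2 d v) k * mFourier k x) :=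
      hasSum_sum_of_ne_finset_zero fun k hk => by
        rw [mem_fourierSpace_iff.1 hv k (by simpa [s] using hk), zero_mul]
    have h3 := congrArg Complex.re (hx.unique h2)
    simpa [φ] using h3
  refine ⟨φ, hφ, hvφ, fun j => ?_⟩
  have h0 := ContinuousMap.coeFn_toLp (p := 2) (𝕜 := ℝ) (volume : Measure (Torus d))
    ⟨φ, hφ.continuous⟩
  have h1 : (ContinuousMap.toLp 2 volume ℝ ⟨φ, hφ.continuous⟩ : L2 d) = toL2 d v :=
    Lp.ext (h0.trans hvφ.symm)
  have h2 : (ContinuousMap.toLp 2 volume ℝ ⟨_, hφ.continuous_partialDeriv j⟩ : L2 d)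
      = grad v j := fc_injective fun k => by rw [hφ.fc_partialDeriv, h1, fc_grad]
  rw [← h2]
  exact ContinuousMap.coeFn_toLp (p := 2) (𝕜 := ℝ) (volume : Measure (Torus d)) _

theorem lipschitz_of_hasDerivAt {F F' : ℝ → ℝ} (hF : ∀ s, HasDerivAt F (F' s) s) {K : ℝ}
    (hK : ∀ s, |F' s| ≤ K) (a b : ℝ) : |F a - F b| ≤ K * |a - b| :=
  (convex_univ).norm_image_sub_le_of_norm_hasDerivWithin_le (f := F) (f' := F')
    (fun x _ => (hF x).hasDerivWithinAt) (fun x _ => hK x) trivial trivial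

theorem memLp_comp {F F' : ℝ → ℝ} (hF : ∀ s, HasDerivAt F (F' s) s) {K : ℝ}
    (hK : ∀ s, |F' s| ≤ K) (f : L2 d) : MemLp (fun x => F (f x)) 2 volume := by
  have hc : Continuous F := continuous_iff_continuousAt.2 fun s => (hF s).continuousAt
  have h0 : MemLp (fun x => K * ‖f x‖) 2 volume := (Lp.memLp f).norm.const_mul K
  have h1 : MemLp (fun x => |F 0| + K * ‖f x‖) 2 volume :=
    (memLp_const (μ := (volume : Measure (Torus d))) |F 0|).add h0
  refine h1.mono (hc.comp_aestronglyMeasurable (Lp.aestronglyMeasurable f))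
    (ae_of_all _ fun x => ?_)
  have h2 := lipschitz_of_hasDerivAt hF hK (f x) 0
  rw [Real.norm_eq_abs, Real.norm_eq_abs]
  refine le_trans ?_ (le_abs_self _)
  have h3 := abs_sub_abs_le_abs_sub (F (f x)) (F 0)
  rw [sub_zero, ← Real.norm_eq_abs (f x)] at h2
  linarith

theorem memLp_bdd_mul {b : Torus d → ℝ} (hb : AEStronglyMeasurable b volume) {K : ℝ}
    (hK : ∀ᵐ x, |b x| ≤ K) (f : L2 d) : MemLp (fun x => b x * f x) 2 volume := by
  refine MemLp.of_le_mul (c := K) (Lp.memLp f) (hb.mul (Lp.aestronglyMeasurable f)) ?_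
  filter_upwards [hK] with x hx
  rw [norm_mul, Real.norm_eq_abs]
  gcongr

/-- The chain rule for weak derivatives. -/
theorem exists_H1_comp {F F' : ℝ → ℝ} (hF : ∀ s, HasDerivAt F (F' s) s) (hF' : Continuous F')
    {K : ℝ} (hK : ∀ s, |F' s| ≤ K) (v : H1 d) :
    ∃ z : H1 d, toL2 d z =ᵐ[volume] (fun x => F (toL2 d v x)) ∧
      ∀ j, grad z j =ᵐ[volume] fun x => F' (toL2 d v x) * grad v j x := by
  have hc : Continuous F := continuous_iff_continuousAt.2 fun s => (hF s).continuousAt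
  choose Z hZ using fun f : L2 d => (⟨_, (memLp_comp hF hK f).coeFn_toLp⟩ :
    ∃ z : L2 d, z =ᵐ[volume] fun x => F (f x))
  have hm : ∀ f : L2 d, AEStronglyMeasurable (fun x => F' (f x)) volume := fun f =>
    hF'.comp_aestronglyMeasurable (Lp.aestronglyMeasurable f)
  choose D hD using fun f g : L2 d =>
    (⟨_, (memLp_bdd_mul (hm f) (ae_of_all _ fun x => hK _) g).coeFn_toLp⟩ :
      ∃ z : L2 d, z =ᵐ[volume] fun x => F' (f x) * g x)
  -- For the trigonometric polynomials `w i` the identity is classical integration by parts; it then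
  -- passes to the limit, almost everywhere along a subsequence and in `H¹`.
  have hweak : ∀ j, IsWeakPartialDeriv j (Z (toL2 d v))
      (D (toL2 d v) (grad v j)) := fun j ψ hψ => by
    obtain ⟨ns, hns, hlim⟩ := exists_subseq_ae_tendsto
      (((toL2 d).continuous.tendsto v).comp (tendsto_fourierProj v))
    have hconv : Tendsto (fun i => fourierProj d (ns i) v) atTop (𝓝 v) :=
      (tendsto_fourierProj v).comp hns.tendsto_atTop
    simp only [Function.comp] at hlim
    generalize hw : (fun i => fourierProj d (ns i) v) = w at hconv
    have hwi : ∀ i, fourierProj d (ns i) v = w i := fun i => congrFun hw i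
    simp only [hwi] at hlim
    have hmem : ∀ i, w i ∈ fourierSpace d (ns i) := fun i => by
      rw [← hwi]; exact fourierProj_mem _ _
    have hi : ∀ g : Torus d → ℝ, Continuous g → Integrable g := fun g hg =>
      hg.integrable_of_hasCompactSupport (HasCompactSupport.of_compactSpace _)
    have hibp : ∀ i, ∫ x, (Z (toL2 d (w i))) x * partialDeriv j ψ x
        = -∫ x, (D (toL2 d (w i)) (grad (w i) j)) x * ψ x := fun i => by
      obtain ⟨φ, hφ, hφ0, hφ1⟩ := exists_isSmooth_of_mem (hmem i)
      have hφc := hφ.continuous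
      have hφc' := hφ.continuous_partialDeriv j
      have hψc := hψ.continuous
      have hψc' := hψ.continuous_partialDeriv j
      have key := integral_deriv_eq_zero j (ψ := fun p => F (φ p) * ψ p)
        (ψ' := fun p => F' (φ p) * partialDeriv j φ p * ψ p + F (φ p) * partialDeriv j ψ p)
        (by fun_prop) (by fun_prop) (fun p => by
          have h2 := ((hF (φ (p + Pi.single j ((0 : ℝ) : UnitAddCircle)))).comp (0 : ℝ)
            (hφ.hasDerivAt j p)).mul (hψ.hasDerivAt j p)
          convert! h2 using 1
          simp)
      rw [integral_add (hi _ (by fun_prop)) (hi _ (by fun_prop))] at key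
      have e1 : ∫ x, (Z (toL2 d (w i))) x * partialDeriv j ψ x
          = ∫ x, F (φ x) * partialDeriv j ψ x := by
        refine integral_congr_ae ?_
        filter_upwards [hZ (toL2 d (w i)), hφ0] with x hx hx0
        rw [hx, hx0]
      have e2 : ∫ x, (D (toL2 d (w i)) (grad (w i) j)) x * ψ x
          = ∫ x, F' (φ x) * partialDeriv j φ x * ψ x := by
        refine integral_congr_ae ?_
        filter_upwards [hD (toL2 d (w i)) (grad (w i) j), hφ0, hφ1 j]
          with x hx hx0 hx1
        rw [hx, hx0, hx1]
      rw [e1, e2]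
      linarith
    have hL : Tendsto (fun i => (Z (toL2 d (w i)))) atTop (𝓝 (Z (toL2 d v))) := by
      rw [tendsto_iff_norm_sub_tendsto_zero]
      have h2 : Tendsto (fun i => K * ‖toL2 d (w i) - toL2 d v‖) atTop (𝓝 0) := by
        simpa using (tendsto_iff_norm_sub_tendsto_zero.1
          (((toL2 d).continuous.tendsto v).comp hconv)).const_mul K
      refine squeeze_zero (fun _ => norm_nonneg _) (fun i => ?_) h2
      refine Lp.norm_le_mul_norm_of_ae_le_mul ?_
      filter_upwards [Lp.coeFn_sub (Z (toL2 d (w i))) (Z (toL2 d v)),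
        Lp.coeFn_sub (toL2 d (w i)) (toL2 d v), hZ (toL2 d (w i)),
        hZ (toL2 d v)] with x e1 e2 e3 e4
      rw [e1, e2, Pi.sub_apply, Pi.sub_apply, e3, e4]
      exact lipschitz_of_hasDerivAt hF hK _ _
    have hgrad : Tendsto (fun i => ‖grad (w i) j - grad v j‖) atTop (𝓝 0) := by
      refine squeeze_zero (fun _ => norm_nonneg _) (fun i => ?_)
        (tendsto_iff_norm_sub_tendsto_zero.1 hconv)
      rw [← grad_sub]
      exact norm_grad_le _ _
    let Ψ : C(Torus d, ℝ) := ⟨ψ, hψ.continuous⟩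
    have lim1 : Tendsto (fun i => ∫ x, (Z (toL2 d (w i))) x * partialDeriv j ψ x) atTop
        (𝓝 (∫ x, (Z (toL2 d v)) x * partialDeriv j ψ x)) := by
      have := fun f : L2 d => integral_mul_eq_inner f ⟨_, hψ.continuous_partialDeriv j⟩
      simp only [ContinuousMap.coe_mk] at this
      simp only [this]
      exact tendsto_const_nhds.inner hL
    have lim2 : Tendsto (fun i => ∫ x, (D (toL2 d (w i)) (grad (w i) j)) x * ψ x) atTop
        (𝓝 (∫ x, (D (toL2 d v) (grad v j)) x * ψ x)) := by
      -- `F'` is only continuous and bounded, so the gradient is compared with its limit first: the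
      -- difference is small in `L²`, and `F'(w i)` times the fixed function `grad v j` is left to
      -- dominated convergence.
      have hsplit : ∀ i, ∫ x, (D (toL2 d (w i)) (grad (w i) j)) x * ψ x
          = inner ℝ (ContinuousMap.toLp 2 volume ℝ Ψ : L2 d)
              (D (toL2 d (w i)) (grad (w i) j - grad v j))
            + ∫ x, F' (toL2 d (w i) x) * grad v j x * ψ x := fun i => by
        rw [← integral_mul_eq_inner]
        have i1 : Integrable fun x => F' (toL2 d (w i) x) * grad v j x * ψ x := by
          obtain ⟨B, hB⟩ := isCompact_univ.exists_bound_of_continuousOn hψ.continuous.continuousOn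
          exact ((memLp_bdd_mul (hm _) (ae_of_all _ fun x => hK _) _).integrable (by norm_num)).mul_bdd (c := B)
            hψ.continuous.aestronglyMeasurable (ae_of_all _ fun x => hB x trivial)
        rw [← integral_add _ i1]
        · refine integral_congr_ae ?_
          filter_upwards [hD (toL2 d (w i)) (grad (w i) j),
            hD (toL2 d (w i)) (grad (w i) j - grad v j),
            Lp.coeFn_sub (grad (w i) j) (grad v j)] with x e1 e2 e3
          rw [e1, e2, e3, Pi.sub_apply]
          simp only [Ψ, ContinuousMap.coe_mk]
          ring
        · obtain ⟨B, hB⟩ := isCompact_univ.exists_bound_of_continuousOn hψ.continuous.continuousOn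
          exact ((Lp.memLp _).integrable (by norm_num)).mul_bdd (c := B)
            hψ.continuous.aestronglyMeasurable (ae_of_all _ fun x => hB x trivial)
      simp only [hsplit]
      have l1 : Tendsto (fun i => inner ℝ (ContinuousMap.toLp 2 volume ℝ Ψ : L2 d)
          (D (toL2 d (w i)) (grad (w i) j - grad v j))) atTop (𝓝 0) := by
        have h2 : Tendsto (fun i => ‖(ContinuousMap.toLp 2 volume ℝ Ψ : L2 d)‖ *
            (K * ‖grad (w i) j - grad v j‖)) atTop (𝓝 0) := by
          simpa using (hgrad.const_mul K).const_mul ‖(ContinuousMap.toLp 2 volume ℝ Ψ : L2 d)‖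
        refine squeeze_zero_norm (fun i => ?_) h2
        refine (norm_inner_le_norm _ _).trans ?_
        gcongr
        refine Lp.norm_le_mul_norm_of_ae_le_mul ?_
        filter_upwards [hD (toL2 d (w i)) (grad (w i) j - grad v j)] with x e1
        rw [e1, norm_mul]
        gcongr
        exact hK _
      have l2 : Tendsto (fun i => ∫ x, F' (toL2 d (w i) x) * grad v j x * ψ x) atTop
          (𝓝 (∫ x, (D (toL2 d v) (grad v j)) x * ψ x)) := by
        have e : ∫ x, (D (toL2 d v) (grad v j)) x * ψ x
            = ∫ x, F' (toL2 d v x) * grad v j x * ψ x := by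
          refine integral_congr_ae ?_
          filter_upwards [hD (toL2 d v) (grad v j)] with x hx
          rw [hx]
        rw [e]
        obtain ⟨B, hB⟩ := isCompact_univ.exists_bound_of_continuousOn hψ.continuous.continuousOn
        have hK0 : 0 ≤ K := (abs_nonneg _).trans (hK 0)
        refine tendsto_integral_of_dominated_convergence (fun x => K * |grad v j x| * B)
          (fun i => ((hm _).mul (Lp.aestronglyMeasurable _)).mul
            hψ.continuous.aestronglyMeasurable) ?_ (fun i => ae_of_all _ fun x => ?_) ?_
        · exact ((((Lp.memLp (grad v j)).integrable (by norm_num)).abs).const_mul K).mul_const B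
        · rw [norm_mul, norm_mul]
          have := hB x trivial
          have := hK (toL2 d (w i) x)
          rw [Real.norm_eq_abs, Real.norm_eq_abs]
          gcongr
        · filter_upwards [hlim] with x hx
          exact (((hF'.tendsto _).comp hx).mul_const _).mul_const _
      simpa using l1.add l2
    refine tendsto_nhds_unique lim1 ?_
    simp only [hibp]
    exact lim2.neg
  obtain ⟨z, hz, hzg⟩ := exists_H1 _ _ hweak
  exact ⟨z, by rw [hz]; exact hZ _, fun j => by rw [hzg]; exact hD _ _⟩

/-! ### Bounded multiplication operators and the quadratic form -/

theorem AEBdd.exists_nonneg {f : L2 d} (hf : AEBdd f) : ∃ B, 0 ≤ B ∧ ∀ᵐ x, |f x| ≤ B := by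
  obtain ⟨B, hB⟩ := hf
  exact ⟨|B|, abs_nonneg _, hB.mono fun x hx => hx.trans (le_abs_self B)⟩

theorem AEBdd.add {f g : L2 d} (hf : AEBdd f) (hg : AEBdd g) : AEBdd (f + g) := by
  obtain ⟨A, hA⟩ := hf
  obtain ⟨B, hB⟩ := hg
  refine ⟨A + B, ?_⟩
  filter_upwards [hA, hB, Lp.coeFn_add f g] with x h1 h2 h3
  rw [h3]
  exact (abs_add_le _ _).trans (add_le_add h1 h2)

theorem AEBdd.smul {f : L2 d} (hf : AEBdd f) (c : ℝ) : AEBdd (c • f) := by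
  obtain ⟨A, hA⟩ := hf
  refine ⟨|c| * A, ?_⟩
  filter_upwards [hA, Lp.coeFn_smul c f] with x h1 h3
  rw [h3, Pi.smul_apply, smul_eq_mul, abs_mul]
  gcongr

theorem AEBdd.sub {f g : L2 d} (hf : AEBdd f) (hg : AEBdd g) : AEBdd (f - g) := by
  have := hf.add (hg.smul (-1))
  rwa [neg_one_smul, ← sub_eq_add_neg] at this

/-- For unbounded `b` the assertion is vacuous, which lets `mulOp` be a total function of `b`
without a proof of boundedness among its arguments. -/
theorem exists_mulOp (b : L2 d) :
    ∃ T : L2 d →L[ℝ] L2 d, AEBdd b → ∀ f, T f =ᵐ[volume] fun x => b x * f x := by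
  by_cases hb : AEBdd b
  · obtain ⟨B, hB0, hB⟩ := hb.exists_nonneg
    have hm := fun f => memLp_mul_of_bdd hb f
    refine ⟨LinearMap.mkContinuous
      { toFun := fun f => (hm f).toLp
        map_add' := fun f g => ?_
        map_smul' := fun c f => ?_ } B fun f => ?_, fun _ f => (hm f).coeFn_toLp⟩
    · refine Lp.ext ?_
      filter_upwards [(hm f).coeFn_toLp, (hm g).coeFn_toLp, (hm (f + g)).coeFn_toLp,
        Lp.coeFn_add f g, Lp.coeFn_add (hm f).toLp (hm g).toLp] with x h1 h2 h3 h4 h5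
      rw [h3, h5, Pi.add_apply, h1, h2, h4, Pi.add_apply, mul_add]
    · refine Lp.ext ?_
      filter_upwards [(hm f).coeFn_toLp, (hm (c • f)).coeFn_toLp,
        Lp.coeFn_smul c f, Lp.coeFn_smul c (hm f).toLp] with x h1 h3 h4 h5
      rw [h3, RingHom.id_apply, h5, Pi.smul_apply, h1, h4, Pi.smul_apply, smul_eq_mul, smul_eq_mul]
      ring
    · refine Lp.norm_le_mul_norm_of_ae_le_mul ?_
      filter_upwards [(hm f).coeFn_toLp, hB] with x h1 h2
      change ‖((hm f).toLp : L2 d) x‖ ≤ _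
      rw [h1, norm_mul, Real.norm_eq_abs]
      gcongr
  · exact ⟨0, fun h => absurd h hb⟩

/-- The operator of multiplication by a bounded function. -/
noncomputable def mulOp (b : L2 d) : L2 d →L[ℝ] L2 d := (exists_mulOp b).choose

theorem coeFn_mulOp {b : L2 d} (hb : AEBdd b) (f : L2 d) :
    mulOp b f =ᵐ[volume] fun x => b x * f x := (exists_mulOp b).choose_spec hb f

theorem norm_mulOp_le {b : L2 d} {B : ℝ} (hb : ∀ᵐ x, |b x| ≤ B) (f : L2 d) :
    ‖mulOp b f‖ ≤ B * ‖f‖ := by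
  refine Lp.norm_le_mul_norm_of_ae_le_mul ?_
  filter_upwards [coeFn_mulOp ⟨B, hb⟩ f, hb] with x h1 h2
  rw [h1, norm_mul, Real.norm_eq_abs]
  gcongr

theorem AEBdd.mulOp {b f : L2 d} (hb : AEBdd b) (hf : AEBdd f) : AEBdd (mulOp b f) := by
  obtain ⟨A, hA0, hA⟩ := hb.exists_nonneg
  obtain ⟨B, hB⟩ := hf
  refine ⟨A * B, ?_⟩
  filter_upwards [coeFn_mulOp hb f, hA, hB] with x h1 h2 h3
  rw [h1, abs_mul]
  gcongr

theorem integral_mulOp {b : L2 d} (hb : AEBdd b) (f g : L2 d) :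
    inner ℝ (mulOp b f) g = ∫ x, b x * f x * g x := by
  rw [inner_eq_integral]
  refine integral_congr_ae ?_
  filter_upwards [coeFn_mulOp hb f] with x h1
  rw [h1]

theorem integrable_mulOp {b : L2 d} (hb : AEBdd b) (f g : L2 d) :
    Integrable fun x => b x * f x * g x := by
  refine (integrable_mul_L2 (mulOp b f) g).congr ?_
  filter_upwards [coeFn_mulOp hb f] with x h1
  rw [h1]

theorem inner_mulOp_comm {b : L2 d} (hb : AEBdd b) (f g : L2 d) :
    inner ℝ (mulOp b f) g = inner ℝ (mulOp b g) f := by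
  rw [integral_mulOp hb, integral_mulOp hb]
  simp only [mul_right_comm]

/-- The bilinear form `∫ ∇x · ∇y + ∫ b x y` on `H¹`. -/
noncomputable def form (b : L2 d) (x y : H1 d) : ℝ :=
  ∑ j, inner ℝ (grad x j) (grad y j) + inner ℝ (mulOp b (toL2 d x)) (toL2 d y)

theorem form_comm {b : L2 d} (hb : AEBdd b) (x y : H1 d) : form b x y = form b y x := by
  rw [form, form, inner_mulOp_comm hb]
  simp only [real_inner_comm]

theorem form_add_left (b : L2 d) (x y z : H1 d) : form b (x + y) z = form b x z + form b y z := by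
  simp only [form, grad_add, map_add, inner_add_left, Finset.sum_add_distrib]
  ring

theorem form_sub_left (b : L2 d) (x y z : H1 d) : form b (x - y) z = form b x z - form b y z := by
  simp only [form, grad_sub, map_sub, inner_sub_left, Finset.sum_sub_distrib]
  ring

theorem form_smul_left (b : L2 d) (c : ℝ) (x z : H1 d) : form b (c • x) z = c * form b x z := by
  simp only [form, grad_smul, map_smul, real_inner_smul_left, ← Finset.mul_sum]
  ring

theorem form_add_right (b : L2 d) (x y z : H1 d) : form b x (y + z) = form b x y + form b x z := by
  simp only [form, grad_add, map_add, inner_add_right, Finset.sum_add_distrib]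
  ring

theorem form_sub_right (b : L2 d) (x y z : H1 d) : form b x (y - z) = form b x y - form b x z := by
  simp only [form, grad_sub, map_sub, inner_sub_right, Finset.sum_sub_distrib]
  ring

theorem form_smul_right (b : L2 d) (c : ℝ) (x z : H1 d) : form b x (c • z) = c * form b x z := by
  simp only [form, grad_smul, map_smul, real_inner_smul_right, ← Finset.mul_sum]
  ring

theorem form_eq_inner (b : L2 d) (x y : H1 d) : form b x y
    = inner ℝ x y - inner ℝ (toL2 d x) (toL2 d y) + inner ℝ (mulOp b (toL2 d x)) (toL2 d y) := by
  rw [form, inner_H1]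
  ring

theorem form_self (b : L2 d) (x : H1 d) : form b x x
    = ‖x‖ ^ 2 - ‖toL2 d x‖ ^ 2 + inner ℝ (mulOp b (toL2 d x)) (toL2 d x) := by
  rw [form_eq_inner, real_inner_self_eq_norm_sq, real_inner_self_eq_norm_sq]

theorem abs_form_le {b : L2 d} {B : ℝ} (hB0 : 0 ≤ B) (hb : ∀ᵐ x, |b x| ≤ B) (x y : H1 d) :
    |form b x y| ≤ (2 + B) * (‖x‖ * ‖y‖) := by
  rw [form_eq_inner]
  have h1 := abs_real_inner_le_norm x y
  have h2 : |inner ℝ (toL2 d x) (toL2 d y)| ≤ ‖x‖ * ‖y‖ :=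
    (abs_real_inner_le_norm _ _).trans (by gcongr <;> exact norm_toL2_le _)
  have h3 : |inner ℝ (mulOp b (toL2 d x)) (toL2 d y)| ≤ B * (‖x‖ * ‖y‖) := by
    refine (abs_real_inner_le_norm _ _).trans ?_
    rw [← mul_assoc]
    gcongr
    · exact (norm_mulOp_le hb _).trans (by gcongr; exact norm_toL2_le _)
    · exact norm_toL2_le _
  rw [abs_le] at *
  constructor <;> linarith

/-! ### The energy and its Euler–Lagrange equation -/

theorem integrable_grad_sq (x : H1 d) (j : Fin d) : Integrable fun p => grad x j p ^ 2 :=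
  (Lp.memLp _).integrable_sq

theorem energy_eq {V : L2 d} (hV : AEBdd V) (x : H1 d) :
    energy V x = 1 / 2 * form V x x + 1 / 4 * ∫ p, toL2 d x p ^ 4 := by
  rw [energy, form, integral_finsetSum _ fun j _ => integrable_grad_sq x j, integral_mulOp hV]
  simp only [real_inner_self_eq_norm_sq, norm_sq_eq_integral, mul_assoc, ← sq]
  ring

/-- The product is at most the fourth power of the larger factor, hence at most the sum of the two
fourth powers. -/
theorem integrable_pow_mul_pow (hd : d ≤ 3) (x y : H1 d) {a b : ℕ} (hab : a + b = 4) :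
    Integrable fun p => toL2 d x p ^ a * toL2 d y p ^ b := by
  refine ((integral_pow_four_le hd x).1.add (integral_pow_four_le hd y).1).mono
    (((Lp.aestronglyMeasurable _).pow a).mul ((Lp.aestronglyMeasurable _).pow b))
    (ae_of_all _ fun p => ?_)
  have h4 : ∀ s : ℝ, s ^ 4 = |s| ^ 4 := fun s => by rw [← abs_pow, abs_of_nonneg (by positivity)]
  rw [norm_mul, norm_pow, norm_pow, Real.norm_eq_abs, Real.norm_eq_abs, Real.norm_of_nonneg
    (by simp only [Pi.add_apply]; positivity), Pi.add_apply, h4, h4 (toL2 d y p)]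
  have hs := abs_nonneg (toL2 d x p)
  have ht := abs_nonneg (toL2 d y p)
  generalize |toL2 d x p| = s at hs ⊢
  generalize |toL2 d y p| = t at ht ⊢
  rcases le_total s t with h | h
  · calc s ^ a * t ^ b ≤ t ^ a * t ^ b := by gcongr
      _ = t ^ 4 := by rw [← pow_add, hab]
      _ ≤ _ := le_add_of_nonneg_left (by positivity)
  · calc s ^ a * t ^ b ≤ s ^ a * s ^ b := by gcongr
      _ = s ^ 4 := by rw [← pow_add, hab]
      _ ≤ _ := le_add_of_nonneg_right (by positivity)

theorem integral_pow_four_add (hd : d ≤ 3) (x y : H1 d) (t : ℝ) :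
    ∫ p, toL2 d (x + t • y) p ^ 4 = (∫ p, toL2 d x p ^ 4)
      + t * (4 * ∫ p, toL2 d x p ^ 3 * toL2 d y p ^ 1)
      + t ^ 2 * (6 * ∫ p, toL2 d x p ^ 2 * toL2 d y p ^ 2)
      + t ^ 3 * (4 * ∫ p, toL2 d x p ^ 1 * toL2 d y p ^ 3) + t ^ 4 * ∫ p, toL2 d y p ^ 4 := by
  have i0 := (integral_pow_four_le hd x).1
  have i1 := ((integrable_pow_mul_pow hd x y (a := 3) (b := 1) rfl).const_mul 4).const_mul t
  have i2 := ((integrable_pow_mul_pow hd x y (a := 2) (b := 2) rfl).const_mul 6).const_mul (t ^ 2)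
  have i3 := ((integrable_pow_mul_pow hd x y (a := 1) (b := 3) rfl).const_mul 4).const_mul (t ^ 3)
  have i4 := (integral_pow_four_le hd y).1.const_mul (t ^ 4)
  have j1 := i0.add i1
  simp only [Pi.add_def] at j1
  have j2 := j1.add i2
  simp only [Pi.add_def] at j2
  have j3 := j2.add i3
  simp only [Pi.add_def] at j3
  rw [← integral_const_mul, ← integral_const_mul, ← integral_const_mul, ← integral_const_mul,
    ← integral_const_mul, ← integral_const_mul, ← integral_const_mul,
    ← integral_add i0 i1, ← integral_add j1 i2, ← integral_add j2 i3, ← integral_add j3 i4]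
  refine integral_congr_ae ?_
  rw [map_add, map_smul]
  filter_upwards [Lp.coeFn_add (toL2 d x) (t • toL2 d y), Lp.coeFn_smul t (toL2 d y)] with p h1 h2
  rw [h1, Pi.add_apply, h2, Pi.smul_apply, smul_eq_mul]
  ring

/-- The Euler–Lagrange equation of the constrained minimisation problem. -/
theorem IsConstrainedMinimiser.form_add_cubic_eq_zero (hd : d ≤ 3) {V : L2 d} (hV : AEBdd V)
    {S : Submodule ℝ (H1 d)} {u v : H1 d} (hu : IsConstrainedMinimiser V S u) (hv : v ∈ S)
    (huv : inner ℝ (toL2 d u) (toL2 d v) = 0) :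
    form V u v + ∫ p, toL2 d u p ^ 3 * toL2 d v p ^ 1 = 0 := by
  obtain ⟨huS, hu1, hmin⟩ := hu
  set s := ‖toL2 d v‖ ^ 2 with hs
  set A1 := form V u v
  set B1 := ∫ p, toL2 d u p ^ 3 * toL2 d v p ^ 1
  set B2 := ∫ p, toL2 d u p ^ 2 * toL2 d v p ^ 2
  set B3 := ∫ p, toL2 d u p ^ 1 * toL2 d v p ^ 3
  set B4 := ∫ p, toL2 d v p ^ 4
  set B0 := ∫ p, toL2 d u p ^ 4
  -- The energy along the normalised curve `(u + t v) / ‖u + t v‖`. Since `v ⊥ u`, the squared norm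
  -- is `1 + t² s`, whose derivative vanishes at `0`; hence `f' 0 = A1 + B1`.
  let f : ℝ → ℝ := fun t => 1 / 2 * (form V u u + t * (2 * A1) + t ^ 2 * form V v v) / (1 + t ^ 2 * s)
    + 1 / 4 * (B0 + t * (4 * B1) + t ^ 2 * (6 * B2) + t ^ 3 * (4 * B3) + t ^ 4 * B4)
      / (1 + t ^ 2 * s) ^ 2
  have hvu : inner ℝ (toL2 d v) (toL2 d u) = 0 := by rw [real_inner_comm]; exact huv
  have hs0 : 0 ≤ s := sq_nonneg _
  have hpos : ∀ t : ℝ, 0 < 1 + t ^ 2 * s := fun t => by positivity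
  have hf : ∀ t, f 0 ≤ f t := fun t => by
    set n := √(1 + t ^ 2 * s) with hn
    have hn0 : 0 < n := Real.sqrt_pos.2 (hpos t)
    have hn2 : n ^ 2 = 1 + t ^ 2 * s := Real.sq_sqrt (hpos t).le
    have hnorm : ‖toL2 d (u + t • v)‖ = n := by
      refine (pow_left_inj₀ (norm_nonneg _) hn0.le two_ne_zero).1 ?_
      rw [hn2, ← real_inner_self_eq_norm_sq, map_add, map_smul, inner_add_left, inner_add_right,
        inner_add_right, real_inner_smul_left, real_inner_smul_right, real_inner_smul_left,
        real_inner_smul_right, hvu, huv, real_inner_self_eq_norm_sq,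
        real_inner_self_eq_norm_sq, hu1]
      ring
    have h1 := hmin (n⁻¹ • (u + t • v)) (S.smul_mem _ (S.add_mem huS (S.smul_mem _ hv))) (by
      rw [map_smul, norm_smul, hnorm, Real.norm_of_nonneg (inv_nonneg.2 hn0.le),
        inv_mul_cancel₀ hn0.ne'])
    have h2 : ∫ p, toL2 d (n⁻¹ • (u + t • v)) p ^ 4
        = (n ^ 2)⁻¹ ^ 2 * ∫ p, toL2 d (u + t • v) p ^ 4 := by
      rw [← integral_const_mul]
      refine integral_congr_ae ?_
      rw [map_smul]
      filter_upwards [Lp.coeFn_smul n⁻¹ (toL2 d (u + t • v))] with p hp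
      rw [hp, Pi.smul_apply, smul_eq_mul]
      ring
    rw [energy_eq hV, energy_eq hV, h2, integral_pow_four_add hd, form_smul_left, form_smul_right,
      form_add_left, form_add_right, form_add_right, form_smul_left, form_smul_left,
      form_smul_right, form_smul_right, form_comm hV v u] at h1
    have e0 : f 0 = 1 / 2 * form V u u + 1 / 4 * B0 := by simp [f]
    rw [e0]
    change 1 / 2 * form V u u + 1 / 4 * B0 ≤ 1 / 2 * (n⁻¹ * (n⁻¹ * (form V u u + t * A1
      + (t * A1 + t * (t * form V v v))))) + 1 / 4 * ((n ^ 2)⁻¹ ^ 2 * (B0 + t * (4 * B1)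
      + t ^ 2 * (6 * B2) + t ^ 3 * (4 * B3) + t ^ 4 * B4)) at h1
    refine h1.trans (le_of_eq ?_)
    simp only [f, ← hn2]
    field_simp
    ring
  have hmin' : IsLocalMin f 0 := Eventually.of_forall hf
  have h1 : HasDerivAt (fun t : ℝ => 1 + t ^ 2 * s) 0 0 := by
    simpa using ((hasDerivAt_pow 2 (0 : ℝ)).mul_const s).const_add 1
  have h2 : HasDerivAt (fun t : ℝ => 1 / 2 * (form V u u + t * (2 * A1) + t ^ 2 * form V v v))
      A1 0 := by
    have := ((((hasDerivAt_id (0 : ℝ)).mul_const (2 * A1)).const_add (form V u u)).add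
      ((hasDerivAt_pow 2 (0 : ℝ)).mul_const (form V v v))).const_mul (1 / 2)
    convert! this using 1
    simp
  have h3 : HasDerivAt (fun t : ℝ => 1 / 4 * (B0 + t * (4 * B1) + t ^ 2 * (6 * B2)
      + t ^ 3 * (4 * B3) + t ^ 4 * B4)) B1 0 := by
    have := (((((((hasDerivAt_id (0 : ℝ)).mul_const (4 * B1)).const_add B0).add
      ((hasDerivAt_pow 2 (0 : ℝ)).mul_const (6 * B2))).add
      ((hasDerivAt_pow 3 (0 : ℝ)).mul_const (4 * B3))).add
      ((hasDerivAt_pow 4 (0 : ℝ)).mul_const B4))).const_mul (1 / 4)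
    convert! this using 1
    simp
  have h4 := (h2.div h1 (by simp)).add (h3.div (h1.pow 2) (by simp))
  have h5 := hmin'.hasDerivAt_eq_zero h4
  simpa using h5

/-! ### The weak maximum principle and the upper bound for the ground state -/

/-- A continuously differentiable substitute for the positive part of `s - K`. -/
theorem exists_smooth_posPart (K : ℝ) : ∃ F F' : ℝ → ℝ, (∀ s, HasDerivAt F (F' s) s) ∧
    Continuous F' ∧ (∀ s, |F' s| ≤ 1) ∧ (∀ s, 0 ≤ F' s) ∧ (∀ s, s ≤ K → F s = 0) ∧
      ∀ s, K < s → 0 < F s := by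
  -- The derivative is cut off at `1` because the chain rule needs it bounded.
  have hc : Continuous fun t : ℝ => min (max (t - K) 0) 1 := by fun_prop
  refine ⟨fun s => ∫ t in K..s, min (max (t - K) 0) 1, fun t => min (max (t - K) 0) 1,
    fun s => (hc.integral_hasStrictDerivAt K s).hasDerivAt, hc, fun s => ?_, fun s => ?_,
    fun s hs => ?_, fun s hs => ?_⟩
  · rw [abs_of_nonneg (le_min (le_max_right _ _) zero_le_one)]
    exact min_le_right _ _
  · exact le_min (le_max_right _ _) zero_le_one
  · beta_reduce
    rw [intervalIntegral.integral_symm, neg_eq_zero]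
    refine intervalIntegral.integral_zero_ae (ae_of_all _ fun t ht => ?_)
    rw [Set.uIoc_of_le hs] at ht
    rw [max_eq_right (by linarith [ht.2]), min_eq_left zero_le_one]
  · refine intervalIntegral.intervalIntegral_pos_of_pos_on (hc.intervalIntegrable _ _)
      (fun t ht => lt_min (lt_max_of_lt_left (by linarith [ht.1])) one_pos) hs

/-- The weak maximum principle for `M - Δ`, `M > 0`. -/
theorem ae_nonneg_of_resolvent {z : H1 d} {f : L2 d} {M : ℝ} (hM : 0 < M)
    (h : ∀ v : H1 d, ∑ j, inner ℝ (grad z j) (grad v j) + M * inner ℝ (toL2 d z) (toL2 d v)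
      = inner ℝ f (toL2 d v)) (hf : ∀ᵐ x, 0 ≤ f x) : ∀ᵐ x, 0 ≤ toL2 d z x := by
  obtain ⟨F, F', hF, hFc, hF1, hF0, hFz, hFp⟩ := exists_smooth_posPart 0
  have hFnn : ∀ s, 0 ≤ F s := fun s => by
    rcases le_or_gt s 0 with h | h
    · exact (hFz s h).ge
    · exact (hFp s h).le
  -- Testing with a smoothed positive part of `-z` makes both terms on the left nonpositive and the
  -- right side nonnegative, so all of them vanish.
  obtain ⟨v, hv, hvg⟩ := exists_H1_comp hF hFc hF1 (-z)
  have hneg : toL2 d (-z) =ᵐ[volume] fun x => -toL2 d z x := by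
    rw [map_neg]; exact Lp.coeFn_neg _
  have h1 := h v
  have h2 : ∀ j, inner ℝ (grad z j) (grad v j) ≤ 0 := fun j => by
    rw [inner_eq_integral]
    refine integral_nonpos_of_ae ?_
    have : grad (-z) j = -grad z j := by
      rw [← neg_one_smul ℝ, grad_smul, neg_one_smul]
    filter_upwards [hvg j, Lp.coeFn_neg (grad z j)] with x e1 e2
    rw [e1, this, e2]
    have := hF0 (toL2 d (-z) x)
    simp only [Pi.neg_apply, Pi.zero_apply]
    nlinarith [mul_nonneg this (sq_nonneg (grad z j x))]
  have hle : ∀ᵐ x, toL2 d z x * toL2 d v x ≤ 0 := by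
    filter_upwards [hv, hneg] with x e1 e2
    rw [e1, e2]
    rcases le_or_gt 0 (toL2 d z x) with h | h
    · rw [hFz _ (by linarith)]; simp
    · exact mul_nonpos_of_nonpos_of_nonneg h.le (hFnn _)
  have h3 : 0 ≤ inner ℝ f (toL2 d v) := by
    rw [inner_eq_integral]
    refine integral_nonneg_of_ae ?_
    filter_upwards [hf, hv] with x e1 e2
    rw [e2]
    exact mul_nonneg e1 (hFnn _)
  have h4 : inner ℝ (toL2 d z) (toL2 d v) = 0 := by
    refine le_antisymm ?_ ?_
    · rw [inner_eq_integral]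
      exact integral_nonpos_of_ae hle
    · have := Finset.sum_nonpos fun j (_ : j ∈ Finset.univ) => h2 j
      nlinarith
  rw [inner_eq_integral] at h4
  have h5 : ∫ x, -(toL2 d z x * toL2 d v x) = 0 := by rw [integral_neg, h4, neg_zero]
  have h6 : Integrable fun x => -(toL2 d z x * toL2 d v x) := (integrable_mul_L2 _ _).neg
  rw [integral_eq_zero_iff_of_nonneg_ae (hle.mono fun x hx => by
    simp only [Pi.zero_apply]; linarith) h6] at h5
  filter_upwards [h5, hv, hneg] with x e0 e1 e2
  by_contra hlt
  push Not at hlt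
  rw [e2] at e1
  have := hFp (-toL2 d z x) (by linarith)
  rw [← e1] at this
  simp only [Pi.zero_apply, neg_eq_zero, mul_eq_zero] at e0
  rcases e0 with h | h <;> linarith

/-- The data of the Gross–Pitaevskii problem: `u` is the positive ground state for the
potential `V`. -/
structure IsGroundState (V : L2 d) (u : H1 d) : Prop where
  dim_le : d ≤ 3
  memH2 : MemH2 V
  potential_pos : ∀ᵐ x, 0 < V x
  isMin : IsConstrainedMinimiser V ⊤ u
  pos : ∀ᵐ x, 0 < toL2 d u x

/-- The Lagrange multiplier `∫ |∇u|² + ∫ V u² + ∫ u⁴`. -/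
noncomputable def multiplier (V : L2 d) (u : H1 d) : ℝ :=
  form V u u + ∫ x, toL2 d u x ^ 3 * toL2 d u x ^ 1

namespace IsGroundState

variable {V : L2 d} {u : H1 d}

theorem aeBdd_potential (h : IsGroundState V u) : AEBdd V := ⟨_, h.memH2.ae_abs_le h.dim_le⟩

theorem inner_self (h : IsGroundState V u) : inner ℝ (toL2 d u) (toL2 d u) = 1 := by
  rw [real_inner_self_eq_norm_sq, h.isMin.2.1, one_pow]

/-- Splitting `v` along `u` removes the orthogonality constraint: the orthogonal part contributes
nothing, and the part along `u` produces the multiplier. -/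
theorem form_add_cubic (h : IsGroundState V u) (v : H1 d) :
    form V u v + ∫ x, toL2 d u x ^ 3 * toL2 d v x ^ 1
      = multiplier V u * inner ℝ (toL2 d u) (toL2 d v) := by
  set c := inner ℝ (toL2 d u) (toL2 d v) with hc
  have h1 := h.isMin.form_add_cubic_eq_zero h.dim_le h.aeBdd_potential
    (v := v - c • u) Submodule.mem_top (by
      rw [map_sub, map_smul, inner_sub_right, real_inner_smul_right, h.inner_self, mul_one, ← hc,
        sub_self])
  have h2 : ∫ x, toL2 d u x ^ 3 * toL2 d (v - c • u) x ^ 1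
      = (∫ x, toL2 d u x ^ 3 * toL2 d v x ^ 1) - c * ∫ x, toL2 d u x ^ 3 * toL2 d u x ^ 1 := by
    rw [← integral_const_mul, ← integral_sub (integrable_pow_mul_pow h.dim_le u v rfl)
      ((integrable_pow_mul_pow h.dim_le u u rfl).const_mul c)]
    refine integral_congr_ae ?_
    rw [map_sub, map_smul]
    filter_upwards [Lp.coeFn_sub (toL2 d v) (c • toL2 d u), Lp.coeFn_smul c (toL2 d u)]
      with x e1 e2
    rw [e1, Pi.sub_apply, e2, Pi.smul_apply, smul_eq_mul]
    ring
  rw [h2, form_sub_right, form_smul_right] at h1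
  rw [multiplier]
  linarith

theorem multiplier_nonneg (h : IsGroundState V u) : 0 ≤ multiplier V u := by
  rw [multiplier, form]
  refine add_nonneg (add_nonneg (Finset.sum_nonneg fun j _ => real_inner_self_nonneg) ?_)
    (integral_nonneg fun x => ?_)
  · rw [integral_mulOp h.aeBdd_potential]
    refine integral_nonneg_of_ae ?_
    filter_upwards [h.potential_pos] with x hx
    simp only [Pi.zero_apply, mul_assoc]
    exact mul_nonneg hx.le (mul_self_nonneg _)
  · simp only [Pi.zero_apply]
    rw [← pow_add]
    exact Even.pow_nonneg (by decide) _

/-- The ground state is bounded by the square root of the Lagrange multiplier. -/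
theorem le_sqrt_multiplier (h : IsGroundState V u) :
    ∀ᵐ x, toL2 d u x ≤ √(multiplier V u) := by
  set K := √(multiplier V u) with hK
  have hK0 : 0 ≤ K := Real.sqrt_nonneg _
  have hK2 : K ^ 2 = multiplier V u := Real.sq_sqrt h.multiplier_nonneg
  obtain ⟨F, F', hF, hFc, hF1, hF0, hFz, hFp⟩ := exists_smooth_posPart K
  -- The test function is a smoothed positive part of `u - K`.
  obtain ⟨v, hv, hvg⟩ := exists_H1_comp hF hFc hF1 u
  have h1 := h.form_add_cubic v
  rw [form, integral_mulOp h.aeBdd_potential, inner_eq_integral, ← integral_const_mul] at h1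
  have i1 := integrable_mulOp h.aeBdd_potential (toL2 d u) (toL2 d v)
  have i2 := integrable_pow_mul_pow h.dim_le u v (a := 3) (b := 1) rfl
  have i3 := (integrable_mul_L2 (toL2 d u) (toL2 d v)).const_mul (multiplier V u)
  have h2 : 0 ≤ ∑ j, inner ℝ (grad u j) (grad v j) := Finset.sum_nonneg fun j _ => by
    rw [inner_eq_integral]
    refine integral_nonneg_of_ae ?_
    filter_upwards [hvg j] with x e1
    rw [e1]
    have := hF0 (toL2 d u x)
    simp only [Pi.zero_apply]
    nlinarith [mul_nonneg this (sq_nonneg (grad u j x))]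
  -- The zeroth-order part of the equation. Since `K² = λ`, it equals `F(u) u (V + u² - K²) ≥ 0`;
  -- the gradient part is nonnegative too, so its integral is zero, which forces `u ≤ K`.
  let R : Torus d → ℝ := fun x => V x * toL2 d u x * toL2 d v x
    + toL2 d u x ^ 3 * toL2 d v x ^ 1 - multiplier V u * (toL2 d u x * toL2 d v x)
  have hRi : Integrable R := (i1.add i2).sub i3
  have hR : R =ᵐ[volume] fun x => F (toL2 d u x) *
      (toL2 d u x * (V x + (toL2 d u x ^ 2 - K ^ 2))) := by
    filter_upwards [hv] with x e1
    simp only [R, e1, hK2]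
    ring
  have hR0 : 0 ≤ᵐ[volume] R := by
    filter_upwards [hR, h.potential_pos] with x e1 e2
    rw [e1, Pi.zero_apply]
    rcases le_or_gt (toL2 d u x) K with hx | hx
    · rw [hFz _ hx, zero_mul]
    · refine mul_nonneg (hFp _ hx).le (mul_nonneg (hK0.trans hx.le) ?_)
      nlinarith
  have hRint : ∫ x, R x = 0 := by
    refine le_antisymm ?_ (integral_nonneg_of_ae hR0)
    have : ∫ x, R x = (∫ x, V x * toL2 d u x * toL2 d v x)
        + (∫ x, toL2 d u x ^ 3 * toL2 d v x ^ 1)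
        - ∫ x, multiplier V u * (toL2 d u x * toL2 d v x) := by
      have i4 := i1.add i2
      simp only [Pi.add_def] at i4
      rw [← integral_add i1 i2, ← integral_sub i4 i3]
    rw [this]
    linarith
  rw [integral_eq_zero_iff_of_nonneg_ae hR0 hRi] at hRint
  filter_upwards [hRint, hR, h.potential_pos] with x e1 e2 e3
  by_contra hlt
  push Not at hlt
  rw [e2, Pi.zero_apply] at e1
  have : 0 < F (toL2 d u x) * (toL2 d u x * (V x + (toL2 d u x ^ 2 - K ^ 2))) := by
    refine mul_pos (hFp _ hlt) (mul_pos (hK0.trans_lt hlt) ?_)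
    nlinarith
  linarith

theorem aeBdd (h : IsGroundState V u) : AEBdd (toL2 d u) := by
  refine ⟨√(multiplier V u), ?_⟩
  filter_upwards [h.le_sqrt_multiplier, h.pos] with x e1 e2
  rwa [abs_of_pos e2]

end IsGroundState

/-! ### The linearised operators and `H²` regularity -/

/-- The effective potential `V + c u² - λ`. -/
noncomputable def effPot (c : ℝ) (V : L2 d) (u : H1 d) : L2 d :=
  V + c • mulOp (toL2 d u) (toL2 d u) - Lp.const 2 volume (multiplier V u)

theorem aeBdd_const (c : ℝ) : AEBdd (Lp.const 2 (volume : Measure (Torus d)) c) :=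
  ⟨|c|, by
    filter_upwards [Lp.coeFn_const (p := 2) (μ := (volume : Measure (Torus d))) c] with x hx
    rw [hx, Function.const_apply]⟩

namespace IsGroundState

variable {V : L2 d} {u : H1 d}

theorem aeBdd_effPot (h : IsGroundState V u) (c : ℝ) : AEBdd (effPot c V u) :=
  (h.aeBdd_potential.add ((h.aeBdd.mulOp h.aeBdd).smul c)).sub (aeBdd_const _)

theorem coeFn_effPot (h : IsGroundState V u) (c : ℝ) : effPot c V u =ᵐ[volume]
    fun x => V x + c * toL2 d u x ^ 2 - multiplier V u := by
  rw [effPot]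
  filter_upwards [Lp.coeFn_sub (V + c • mulOp (toL2 d u) (toL2 d u))
      (Lp.const 2 volume (multiplier V u)), Lp.coeFn_add V (c • mulOp (toL2 d u) (toL2 d u)),
    Lp.coeFn_smul c (mulOp (toL2 d u) (toL2 d u)), coeFn_mulOp h.aeBdd (toL2 d u),
    Lp.coeFn_const (p := 2) (μ := (volume : Measure (Torus d))) (multiplier V u)]
    with x e1 e2 e3 e4 e5
  rw [e1, Pi.sub_apply, e2, Pi.add_apply, e3, Pi.smul_apply, e4, e5, Function.const_apply,
    smul_eq_mul, sq]

theorem form_effPot (h : IsGroundState V u) (c : ℝ) (x y : H1 d) : form (effPot c V u) x y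
    = form V x y + c * inner ℝ (mulOp (mulOp (toL2 d u) (toL2 d u)) (toL2 d x)) (toL2 d y)
      - multiplier V u * inner ℝ (toL2 d x) (toL2 d y) := by
  have hu2 := h.aeBdd.mulOp h.aeBdd
  rw [form, form, add_sub_assoc, add_assoc]
  congr 1
  rw [integral_mulOp (h.aeBdd_effPot c), integral_mulOp h.aeBdd_potential, integral_mulOp hu2,
    inner_eq_integral, ← integral_const_mul, ← integral_const_mul, ← integral_sub, ← integral_add]
  · refine integral_congr_ae ?_
    filter_upwards [h.coeFn_effPot c, coeFn_mulOp h.aeBdd (toL2 d u)] with p e1 e2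
    rw [e1, e2]
    ring
  · exact integrable_mulOp h.aeBdd_potential _ _
  · exact ((integrable_mulOp hu2 _ _).const_mul c).sub ((integrable_mul_L2 _ _).const_mul _)
  · exact (integrable_mulOp hu2 _ _).const_mul c
  · exact (integrable_mul_L2 _ _).const_mul _

/-- The eigenvalue equation `(-Δ + V + u² - λ) u = 0`. -/
theorem form_effPot_one (h : IsGroundState V u) (v : H1 d) : form (effPot 1 V u) u v = 0 := by
  rw [h.form_effPot, ← h.form_add_cubic v, integral_mulOp (h.aeBdd.mulOp h.aeBdd), one_mul,
    add_sub_add_left_eq_sub, sub_eq_zero]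
  refine integral_congr_ae ?_
  filter_upwards [coeFn_mulOp h.aeBdd (toL2 d u)] with p e2
  rw [e2]
  ring

/-- The ground state is in the Sobolev space of order two. -/
theorem memH2_ground (h : IsGroundState V u) : MemH2 (toL2 d u) := by
  -- The equation rewritten as `(1 - Δ) u = u - W u`, where `W` is the effective potential; the
  -- right side is in `L²` because `W` is bounded.
  have h1 : ∀ v, inner ℝ u v = inner ℝ (toL2 d u - mulOp (effPot 1 V u) (toL2 d u)) (toL2 d v) :=
    fun v => by
      have := h.form_effPot_one v
      rw [form_eq_inner] at this
      rw [inner_sub_left]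
      linarith
  refine (hasSum_sq_fc (toL2 d u - mulOp (effPot 1 V u) (toL2 d u))).summable.congr fun k => ?_
  rw [← wt_mul_fc_eq_of_forall h1 k, norm_mul, mul_pow]
  simp [abs_of_pos (wt_pos k)]

end IsGroundState

/-! ### The strong maximum principle -/

/-- The resolvent `(M - Δ)⁻¹` on the torus, with its Fourier symbol. -/
theorem exists_resolvent {M : ℝ} (hM : 1 ≤ M) (f : L2 d) : ∃ z : H1 d,
    (∀ k, fc (toL2 d z) k = fc f k / ((wt k - 1 + M : ℝ) : ℂ)) ∧
    ∀ v : H1 d, ∑ j, inner ℝ (grad z j) (grad v j) + M * inner ℝ (toL2 d z) (toL2 d v)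
      = inner ℝ f (toL2 d v) := by
  have hle : ∀ k : Fin d → ℤ, wt k ≤ wt k - 1 + M := fun k => by linarith
  have hpos : ∀ k : Fin d → ℤ, 0 < wt k - 1 + M := fun k => (wt_pos k).trans_le (hle k)
  obtain ⟨z, hz⟩ := exists_H1_fc_eq (fun k => fc f k / ((wt k - 1 + M : ℝ) : ℂ))
    (fun k => by rw [fc_neg_index, wt_neg, map_div₀, conj_ofReal])
    ((hasSum_sq_fc f).summable.of_nonneg_of_le (fun k => by have := wt_pos k; positivity)
      fun k => by
        have h0 := wt_pos k
        have h1 := hpos k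
        rw [norm_div, div_pow, Complex.norm_real, Real.norm_of_nonneg h1.le, ← mul_div_assoc,
          div_le_iff₀ (by positivity), mul_comm]
        refine mul_le_mul_of_nonneg_left ?_ (sq_nonneg _)
        nlinarith [one_le_wt k, hle k])
  refine ⟨z, hz, fun v => ?_⟩
  have h1 := ((hasSum_inner_H1 z v).sub (hasSum_re_inner_fc (toL2 d z) (toL2 d v))).add
    ((hasSum_re_inner_fc (toL2 d z) (toL2 d v)).mul_left M)
  rw [inner_H1, add_sub_cancel_left] at h1
  refine h1.unique ((hasSum_re_inner_fc f (toL2 d v)).congr_fun fun k => ?_)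
  have hne : ((wt k - 1 + M : ℝ) : ℂ) ≠ 0 := by exact_mod_cast (hpos k).ne'
  have : fc f k = ((wt k - 1 + M : ℝ) : ℂ) * fc (toL2 d z) k := by
    rw [hz]; field_simp
  rw [this, map_mul, conj_ofReal, mul_assoc, re_ofReal_mul]
  ring

theorem fc_zero_eq_integral (f : L2 d) : fc f 0 = ((∫ x, f x : ℝ) : ℂ) := by
  rw [fc_eq_mFourierCoeff, mFourierCoeff, ← integral_complex_ofReal]
  refine integral_congr_ae (ae_of_all _ fun x => ?_)
  simp [mFourier_zero]

theorem norm_fc_le_integral {f : L2 d} (hf : ∀ᵐ x, 0 ≤ f x) (k : Fin d → ℤ) :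
    ‖fc f k‖ ≤ ∫ x, f x := by
  rw [fc_eq_mFourierCoeff, mFourierCoeff]
  refine (norm_integral_le_integral_norm _).trans (le_of_eq (integral_congr_ae ?_))
  filter_upwards [hf] with x hx
  rw [norm_smul, norm_mFourier_apply, one_mul, Complex.norm_real, Real.norm_of_nonneg hx]

theorem one_le_wt_sub_one {k : Fin d → ℤ} (hk : k ≠ 0) : 1 ≤ wt k - 1 := by
  obtain ⟨i, hi⟩ := Function.ne_iff.1 hk
  have h2 := Finset.single_le_sum (f := fun i => (2 * Real.pi * (k i : ℝ)) ^ 2)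
    (fun _ _ => sq_nonneg _) (Finset.mem_univ i)
  have h1 : (1 : ℝ) ≤ (k i : ℝ) ^ 2 := by
    have hi2 : 0 < k i ^ 2 := by have : k i ≠ 0 := hi; positivity
    exact_mod_cast hi2
  simp only [mul_pow] at h2
  rw [wt]
  simp only [mul_pow]
  nlinarith [Real.pi_gt_three, mul_pos Real.pi_pos Real.pi_pos]

/-- The deviation from the mean is the Fourier series without its zero mode; `g` only has to
dominate the remaining coefficients. -/
theorem ae_abs_sub_mean_le {f : L2 d} {g : (Fin d → ℤ) → ℝ} (hg : Summable g)
    (h0 : ∀ k, 0 ≤ g k) (hfg : ∀ k, k ≠ 0 → ‖fc f k‖ ≤ g k) :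
    ∀ᵐ x, |f x - (fc f 0).re| ≤ ∑' k, g k := by
  classical
  have hs : Summable fun k => ‖fc f k‖ := by
    refine Summable.of_norm_bounded_eventually hg ?_
    refine (Set.finite_singleton (0 : Fin d → ℤ)).subset fun k hk => ?_
    by_contra hk0
    exact hk (show ‖‖fc f k‖‖ ≤ g k by rw [norm_norm]; exact hfg k hk0)
  filter_upwards [ae_hasSum_fourier hs] with x hx
  have h1 := hx.sub (hasSum_ite_eq (0 : Fin d → ℤ) (fc f 0))
  have h2 := h1.norm_le_of_bounded hg.hasSum fun k => by
    split_ifs with hk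
    · rw [hk]; simpa [mFourier_zero] using h0 0
    · rw [sub_zero, norm_mul, norm_mFourier_apply, mul_one]
      exact hfg k hk
  refine le_trans ?_ h2
  have h3 := Complex.abs_re_le_norm ((f x : ℂ) - fc f 0)
  simpa using h3

namespace IsGroundState

variable {V : L2 d} {u : H1 d}

theorem integral_pos (h : IsGroundState V u) : 0 < ∫ x, toL2 d u x := by
  have hi : Integrable (toL2 d u) := (Lp.memLp (toL2 d u)).integrable (by norm_num)
  have h0 : 0 ≤ᵐ[volume] toL2 d u := h.pos.mono fun x hx => hx.le
  refine lt_of_le_of_ne (integral_nonneg_of_ae h0) fun h1 => ?_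
  have h2 := (integral_eq_zero_iff_of_nonneg_ae h0 hi).1 h1.symm
  obtain ⟨x, hx1, hx2⟩ := (h2.and h.pos).exists
  exact hx2.ne' hx1

/-- With `W` the effective potential, `(M - Δ) u = (M - W) u ≥ u`. If `z ≤ u` and `(M - Δ) y = z`,
then `(M - Δ)(u - y) ≥ u - z ≥ 0`, and the weak maximum principle gives `y ≤ u`. -/
theorem exists_iterated_resolvent (h : IsGroundState V u) {M : ℝ} (hM : 1 ≤ M)
    (hW : ∀ᵐ x, effPot 1 V u x ≤ M - 1) (m : ℕ) : ∃ z : H1 d,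
    (∀ k, fc (toL2 d z) k = fc (toL2 d u) k / ((wt k - 1 + M : ℝ) : ℂ) ^ m) ∧
      ∀ᵐ x, toL2 d z x ≤ toL2 d u x := by
  induction m with
  | zero => exact ⟨u, fun k => by simp, ae_of_all _ fun x => le_rfl⟩
  | succ m ih =>
    obtain ⟨z, hz, hle⟩ := ih
    obtain ⟨y, hy, hyr⟩ := exists_resolvent hM (toL2 d z)
    refine ⟨y, fun k => by rw [hy, hz, pow_succ, div_div], ?_⟩
    have hnn := ae_nonneg_of_resolvent (z := u - y) (M := M) (by linarith)
      (f := M • toL2 d u - mulOp (effPot 1 V u) (toL2 d u) - toL2 d z) (fun v => by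
        have h1 := h.form_effPot_one v
        have h2 := hyr v
        rw [form] at h1
        simp only [grad_sub, map_sub, inner_sub_left, Finset.sum_sub_distrib,
          real_inner_smul_left]
        linarith) (by
        filter_upwards [hW, hle, h.pos, coeFn_mulOp (h.aeBdd_effPot 1) (toL2 d u),
          Lp.coeFn_smul M (toL2 d u),
          Lp.coeFn_sub (M • toL2 d u) (mulOp (effPot 1 V u) (toL2 d u)),
          Lp.coeFn_sub (M • toL2 d u - mulOp (effPot 1 V u) (toL2 d u)) (toL2 d z)]
          with x e1 e2 e3 e4 e5 e6 e7
        rw [e7, Pi.sub_apply, e6, Pi.sub_apply, e5, Pi.smul_apply, e4, smul_eq_mul]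
        nlinarith)
    rw [map_sub] at hnn
    filter_upwards [hnn, Lp.coeFn_sub (toL2 d u) (toL2 d y)] with x e1 e2
    rw [e2, Pi.sub_apply] at e1
    linarith

/-- The strong maximum principle: the ground state is bounded below by a positive constant. -/
theorem exists_lower_bound (h : IsGroundState V u) : ∃ c : ℝ, 0 < c ∧ ∀ᵐ x, c ≤ toL2 d u x := by
  obtain ⟨B, hB0, hB⟩ := (h.aeBdd_effPot 1).exists_nonneg
  set M := B + 1 with hM
  have hM1 : 1 ≤ M := by linarith
  have hM0 : 0 < M := by linarith
  set S := ∑' k : Fin d → ℤ, (wt k ^ 2)⁻¹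
  -- After rescaling by `M`, the resolvent fixes the zero mode and multiplies every other mode by at
  -- most `ρ`, because `|2πk|² ≥ 1` for `k ≠ 0`.
  set ρ := M / (M + 1)
  have hρ0 : 0 ≤ ρ := by positivity
  have hρ1 : ρ < 1 := (div_lt_one (by positivity)).2 (by linarith)
  obtain ⟨n, hn⟩ : ∃ n : ℕ, ρ ^ n * (M ^ 2 * S) < 1 / 2 := by
    have := (tendsto_pow_atTop_nhds_zero_of_lt_one hρ0 hρ1).mul_const (M ^ 2 * S)
    rw [zero_mul] at this
    exact (this.eventually (gt_mem_nhds (by norm_num))).exists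
  -- Two of the `n + 2` resolvents provide the summable weight, and the other `n` make the nonzero
  -- modes at most half of the mean.
  obtain ⟨z, hz, hle⟩ := h.exists_iterated_resolvent hM1
    (hB.mono fun x hx => (le_abs_self _).trans (by linarith)) (n + 2)
  set U := ∫ x, toL2 d u x
  have hU : 0 < U := h.integral_pos
  have hsum := (summable_wt_sq_inv h.dim_le).mul_left (U * (M ^ (n + 2))⁻¹ * (ρ ^ n * M ^ 2))
  have hmain := ae_abs_sub_mean_le (f := toL2 d z) hsum
    (fun k => by have := wt_pos k; positivity) (fun k hk => by
      have hk1 := one_le_wt_sub_one hk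
      have hk2 := wt_pos k
      have hp : 0 < wt k - 1 + M := by linarith
      rw [hz, norm_div, norm_pow, Complex.norm_real, Real.norm_of_nonneg hp.le, div_eq_mul_inv]
      rw [mul_assoc U, mul_assoc U]
      refine mul_le_mul (norm_fc_le_integral (h.pos.mono fun x hx => hx.le) k) ?_
        (by positivity) hU.le
      have h1 : M / (wt k - 1 + M) ≤ ρ :=
        div_le_div_of_nonneg_left hM0.le (by linarith) (by linarith)
      have h2 : M / (wt k - 1 + M) ≤ M / wt k := by
        gcongr
        linarith
      have h3 : ((wt k - 1 + M) ^ (n + 2))⁻¹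
          = (M ^ (n + 2))⁻¹ * ((M / (wt k - 1 + M)) ^ n * (M / (wt k - 1 + M)) ^ 2) := by
        rw [← pow_add, div_pow]
        field_simp
      rw [h3, mul_assoc]
      refine mul_le_mul_of_nonneg_left ?_ (by positivity)
      calc (M / (wt k - 1 + M)) ^ n * (M / (wt k - 1 + M)) ^ 2 ≤ ρ ^ n * (M / wt k) ^ 2 := by
            gcongr
        _ = ρ ^ n * M ^ 2 * (wt k ^ 2)⁻¹ := by rw [div_pow]; ring)
  refine ⟨U * (M ^ (n + 2))⁻¹ / 2, by positivity, ?_⟩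
  have h0 : (fc (toL2 d z) 0).re = U * (M ^ (n + 2))⁻¹ := by
    rw [hz, fc_zero_eq_integral, wt_zero, sub_self, zero_add, ← ofReal_pow, ← ofReal_div, ofReal_re,
      div_eq_mul_inv]
  filter_upwards [hmain, hle] with x e1 e2
  rw [h0, tsum_mul_left] at e1
  have e3 := (abs_le.1 e1).1
  have e4 : U * (M ^ (n + 2))⁻¹ * (ρ ^ n * (M ^ 2 * S)) ≤ U * (M ^ (n + 2))⁻¹ * (1 / 2) := by
    gcongr
  have e5 : U * (M ^ (n + 2))⁻¹ * (ρ ^ n * M ^ 2) * ∑' k : Fin d → ℤ, (wt k ^ 2)⁻¹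
    = U * (M ^ (n + 2))⁻¹ * (ρ ^ n * (M ^ 2 * S)) := by simp only [S]; ring
  rw [e5] at e3
  linarith

end IsGroundState

/-! ### The spectral gap by the ground state substitution -/

/-- A continuously differentiable function agreeing with `s⁻¹` for `s ≥ c`. -/
theorem exists_smooth_inv {c : ℝ} (hc : 0 < c) : ∃ F F' : ℝ → ℝ, (∀ s, HasDerivAt F (F' s) s) ∧
    Continuous F' ∧ (∀ s, |F' s| ≤ (c ^ 2)⁻¹) ∧ ∀ s, c ≤ s → F s = s⁻¹ ∧ F' s = -(s ^ 2)⁻¹ := by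
  have hm : ∀ t : ℝ, 0 < max t c := fun t => lt_max_of_lt_right hc
  have hcont : Continuous fun t : ℝ => -((max t c) ^ 2)⁻¹ :=
    (Continuous.inv₀ (by fun_prop) fun t => (pow_pos (hm t) 2).ne').neg
  refine ⟨fun s => c⁻¹ + ∫ t in c..s, -((max t c) ^ 2)⁻¹, fun t => -((max t c) ^ 2)⁻¹,
    fun s => (hcont.integral_hasStrictDerivAt c s).hasDerivAt.const_add _, hcont, fun s => ?_,
    fun s hs => ⟨?_, by beta_reduce; rw [max_eq_left hs]⟩⟩
  · rw [abs_neg, abs_of_pos (inv_pos.2 (pow_pos (hm s) 2))]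
    exact inv_anti₀ (by positivity) (pow_le_pow_left₀ hc.le (le_max_right _ _) 2)
  · have h1 : ∫ t in c..s, -((max t c) ^ 2)⁻¹ = s⁻¹ - c⁻¹ := by
      refine intervalIntegral.integral_eq_sub_of_hasDerivAt (f := fun t => t⁻¹) (fun t ht => ?_)
        (hcont.intervalIntegrable _ _)
      rw [Set.uIcc_of_le hs] at ht
      rw [max_eq_left ht.1]
      exact hasDerivAt_inv (hc.trans_le ht.1).ne'
    beta_reduce
    rw [h1]
    ring

/-- The Poincaré inequality on the torus. -/
theorem norm_sub_mean_sq_le (q : H1 d) :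
    ‖toL2 d q - Lp.const 2 volume (∫ x, toL2 d q x)‖ ^ 2 ≤ ∑ j, ‖grad q j‖ ^ 2 := by
  classical
  set m := ∫ x, toL2 d q x with hm
  have h1 := (hasSum_norm_H1 q).sub (hasSum_sq_fc (toL2 d q))
  rw [norm_sq_H1, add_sub_cancel_left] at h1
  refine hasSum_le (fun k => ?_) (hasSum_sq_fc _) h1
  have hconst : fc (Lp.const 2 (volume : Measure (Torus d)) m) k = if k = 0 then (m : ℂ) else 0 := by
    have h2 : complexify d (Lp.const 2 (volume : Measure (Torus d)) m)
        = (m : ℂ) • mFourierBasis (d := Fin d) 0 := by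
      refine Lp.ext ?_
      filter_upwards [coeFn_complexify (Lp.const 2 (volume : Measure (Torus d)) m),
        Lp.coeFn_const (p := 2) (μ := (volume : Measure (Torus d))) m,
        Lp.coeFn_smul (m : ℂ) (mFourierBasis (d := Fin d) 0),
        coeFn_mFourierLp (d := Fin d) 2 0] with x e1 e2 e3 e4
      rw [e1, e2, e3, Pi.smul_apply, coe_mFourierBasis, e4]
      simp [mFourier_zero]
    rw [fc, h2, map_smul, HilbertBasis.repr_self]
    change (m : ℂ) * (lp.single 2 0 (1 : ℂ) : lp (fun _ : Fin d → ℤ => ℂ) 2) k = _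
    rw [lp.single_apply, Pi.single_apply]
    split_ifs <;> simp
  rw [fc_sub, hconst]
  split_ifs with hk
  · rw [hk, fc_zero_eq_integral, ← hm, wt_zero]
    simp
  · have := one_le_wt_sub_one hk
    rw [sub_zero]
    nlinarith [sq_nonneg ‖fc (toL2 d q) k‖]

theorem norm_sub_proj_le {E : Type*} [NormedAddCommGroup E] [InnerProductSpace ℝ E] {e : E}
    (he : ‖e‖ = 1) (v : E) (m : ℝ) : ‖v - (inner ℝ e v) • e‖ ^ 2 ≤ ‖v - m • e‖ ^ 2 := by
  have key : ∀ t : ℝ, ‖v - t • e‖ ^ 2 = ‖v‖ ^ 2 - 2 * t * inner ℝ e v + t ^ 2 := fun t => by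
    rw [norm_sub_sq_real, real_inner_smul_right, norm_smul, he, real_inner_comm, mul_one,
      Real.norm_eq_abs, sq_abs]
    ring
  rw [key, key]
  nlinarith [sq_nonneg (m - inner ℝ e v)]

/-- A form bounded below in `L²` is bounded below in `H¹`. -/
theorem norm_sq_le_form {b : L2 d} {B κ : ℝ} (hB0 : 0 ≤ B) (hκ : 0 < κ)
    (hb : ∀ᵐ x, |b x| ≤ B) {x : H1 d} (hx : κ * ‖toL2 d x‖ ^ 2 ≤ form b x x) :
    κ / (κ + 1 + B) * ‖x‖ ^ 2 ≤ form b x x := by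
  have h1 : |inner ℝ (mulOp b (toL2 d x)) (toL2 d x)| ≤ B * ‖toL2 d x‖ ^ 2 := by
    refine (abs_real_inner_le_norm _ _).trans ?_
    rw [sq, ← mul_assoc]
    gcongr
    exact norm_mulOp_le hb _
  have h2 := form_self b x
  have h3 := (abs_le.1 h1).1
  -- Boundedness of `b` gives `‖x‖² ≤ form b x x + (1 + B) ‖toL2 d x‖²`, and the hypothesis bounds
  -- the last norm by `form b x x / κ`.
  rw [div_mul_eq_mul_div, div_le_iff₀ (by positivity)]
  nlinarith

namespace IsGroundState

variable {V : L2 d} {u : H1 d}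

/-- Jacobi's ground state substitution: the linearised operator at the ground state has a
spectral gap. -/
theorem exists_gap (h : IsGroundState V u) : ∃ κ : ℝ, 0 < κ ∧ ∀ v : H1 d, AEBdd (toL2 d v) →
    κ * ‖toL2 d v - (inner ℝ (toL2 d u) (toL2 d v)) • toL2 d u‖ ^ 2
      ≤ form (effPot 1 V u) v v := by
  obtain ⟨c, hc, hcu⟩ := h.exists_lower_bound
  obtain ⟨K₀, hK₀, hK₀u⟩ := h.aeBdd.exists_nonneg
  set K := K₀ + 1
  have hK : 0 < K := by positivity
  have hKu : ∀ᵐ x, |toL2 d u x| ≤ K := hK₀u.mono fun x hx => hx.trans (by simp [K])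
  refine ⟨c ^ 2 / K ^ 2, by positivity, fun v hv => ?_⟩
  obtain ⟨F, F', hF, hFc, hFb, hFinv⟩ := exists_smooth_inv hc
  obtain ⟨r, hr, hrg⟩ := exists_H1_comp hF hFc hFb u
  have hrb : AEBdd (toL2 d r) := ⟨c⁻¹, by
    filter_upwards [hr, hcu] with x e1 e2
    rw [e1, (hFinv _ e2).1, abs_of_pos (inv_pos.2 (hc.trans_le e2))]
    exact inv_anti₀ hc e2⟩
  -- Here `q = v / u` and `p = v q = v² / u`. Testing the equation of `u` with `p` cancels the
  -- potential terms and leaves `|∇v|² - ∇u · ∇(v²/u) = u² |∇q|²`.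
  obtain ⟨q, hq, hqg⟩ := exists_H1_mul hv hrb
  have hqb : AEBdd (toL2 d q) := by
    refine (?_ : toL2 d q = mulOp (toL2 d v) (toL2 d r)) ▸ hv.mulOp hrb
    exact Lp.ext (hq.trans (coeFn_mulOp hv _).symm)
  obtain ⟨p, hp, hpg⟩ := exists_H1_mul hv hqb
  have h1 := h.form_effPot_one p
  have h2 : inner ℝ (mulOp (effPot 1 V u) (toL2 d u)) (toL2 d p)
      = inner ℝ (mulOp (effPot 1 V u) (toL2 d v)) (toL2 d v) := by
    rw [integral_mulOp (h.aeBdd_effPot 1), integral_mulOp (h.aeBdd_effPot 1)]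
    refine integral_congr_ae ?_
    filter_upwards [hp, hq, hr, hcu] with x e1 e2 e3 e4
    have : toL2 d u x ≠ 0 := (hc.trans_le e4).ne'
    rw [e1, e2, e3, (hFinv _ e4).1]
    field_simp
  have h3 : ∀ j, c ^ 2 * ‖grad q j‖ ^ 2
      ≤ inner ℝ (grad v j) (grad v j) - inner ℝ (grad u j) (grad p j) := fun j => by
    rw [norm_sq_eq_integral, ← integral_const_mul, inner_eq_integral, inner_eq_integral,
      ← integral_sub (integrable_mul_L2 _ _) (integrable_mul_L2 _ _)]
    refine integral_mono_ae ((integrable_grad_sq q j).const_mul _)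
      ((integrable_mul_L2 _ _).sub (integrable_mul_L2 _ _)) ?_
    filter_upwards [hpg j, hqg j, hq, hr, hrg j, hcu] with x e1 e2 e3 e4 e5 e6
    have hpos : 0 < toL2 d u x := hc.trans_le e6
    have e7 : grad v j x * grad v j x - grad u j x * grad p j x
        = toL2 d u x ^ 2 * grad q j x ^ 2 := by
      rw [e1, e2, e3, e4, e5, (hFinv _ e6).1, (hFinv _ e6).2]
      field_simp
      ring
    rw [e7]
    gcongr
  have h4 : c ^ 2 * ∑ j, ‖grad q j‖ ^ 2 ≤ form (effPot 1 V u) v v := by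
    rw [form] at h1 ⊢
    rw [Finset.mul_sum]
    have := Finset.sum_le_sum fun j (_ : j ∈ Finset.univ) => h3 j
    rw [Finset.sum_sub_distrib] at this
    linarith
  -- Poincaré controls `q - m`, and `v - m u = u (q - m)`. The projection onto `u` minimises the
  -- distance over all multiples of `u`, so it may replace `m`.
  set m := ∫ x, toL2 d q x
  have h5 := norm_sub_mean_sq_le q
  have h6 : toL2 d v - m • toL2 d u
      = mulOp (toL2 d u) (toL2 d q - Lp.const 2 volume m) := by
    refine Lp.ext ?_
    filter_upwards [coeFn_mulOp h.aeBdd (toL2 d q - Lp.const 2 volume m),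
      Lp.coeFn_sub (toL2 d q) (Lp.const 2 volume m), Lp.coeFn_sub (toL2 d v) (m • toL2 d u),
      Lp.coeFn_smul m (toL2 d u), hq, hr, hcu,
      Lp.coeFn_const (p := 2) (μ := (volume : Measure (Torus d))) m]
      with x e1 e2 e3 e4 e5 e6 e7 e8
    have : toL2 d u x ≠ 0 := (hc.trans_le e7).ne'
    rw [e1, e2, e3, Pi.sub_apply, Pi.sub_apply, e4, Pi.smul_apply, e5, e6, (hFinv _ e7).1, e8,
      Function.const_apply, smul_eq_mul]
    field_simp
  have h7 : ‖toL2 d v - m • toL2 d u‖ ^ 2 ≤ K ^ 2 * ∑ j, ‖grad q j‖ ^ 2 := by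
    rw [h6]
    calc _ ≤ (K * ‖toL2 d q - Lp.const 2 volume m‖) ^ 2 := by
          gcongr; exact norm_mulOp_le hKu _
      _ ≤ _ := by rw [mul_pow]; gcongr
  have h8 := (norm_sub_proj_le h.isMin.2.1 (toL2 d v) m).trans h7
  refine le_trans ?_ h4
  rw [div_mul_eq_mul_div, div_le_iff₀ (by positivity), mul_assoc]
  gcongr
  linarith

theorem form_effPot_three (h : IsGroundState V u) (x y : H1 d) : form (effPot 3 V u) x y
    = form (effPot 1 V u) x y
      + 2 * inner ℝ (mulOp (mulOp (toL2 d u) (toL2 d u)) (toL2 d x)) (toL2 d y) := by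
  rw [h.form_effPot, h.form_effPot]
  ring

/-- The second derivative of the energy at the ground state is coercive. -/
theorem exists_coercive (h : IsGroundState V u) : ∃ κ : ℝ, 0 < κ ∧ ∀ v : H1 d,
    AEBdd (toL2 d v) → κ * ‖v‖ ^ 2 ≤ form (effPot 3 V u) v v := by
  obtain ⟨κ, hκ, hgap⟩ := h.exists_gap
  obtain ⟨c, hc, hcu⟩ := h.exists_lower_bound
  obtain ⟨B, hB0, hB⟩ := (h.aeBdd_effPot 3).exists_nonneg
  refine ⟨2 * c ^ 2 / (2 * c ^ 2 + 1 + B), by positivity, fun v hv => ?_⟩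
  refine norm_sq_le_form hB0 (by positivity) hB ?_
  rw [h.form_effPot_three]
  have h1 : 0 ≤ form (effPot 1 V u) v v := le_trans (by positivity) (hgap v hv)
  -- The additional term `2u² ≥ 2c²` covers the kernel direction `u`, so no orthogonality is
  -- required of `v`.
  have h2 : c ^ 2 * ‖toL2 d v‖ ^ 2
      ≤ inner ℝ (mulOp (mulOp (toL2 d u) (toL2 d u)) (toL2 d v)) (toL2 d v) := by
    rw [integral_mulOp (h.aeBdd.mulOp h.aeBdd), norm_sq_eq_integral, ← integral_const_mul]
    refine integral_mono_ae ((Lp.memLp (toL2 d v)).integrable_sq.const_mul _)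
      (integrable_mulOp (h.aeBdd.mulOp h.aeBdd) _ _) ?_
    filter_upwards [hcu, coeFn_mulOp h.aeBdd (toL2 d u)] with x e1 e2
    rw [e2]
    have : c ^ 2 ≤ toL2 d u x ^ 2 := by gcongr
    nlinarith [mul_le_mul_of_nonneg_right this (sq_nonneg (toL2 d v x))]
  linarith

end IsGroundState

/-! ### The energy excess and quasi-optimality -/

theorem integral_sq_mul_sq_le (hd : d ≤ 3) (x y : H1 d) :
    ∫ p, toL2 d x p ^ 2 * toL2 d y p ^ 2
      ≤ (sobConst d).toReal * (‖x‖ ^ 2 * ‖y‖ ^ 2) := by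
  have hm : ∀ z : H1 d, MemLp (fun p => toL2 d z p ^ 2) 2 volume := fun z =>
    (memLp_two_iff_integrable_sq ((Lp.aestronglyMeasurable _).pow 2)).2
      ((integral_pow_four_le hd z).1.congr (ae_of_all _ fun p => by simp only [Pi.pow_apply]; ring))
  have hn : ∀ z : H1 d, ‖(hm z).toLp‖ ≤ √(sobConst d).toReal * ‖z‖ ^ 2 := fun z => by
    refine abs_le_of_sq_le_sq' ?_ (by positivity) |>.2
    rw [mul_pow, Real.sq_sqrt ENNReal.toReal_nonneg, norm_sq_eq_integral, ← pow_mul]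
    refine le_trans (le_of_eq (integral_congr_ae ?_)) (integral_pow_four_le hd z).2
    filter_upwards [(hm z).coeFn_toLp] with p e
    rw [e]
    ring
  have h1 : ∫ p, toL2 d x p ^ 2 * toL2 d y p ^ 2 = inner ℝ (hm x).toLp (hm y).toLp := by
    rw [inner_eq_integral]
    refine integral_congr_ae ?_
    filter_upwards [(hm x).coeFn_toLp, (hm y).coeFn_toLp] with p e1 e2
    rw [e1, e2]
  rw [h1]
  calc _ ≤ ‖(hm x).toLp‖ * ‖(hm y).toLp‖ := real_inner_le_norm _ _
    _ ≤ (√(sobConst d).toReal * ‖x‖ ^ 2) * (√(sobConst d).toReal * ‖y‖ ^ 2) := by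
        gcongr
        · exact hn x
        · exact hn y
    _ = _ := by
        rw [mul_mul_mul_comm, Real.mul_self_sqrt ENNReal.toReal_nonneg]

namespace IsGroundState

variable {V : L2 d} {u : H1 d}

/-- The energy excess, in terms of the linearised operator at the ground state. -/
theorem energy_sub (h : IsGroundState V u) {v : H1 d} (hv : ‖toL2 d v‖ = 1) :
    energy V v - energy V u = 1 / 2 * form (effPot 1 V u) (v - u) (v - u)
      + 1 / 4 * ∫ p, toL2 d (v - u) p ^ 2 * toL2 d (v + u) p ^ 2 := by
  have hu2 := h.aeBdd.mulOp h.aeBdd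
  have h0 := h.form_effPot_one
  rw [form_sub_left, form_sub_right, h0, form_comm (h.aeBdd_effPot 1) v u, h0, form_effPot h,
    energy_eq h.aeBdd_potential, energy_eq h.aeBdd_potential, real_inner_self_eq_norm_sq, hv]
  -- The quartic remainder is the square of `v² - u²`. Equal normalisation of `v` and `u` cancels
  -- the multiplier terms, so the identity is exact.
  have h1 : ∫ p, toL2 d (v - u) p ^ 2 * toL2 d (v + u) p ^ 2 = (∫ p, toL2 d v p ^ 4)
      - 2 * (∫ p, toL2 d u p ^ 2 * toL2 d v p ^ 2) + ∫ p, toL2 d u p ^ 4 := by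
    have i1 := (integral_pow_four_le h.dim_le v).1
    have i2 := (integrable_pow_mul_pow h.dim_le u v (a := 2) (b := 2) rfl).const_mul 2
    have i3 := (integral_pow_four_le h.dim_le u).1
    have i4 := i1.sub i2
    simp only [Pi.sub_def] at i4
    rw [← integral_const_mul, ← integral_sub i1 i2, ← integral_add i4 i3]
    refine integral_congr_ae ?_
    rw [map_sub, map_add]
    filter_upwards [Lp.coeFn_sub (toL2 d v) (toL2 d u), Lp.coeFn_add (toL2 d v) (toL2 d u)]
      with p e1 e2
    rw [e1, e2, Pi.sub_apply, Pi.add_apply]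
    ring
  have h2 : inner ℝ (mulOp (mulOp (toL2 d u) (toL2 d u)) (toL2 d v)) (toL2 d v)
      = ∫ p, toL2 d u p ^ 2 * toL2 d v p ^ 2 := by
    rw [integral_mulOp hu2]
    refine integral_congr_ae ?_
    filter_upwards [coeFn_mulOp h.aeBdd (toL2 d u)] with p e
    rw [e]
    ring
  have h3 : multiplier V u = form V u u + ∫ p, toL2 d u p ^ 4 := by
    rw [multiplier]
    simp only [← pow_add]
  rw [h1, h2, h3]
  ring

/-- Energy excess controls the distance to the ground state. -/
theorem exists_norm_sub_sq_le_energy (h : IsGroundState V u) : ∃ κ : ℝ, 0 < κ ∧ ∀ v : H1 d,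
    AEBdd (toL2 d v) → ‖toL2 d v‖ = 1 → 0 ≤ inner ℝ (toL2 d v) (toL2 d u) →
      κ * ‖v - u‖ ^ 2 ≤ energy V v - energy V u := by
  obtain ⟨κ, hκ, hgap⟩ := h.exists_gap
  obtain ⟨B, hB0, hB⟩ := (h.aeBdd_effPot 1).exists_nonneg
  refine ⟨1 / 2 * (κ / 2 / (κ / 2 + 1 + B)), by positivity, fun v hv hv1 hpos => ?_⟩
  rw [h.energy_sub hv1]
  have h0 := h.form_effPot_one
  have h1 : form (effPot 1 V u) (v - u) (v - u) = form (effPot 1 V u) v v := by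
    rw [form_sub_left, form_sub_right, h0, form_comm (h.aeBdd_effPot 1) v u, h0]
    ring
  -- With `β = (u, v)` in `[0, 1]`, the gap controls `1 - β² ≥ 1 - β = ½ ‖v - u‖²`. The sign
  -- condition excludes the minimiser `-u`.
  have h2 : κ / 2 * ‖toL2 d (v - u)‖ ^ 2 ≤ form (effPot 1 V u) (v - u) (v - u) := by
    rw [h1]
    refine le_trans ?_ (hgap v hv)
    rw [real_inner_comm] at hpos
    have hle := real_inner_le_norm (toL2 d u) (toL2 d v)
    rw [hv1, h.isMin.2.1, one_mul] at hle
    rw [map_sub, norm_sub_sq_real, norm_sub_sq_real, real_inner_smul_right, norm_smul,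
      h.isMin.2.1, hv1, real_inner_comm, Real.norm_eq_abs, mul_pow, sq_abs]
    generalize inner ℝ (toL2 d u) (toL2 d v) = β at *
    nlinarith [mul_nonneg hκ.le (mul_nonneg hpos (sub_nonneg.2 hle))]
  have h3 := norm_sq_le_form hB0 (by positivity) hB h2
  have h4 : 0 ≤ ∫ p, toL2 d (v - u) p ^ 2 * toL2 d (v + u) p ^ 2 :=
    integral_nonneg fun p => by positivity
  linarith

/-- The zero mode survives every truncation. This bounds `‖Π_N u‖` below uniformly in `N`, so that
the projection can be normalised. -/
theorem integral_le_norm_proj (h : IsGroundState V u) (N : ℕ) :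
    ∫ x, toL2 d u x ≤ ‖toL2 d (fourierProj d N u)‖ := by
  classical
  have h1 := norm_fc_le (toL2 d (fourierProj d N u)) 0
  rw [fc_fourierProj, if_pos (by simp), fc_zero_eq_integral, Complex.norm_real,
    Real.norm_of_nonneg h.integral_pos.le] at h1
  exact h1

/-- Quasi-optimality of the discrete minimisers in the energy norm. -/
theorem exists_quasiOptimal (h : IsGroundState V u) : ∃ C : ℝ, 0 < C ∧ ∀ (N : ℕ) (uN : H1 d),
    IsConstrainedMinimiser V (fourierSpace d N) uN → 0 ≤ inner ℝ (toL2 d uN) (toL2 d u) →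
      ‖uN - u‖ ≤ C * ‖fourierProj d N u - u‖ := by
  obtain ⟨κ, hκ, hen⟩ := h.exists_norm_sub_sq_le_energy
  obtain ⟨B, hB0, hB⟩ := (h.aeBdd_effPot 1).exists_nonneg
  set m := ∫ x, toL2 d u x
  have hm : 0 < m := h.integral_pos
  set S := (sobConst d).toReal
  have hS : 0 ≤ S := ENNReal.toReal_nonneg
  -- For the competitor `z = w / ‖w‖`, with `w` the projection, the constants are those in `‖z - u‖
  -- ≤ a ‖w - u‖` and `‖z + u‖ ≤ b`.
  set a := (1 + ‖u‖) / m with ha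
  set b := ‖u‖ / m + ‖u‖ with hb
  set D := (1 / 2 * (2 + B) + 1 / 4 * (S * b ^ 2)) * a ^ 2 with hD
  have hD0 : 0 ≤ D := by positivity
  refine ⟨√(D / κ) + 1, by positivity, fun N uN huN hpos => ?_⟩
  set w := fourierProj d N u with hw
  set n := ‖toL2 d w‖ with hn
  have hmn : m ≤ n := h.integral_le_norm_proj N
  have hn0 : 0 < n := hm.trans_le hmn
  set z := n⁻¹ • w with hz
  have hz1 : ‖toL2 d z‖ = 1 := by
    rw [hz, map_smul, norm_smul, Real.norm_of_nonneg (inv_nonneg.2 hn0.le), ← hn,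
      inv_mul_cancel₀ hn0.ne']
  have h1 := huN.2.2 z (Submodule.smul_mem _ _ (fourierProj_mem N u)) hz1
  have h2 := hen uN (aeBdd_of_mem_fourierSpace huN.1) huN.2.1 hpos
  have hwn : ‖w‖ ≤ ‖u‖ := norm_fourierProj_le N u
  have hzu : ‖z - u‖ ≤ a * ‖w - u‖ := by
    have e : z - u = n⁻¹ • ((w - u) + (1 - n) • u) := by
      rw [hz, smul_add, smul_sub, smul_smul, mul_sub, mul_one, inv_mul_cancel₀ hn0.ne', sub_smul,
        one_smul]
      abel
    have e1 : |1 - n| ≤ ‖w - u‖ := by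
      rw [← h.isMin.2.1, hn, abs_sub_comm]
      refine (abs_norm_sub_norm_le _ _).trans ?_
      rw [← map_sub]
      exact norm_toL2_le _
    rw [e, norm_smul, Real.norm_of_nonneg (inv_nonneg.2 hn0.le), ha]
    have e2 : ‖(w - u) + (1 - n) • u‖ ≤ (1 + ‖u‖) * ‖w - u‖ := by
      refine (norm_add_le _ _).trans ?_
      rw [norm_smul, Real.norm_eq_abs]
      nlinarith [norm_nonneg u]
    calc n⁻¹ * ‖(w - u) + (1 - n) • u‖ ≤ m⁻¹ * ((1 + ‖u‖) * ‖w - u‖) := by gcongr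
      _ = _ := by ring
  have hzu' : ‖z + u‖ ≤ b := by
    refine (norm_add_le _ _).trans ?_
    rw [hz, norm_smul, Real.norm_of_nonneg (inv_nonneg.2 hn0.le), hb, div_eq_inv_mul]
    gcongr
  have h3 : energy V z - energy V u ≤ D * ‖w - u‖ ^ 2 := by
    rw [h.energy_sub hz1]
    have f1 := (le_abs_self _).trans (abs_form_le hB0 hB (z - u) (z - u))
    have f2 := integral_sq_mul_sq_le h.dim_le (z - u) (z + u)
    have f3 : ‖z - u‖ ^ 2 ≤ a ^ 2 * ‖w - u‖ ^ 2 := by rw [← mul_pow]; gcongr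
    have f4 : ‖z + u‖ ^ 2 ≤ b ^ 2 := by gcongr
    calc _ ≤ 1 / 2 * ((2 + B) * (‖z - u‖ * ‖z - u‖)) + 1 / 4 * (S * (‖z - u‖ ^ 2 * ‖z + u‖ ^ 2)) := by
          gcongr
      _ ≤ 1 / 2 * ((2 + B) * (a ^ 2 * ‖w - u‖ ^ 2))
          + 1 / 4 * (S * ((a ^ 2 * ‖w - u‖ ^ 2) * b ^ 2)) := by
          rw [← sq]; gcongr
      _ = _ := by rw [hD]; ring
  have h4 : ‖uN - u‖ ^ 2 ≤ (√(D / κ) * ‖w - u‖) ^ 2 := by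
    rw [mul_pow, Real.sq_sqrt (by positivity), div_mul_eq_mul_div, le_div_iff₀ hκ]
    linarith
  have h5 := abs_le_of_sq_le_sq' h4 (by positivity) |>.2
  linarith [norm_nonneg (w - u)]

end IsGroundState

/-! ### Inverse and approximation inequalities for frequency truncation -/

theorem wt_eq (k : Fin d → ℤ) : wt k = 1 + 4 * Real.pi ^ 2 * ((∑ i, k i ^ 2 : ℤ) : ℝ) := by
  rw [wt, Int.cast_sum, Finset.mul_sum]
  congr 1
  refine Finset.sum_congr rfl fun i _ => ?_
  push_cast
  ring

theorem sq_le_wt {N : ℕ} {k : Fin d → ℤ} (hk : (N : ℤ) ^ 2 < ∑ i, k i ^ 2) :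
    (N : ℝ) ^ 2 ≤ wt k := by
  have h1 : ((N : ℝ)) ^ 2 ≤ ((∑ i, k i ^ 2 : ℤ) : ℝ) := by exact_mod_cast hk.le
  have h2 : 1 ≤ 4 * Real.pi ^ 2 := by nlinarith [Real.pi_gt_three]
  rw [wt_eq]
  nlinarith [mul_le_mul_of_nonneg_right h2 ((sq_nonneg (N : ℝ)).trans h1)]

theorem wt_le_sq {N : ℕ} (hN : 1 ≤ N) {k : Fin d → ℤ} (hk : ∑ i, k i ^ 2 ≤ (N : ℤ) ^ 2) :
    wt k ≤ (7 * (N : ℝ)) ^ 2 := by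
  have h1 : ((∑ i, k i ^ 2 : ℤ) : ℝ) ≤ ((N : ℝ)) ^ 2 := by exact_mod_cast hk
  have h2 : (1 : ℝ) ≤ (N : ℝ) ^ 2 := one_le_pow₀ (by exact_mod_cast hN)
  -- Hence `1 + 4π² N² ≤ 41 N² ≤ (7N)²`.
  have h3 : Real.pi ^ 2 ≤ 10 := by nlinarith [Real.pi_lt_d2, Real.pi_gt_three]
  rw [wt_eq]
  nlinarith

/-- The inverse inequality on the Fourier space. -/
theorem norm_le_of_mem_fourierSpace {N : ℕ} (hN : 1 ≤ N) {e : H1 d} (he : e ∈ fourierSpace d N) :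
    ‖e‖ ≤ 7 * N * ‖toL2 d e‖ := by
  refine abs_le_of_sq_le_sq' ?_ (by positivity) |>.2
  rw [mul_pow]
  refine hasSum_le (fun k => ?_) (hasSum_norm_H1 e) ((hasSum_sq_fc (toL2 d e)).mul_left _)
  by_cases hk : ∑ i, k i ^ 2 ≤ (N : ℤ) ^ 2
  · gcongr
    exact wt_le_sq hN hk
  · rw [mem_fourierSpace_iff.1 he k (not_le.1 hk)]
    simp

theorem sq_mul_norm_fc_sq_le {N : ℕ} {e : L2 d}
    (he : ∀ k : Fin d → ℤ, ∑ i, k i ^ 2 ≤ (N : ℤ) ^ 2 → fc e k = 0) (k : Fin d → ℤ) :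
    (N : ℝ) ^ 2 * ‖fc e k‖ ^ 2 ≤ wt k * ‖fc e k‖ ^ 2 := by
  by_cases hk : ∑ i, k i ^ 2 ≤ (N : ℤ) ^ 2
  · rw [he k hk]
    simp
  · gcongr
    exact sq_le_wt (not_le.1 hk)

theorem norm_toL2_le_of_high {N : ℕ} {e : H1 d}
    (he : ∀ k : Fin d → ℤ, ∑ i, k i ^ 2 ≤ (N : ℤ) ^ 2 → fc (toL2 d e) k = 0) :
    N * ‖toL2 d e‖ ≤ ‖e‖ := by
  refine abs_le_of_sq_le_sq' ?_ (norm_nonneg _) |>.2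
  rw [mul_pow]
  exact hasSum_le (sq_mul_norm_fc_sq_le he) ((hasSum_sq_fc (toL2 d e)).mul_left _)
    (hasSum_norm_H1 e)

/-- One of the two `H²` weights is traded for `N²`. The domination by `u` fits the truncation error
of `u`. -/
theorem norm_le_of_high {N : ℕ} {u e : H1 d} (hu : MemH2 (toL2 d u))
    (he : ∀ k : Fin d → ℤ, ∑ i, k i ^ 2 ≤ (N : ℤ) ^ 2 → fc (toL2 d e) k = 0)
    (hle : ∀ k, ‖fc (toL2 d e) k‖ ≤ ‖fc (toL2 d u) k‖) :
    N * ‖e‖ ≤ √(h2Sq (toL2 d u)) := by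
  refine Real.le_sqrt_of_sq_le ?_
  rw [mul_pow]
  refine hasSum_le (fun k => ?_) ((hasSum_norm_H1 e).mul_left _) hu.hasSum
  have h1 := sq_mul_norm_fc_sq_le he k
  have h2 : ‖fc (toL2 d e) k‖ ^ 2 ≤ ‖fc (toL2 d u) k‖ ^ 2 := by gcongr; exact hle k
  have h3 := wt_pos k
  calc (N : ℝ) ^ 2 * (wt k * ‖fc (toL2 d e) k‖ ^ 2)
      = wt k * ((N : ℝ) ^ 2 * ‖fc (toL2 d e) k‖ ^ 2) := by ring
    _ ≤ wt k * (wt k * ‖fc (toL2 d u) k‖ ^ 2) := 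
        mul_le_mul_of_nonneg_left (h1.trans (mul_le_mul_of_nonneg_left h2 h3.le)) h3.le
    _ = _ := by ring

/-- The pairing of a function with high frequencies and a function in the Sobolev space of order
two. -/
theorem abs_inner_le_of_high {N : ℕ} (hN : 1 ≤ N) {e : H1 d} {g : L2 d}
    (he : ∀ k : Fin d → ℤ, ∑ i, k i ^ 2 ≤ (N : ℤ) ^ 2 → fc (toL2 d e) k = 0) (hg : MemH2 g) :
    |inner ℝ (toL2 d e) g| ≤ ((N : ℝ) ^ 3)⁻¹ * ‖e‖ * √(h2Sq g) := by
  have hN0 : (0 : ℝ) < N := by exact_mod_cast hN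
  have h1 : ‖((inner ℝ (toL2 d e) g : ℝ) : ℂ)‖ₑ ≤ ∑' k, ‖fc (toL2 d e) k‖ₑ * ‖fc g k‖ₑ := by
    rw [← (hasSum_inner_fc (toL2 d e) g).tsum_eq]
    refine enorm_tsum_le_tsum_enorm.trans (le_of_eq (tsum_congr fun k => ?_))
    rw [enorm_mul]
    congr 1
    simp [← ofReal_norm]
  -- Duality between `H⁻²` and `H²`. On frequencies above `N` the weight `wt⁻²` is at most `N⁻⁶ wt`,
  -- which produces the factor `N⁻³` after the square root.
  have h2 := tsum_mul_sq_le (fun k => (ewt k)⁻¹ * ‖fc (toL2 d e) k‖ₑ) fun k => ewt k * ‖fc g k‖ₑ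
  have h3 : ∑' k, (ewt k)⁻¹ * ‖fc (toL2 d e) k‖ₑ * (ewt k * ‖fc g k‖ₑ)
      = ∑' k, ‖fc (toL2 d e) k‖ₑ * ‖fc g k‖ₑ := tsum_congr fun k => by
    rw [mul_mul_mul_comm, ENNReal.inv_mul_cancel (ewt_ne_zero k) (ewt_ne_top k), one_mul]
  have h4 : ∑' k, (ewt k * ‖fc g k‖ₑ) ^ 2 = ENNReal.ofReal (h2Sq g) := by
    rw [← hg.sobSq_eq, sobSq]
    simp only [mul_pow]
  have h5 : ∑' k, ((ewt k)⁻¹ * ‖fc (toL2 d e) k‖ₑ) ^ 2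
      ≤ ENNReal.ofReal (((N : ℝ) ^ 6)⁻¹ * ‖e‖ ^ 2) := by
    rw [ENNReal.ofReal_mul (by positivity), ← sobSq_one_fc, sobSq, ← ENNReal.tsum_mul_left]
    refine ENNReal.tsum_le_tsum fun k => ?_
    by_cases hk : ∑ i, k i ^ 2 ≤ (N : ℤ) ^ 2
    · rw [he k hk]
      simp
    · rw [mul_pow, pow_one, ← mul_assoc]
      gcongr
      have hw := wt_pos k
      rw [ewt, ← ENNReal.ofReal_inv_of_pos hw, ← ENNReal.ofReal_pow (by positivity),
        ← ENNReal.ofReal_mul (by positivity)]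
      refine ENNReal.ofReal_le_ofReal ?_
      have h6 : ((N : ℝ) ^ 2) ^ 3 ≤ wt k ^ 3 := by gcongr; exact sq_le_wt (not_le.1 hk)
      rw [inv_pow, inv_mul_eq_div, le_div_iff₀ (by positivity), inv_mul_le_iff₀ (by positivity)]
      linarith
  rw [h3] at h2
  have h6 : ‖((inner ℝ (toL2 d e) g : ℝ) : ℂ)‖ₑ ^ 2
      ≤ ENNReal.ofReal (((N : ℝ) ^ 6)⁻¹ * ‖e‖ ^ 2 * h2Sq g) := by
    rw [ENNReal.ofReal_mul (by positivity), ← h4]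
    calc _ ≤ (∑' k, ‖fc (toL2 d e) k‖ₑ * ‖fc g k‖ₑ) ^ 2 := by gcongr
      _ ≤ _ := h2
      _ ≤ _ := by gcongr
  rw [← ofReal_norm, Complex.norm_real, ← ENNReal.ofReal_pow (norm_nonneg _),
    ENNReal.ofReal_le_ofReal_iff (mul_nonneg (by positivity) (h2Sq_nonneg g)),
    Real.norm_eq_abs] at h6
  refine abs_le_of_sq_le_sq' (h6.trans (le_of_eq ?_)) (by positivity) |>.2
  rw [mul_pow, mul_pow, Real.sq_sqrt (h2Sq_nonneg g)]
  congr 2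
  rw [inv_pow, ← pow_mul]

/-! ### The discrete dual problem -/

/-- The Lax–Milgram theorem for the form on a closed subspace. -/
theorem exists_form_eq {b : L2 d} (hb : AEBdd b) (S : Submodule ℝ (H1 d)) [CompleteSpace S]
    {κ : ℝ} (hκ : 0 < κ) (hS : ∀ v ∈ S, κ * ‖v‖ ^ 2 ≤ form b v v) (f : L2 d) :
    ∃ ψ ∈ S, ∀ v ∈ S, form b ψ v = inner ℝ f (toL2 d v) := by
  obtain ⟨B, hB0, hB⟩ := hb.exists_nonneg
  let T : S →L[ℝ] S →L[ℝ] ℝ := LinearMap.mkContinuous₂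
    (LinearMap.mk₂ ℝ (fun x y : S => form b x y) (fun x y z => form_add_left b _ _ _)
      (fun c x y => form_smul_left b _ _ _) (fun x y z => form_add_right b _ _ _)
      (fun c x y => form_smul_right b _ _ _)) (2 + B) fun x y => by
        rw [mul_assoc]
        exact abs_form_le hB0 hB _ _
  have hT : IsCoercive T := ⟨κ, hκ, fun x => by
    rw [mul_assoc, ← sq]
    exact hS x x.2⟩
  let ℓ : S →L[ℝ] ℝ := ((innerSL ℝ f).comp (toL2 d)).comp S.subtypeL
  let g := (InnerProductSpace.toDual ℝ S).symm ℓ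
  let ψ := hT.continuousLinearEquivOfBilin.symm g
  refine ⟨ψ, ψ.2, fun v hv => ?_⟩
  have h1 : inner ℝ (hT.continuousLinearEquivOfBilin ψ) (⟨v, hv⟩ : S) = T ψ ⟨v, hv⟩ :=
    hT.continuousLinearEquivOfBilin_apply _ _
  rw [ContinuousLinearEquiv.apply_symm_apply, InnerProductSpace.toDual_symm_apply] at h1
  exact h1.symm

/-- The functions of the Fourier space that are `L²`-orthogonal to a given function. -/
noncomputable def orthFourier (N : ℕ) (e : L2 d) : Submodule ℝ (H1 d) :=
  fourierSpace d N ⊓ ((innerSL ℝ e).comp (toL2 d)).ker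

theorem mem_orthFourier {N : ℕ} {e : L2 d} {v : H1 d} :
    v ∈ orthFourier N e ↔ v ∈ fourierSpace d N ∧ inner ℝ e (toL2 d v) = 0 := Iff.rfl

instance completeSpace_orthFourier (N : ℕ) (e : L2 d) : CompleteSpace (orthFourier N e) := by
  refine completeSpace_coe_iff_isComplete.2 (IsClosed.isComplete ?_)
  exact (completeSpace_coe_iff_isComplete.1 (completeSpace_fourierSpace d N)).isClosed.inter
    (ContinuousLinearMap.isClosed_ker _)

namespace IsGroundState

variable {V : L2 d} {u : H1 d}

/-- The discrete dual problem, with a bound in the Sobolev space of order two. -/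
theorem exists_dual (h : IsGroundState V u) (U : ℝ) : ∃ C : ℝ, 0 < C ∧ ∀ (N : ℕ) (uN : H1 d),
    uN ∈ fourierSpace d N → ‖toL2 d uN‖ = 1 → ‖uN‖ ≤ U → ∀ f : L2 d,
      ∃ ψ ∈ orthFourier N (toL2 d uN),
        (∀ v ∈ orthFourier N (toL2 d uN), form (effPot 3 V u) ψ v = inner ℝ f (toL2 d v)) ∧
        ‖ψ‖ ≤ C * ‖f‖ ∧ √(h2Sq (toL2 d ψ)) ≤ C * ‖f‖ := by
  obtain ⟨κ, hκ, hco⟩ := h.exists_coercive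
  have hb := h.aeBdd_effPot 3
  obtain ⟨B, hB0, hB⟩ := hb.exists_nonneg
  set b := effPot 3 V u
  have hC : 0 ≤ (2 + B) * (κ⁻¹ * |U|) := by positivity
  refine ⟨κ⁻¹ + (2 + ((2 + B) * (κ⁻¹ * |U|)) + (1 + B) * κ⁻¹), by positivity,
    fun N uN huN hu1 hU f => ?_⟩
  obtain ⟨ψ, hψ, hψv⟩ := exists_form_eq hb (orthFourier N (toL2 d uN)) hκ
    (fun v hv => hco v (aeBdd_of_mem_fourierSpace hv.1)) f
  have hf0 := norm_nonneg f
  have h1 : ‖ψ‖ ≤ κ⁻¹ * ‖f‖ := by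
    have h2 := hco ψ (aeBdd_of_mem_fourierSpace hψ.1)
    rw [hψv ψ hψ] at h2
    have h3 : inner ℝ f (toL2 d ψ) ≤ ‖f‖ * ‖ψ‖ :=
      (real_inner_le_norm _ _).trans (by gcongr; exact norm_toL2_le _)
    rw [inv_mul_eq_div, le_div_iff₀ hκ]
    rcases (norm_nonneg ψ).eq_or_lt with h0 | h0
    · rw [← h0, zero_mul]; exact hf0
    · nlinarith
  refine ⟨ψ, hψ, hψv, h1.trans ?_, ?_⟩
  · gcongr
    linarith [mul_nonneg (add_nonneg zero_le_one hB0) (inv_nonneg.2 hκ.le)]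
  -- The Lagrange multiplier of the constraint `v ⊥ uN`. With it the dual equation holds against all
  -- of `X_N`, in the form `(1 - Δ) ψ = g`.
  set μ := form b ψ uN - inner ℝ f (toL2 d uN) with hμ
  set g := f + μ • toL2 d uN + (toL2 d ψ - mulOp b (toL2 d ψ)) with hg
  have h2 : ∀ v ∈ fourierSpace d N, inner ℝ ψ v = inner ℝ g (toL2 d v) := fun v hv => by
    set t := inner ℝ (toL2 d uN) (toL2 d v) with ht
    have h3 := hψv (v - t • uN) ⟨Submodule.sub_mem _ hv (Submodule.smul_mem _ _ huN), by
      change inner ℝ (toL2 d uN) (toL2 d (v - t • uN)) = 0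
      rw [map_sub, map_smul, inner_sub_right, real_inner_smul_right, real_inner_self_eq_norm_sq,
        hu1, ← ht]
      ring⟩
    rw [form_sub_right, form_smul_right, map_sub, map_smul, inner_sub_right,
      real_inner_smul_right, form_eq_inner b ψ v] at h3
    rw [hg, inner_add_left, inner_add_left, inner_sub_left, real_inner_smul_left, ← ht, hμ]
    linarith
  have hμb : |μ| ≤ ((2 + B) * (κ⁻¹ * |U|) + 1) * ‖f‖ := by
    have e1 := abs_form_le hB0 hB ψ uN
    have e2 : |inner ℝ f (toL2 d uN)| ≤ ‖f‖ := by
      have := abs_real_inner_le_norm f (toL2 d uN)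
      rwa [hu1, mul_one] at this
    have e3 : ‖ψ‖ * ‖uN‖ ≤ (κ⁻¹ * ‖f‖) * |U| := by
      gcongr
      exact hU.trans (le_abs_self U)
    calc |μ| ≤ |form b ψ uN| + |inner ℝ f (toL2 d uN)| := abs_sub _ _
      _ ≤ (2 + B) * ((κ⁻¹ * ‖f‖) * |U|) + ‖f‖ := by
          refine add_le_add (e1.trans ?_) e2
          gcongr
      _ = _ := by ring
  have hgb : ‖g‖ ≤ (2 + ((2 + B) * (κ⁻¹ * |U|)) + (1 + B) * κ⁻¹) * ‖f‖ := by
    have e1 : ‖μ • toL2 d uN‖ ≤ ((2 + B) * (κ⁻¹ * |U|) + 1) * ‖f‖ := by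
      rw [norm_smul, hu1, mul_one]
      exact hμb
    have e2 : ‖toL2 d ψ‖ ≤ κ⁻¹ * ‖f‖ := (norm_toL2_le ψ).trans h1
    have e3 : ‖mulOp b (toL2 d ψ)‖ ≤ B * (κ⁻¹ * ‖f‖) := (norm_mulOp_le hB _).trans (by gcongr)
    have e4 := norm_add_le (f + μ • toL2 d uN) (toL2 d ψ - mulOp b (toL2 d ψ))
    have e5 := norm_add_le f (μ • toL2 d uN)
    have e6 := norm_sub_le (toL2 d ψ) (mulOp b (toL2 d ψ))
    rw [← hg] at e4
    nlinarith
  -- Regularity without loss in `N`: on low frequencies the coefficients of `(1 - Δ) ψ` are exactly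
  -- those of `g`, and on high ones they vanish.
  have h3 : h2Sq (toL2 d ψ) ≤ ‖g‖ ^ 2 := by
    refine hasSum_le (fun k => ?_) (memH2_of_mem_fourierSpace hψ.1).hasSum (hasSum_sq_fc g)
    by_cases hk : ∑ i, k i ^ 2 ≤ (N : ℤ) ^ 2
    · rw [← wt_mul_fc_eq h2 k hk, norm_mul, mul_pow]
      simp
    · rw [mem_fourierSpace_iff.1 hψ.1 k (not_le.1 hk)]
      simp
  calc √(h2Sq (toL2 d ψ)) ≤ ‖g‖ := Real.sqrt_le_iff.2 ⟨norm_nonneg _, h3⟩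
    _ ≤ _ := hgb
    _ ≤ _ := mul_le_mul_of_nonneg_right (by linarith [inv_nonneg.2 hκ.le]) hf0

end IsGroundState

/-! ### The error equation and the consistency error -/

theorem fc_mul_eq_zero {N : ℕ} {e v : H1 d}
    (he : ∀ k : Fin d → ℤ, ∑ i, k i ^ 2 ≤ (N : ℤ) ^ 2 → fc (toL2 d e) k = 0)
    (hv : v ∈ fourierSpace d N) (k : Fin d → ℤ) : conj (fc (toL2 d e) k) * fc (toL2 d v) k = 0 := by
  by_cases hk : ∑ i, k i ^ 2 ≤ (N : ℤ) ^ 2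
  · rw [he k hk, map_zero, zero_mul]
  · rw [mem_fourierSpace_iff.1 hv k (not_le.1 hk), mul_zero]

theorem inner_toL2_high_eq_zero {N : ℕ} {e v : H1 d}
    (he : ∀ k : Fin d → ℤ, ∑ i, k i ^ 2 ≤ (N : ℤ) ^ 2 → fc (toL2 d e) k = 0)
    (hv : v ∈ fourierSpace d N) : inner ℝ (toL2 d e) (toL2 d v) = 0 :=
  (hasSum_re_inner_fc _ _).unique
    (hasSum_zero.congr_fun fun k => by rw [fc_mul_eq_zero he hv, zero_re])

theorem inner_high_eq_zero {N : ℕ} {e v : H1 d}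
    (he : ∀ k : Fin d → ℤ, ∑ i, k i ^ 2 ≤ (N : ℤ) ^ 2 → fc (toL2 d e) k = 0)
    (hv : v ∈ fourierSpace d N) : inner ℝ e v = 0 :=
  (hasSum_inner_H1 e v).unique
    (hasSum_zero.congr_fun fun k => by rw [fc_mul_eq_zero he hv, zero_re, mul_zero])

theorem fc_sub_fourierProj (N : ℕ) (u : H1 d) (k : Fin d → ℤ) :
    fc (toL2 d (u - fourierProj d N u)) k
      = if ∑ i, k i ^ 2 ≤ (N : ℤ) ^ 2 then 0 else fc (toL2 d u) k := by
  rw [map_sub, fc_sub, fc_fourierProj]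
  split_ifs <;> simp

/-- Multiplication by a function in the Sobolev space of order two, between high and low
frequencies. -/
theorem abs_inner_mulOp_high_le (hd : d ≤ 3) {N : ℕ} (hN : 1 ≤ N) {b : L2 d} (hb : MemH2 b)
    {e v : H1 d} (he : ∀ k : Fin d → ℤ, ∑ i, k i ^ 2 ≤ (N : ℤ) ^ 2 → fc (toL2 d e) k = 0)
    (hv : MemH2 (toL2 d v)) : |inner ℝ (mulOp b (toL2 d e)) (toL2 d v)|
      ≤ √(16 * (sobConst d).toReal * h2Sq b) * (((N : ℝ) ^ 3)⁻¹ * ‖e‖ * √(h2Sq (toL2 d v))) := by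
  have hbb : AEBdd b := ⟨_, hb.ae_abs_le hd⟩
  obtain ⟨h1, h2⟩ := hb.mul hd hv (coeFn_mulOp hbb (toL2 d v))
  -- The multiplication is moved onto `v`, where the algebra property keeps the product in `H²`.
  rw [inner_mulOp_comm hbb, real_inner_comm]
  refine (abs_inner_le_of_high hN he h1).trans ?_
  have h3 : √(h2Sq (mulOp b (toL2 d v)))
      ≤ √(16 * (sobConst d).toReal * h2Sq b) * √(h2Sq (toL2 d v)) := by
    rw [← Real.sqrt_mul (mul_nonneg (by positivity) (h2Sq_nonneg b)), mul_assoc _ (h2Sq b)]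
    exact Real.sqrt_le_sqrt h2
  calc _ ≤ ((N : ℝ) ^ 3)⁻¹ * ‖e‖ * (√(16 * (sobConst d).toReal * h2Sq b) * √(h2Sq (toL2 d v))) := by
        gcongr
    _ = _ := by ring

namespace IsGroundState

variable {V : L2 d} {u : H1 d}

/-- The equation for the error, with the quadratic and cubic remainder. -/
theorem form_sub_eq (h : IsGroundState V u) {N : ℕ} {uN v : H1 d}
    (huN : IsConstrainedMinimiser V (fourierSpace d N) uN)
    (hv : v ∈ orthFourier N (toL2 d uN)) : form (effPot 3 V u) (u - uN) v
      = ∫ x, (3 * toL2 d u x * toL2 d (u - uN) x ^ 2 - toL2 d (u - uN) x ^ 3) * toL2 d v x := by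
  have hu2 := h.aeBdd.mulOp h.aeBdd
  have h1 := h.form_add_cubic v
  have h2 := huN.form_add_cubic_eq_zero h.dim_le h.aeBdd_potential hv.1 hv.2
  have h3 : inner ℝ (toL2 d uN) (toL2 d v) = 0 := hv.2
  rw [h.form_effPot, form_sub_left, integral_mulOp hu2]
  rw [map_sub, inner_sub_left, h3]
  have i1 := integrable_pow_mul_pow h.dim_le u v (a := 3) (b := 1) rfl
  have i2 := integrable_pow_mul_pow h.dim_le uN v (a := 3) (b := 1) rfl
  have i3 := (integrable_mulOp hu2 (toL2 d u - toL2 d uN) (toL2 d v)).const_mul 3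
  -- With `s = u - uN`, the pointwise identity is `3 u s² - s³ = uN³ - u³ + 3 u² s`. Orthogonality
  -- of `v` to `uN` has removed the discrete multiplier.
  have key : ∫ x, (3 * toL2 d u x * (toL2 d u - toL2 d uN : L2 d) x ^ 2
        - (toL2 d u - toL2 d uN : L2 d) x ^ 3) * toL2 d v x
      = (∫ x, toL2 d uN x ^ 3 * toL2 d v x ^ 1) - (∫ x, toL2 d u x ^ 3 * toL2 d v x ^ 1)
        + 3 * ∫ x, mulOp (toL2 d u) (toL2 d u) x * (toL2 d u - toL2 d uN : L2 d) x
          * toL2 d v x := by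
    have i4 := i2.sub i1
    simp only [Pi.sub_def] at i4
    rw [← integral_const_mul, ← integral_sub i2 i1, ← integral_add i4 i3]
    refine integral_congr_ae ?_
    filter_upwards [coeFn_mulOp h.aeBdd (toL2 d u), Lp.coeFn_sub (toL2 d u) (toL2 d uN)]
      with x e1 e2
    rw [e1, e2, Pi.sub_apply]
    ring
  rw [key]
  linarith

/-- Pointwise, `|3 u s² - s³| ≤ (3K + 1) s² + s⁴`, since `|s|³ ≤ s² + s⁴`; the quartic part is
controlled by the `L⁴` embedding. -/
theorem abs_form_sub_le (h : IsGroundState V u) {K L : ℝ} (hL0 : 0 ≤ L)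
    (hK : ∀ᵐ x, |toL2 d u x| ≤ K) {N : ℕ} {uN v : H1 d}
    (huN : IsConstrainedMinimiser V (fourierSpace d N) uN)
    (hv : v ∈ orthFourier N (toL2 d uN)) (hL : ∀ᵐ x, |toL2 d v x| ≤ L) :
    |form (effPot 3 V u) (u - uN) v| ≤ L * ((3 * K + 1) * ‖toL2 d (u - uN)‖ ^ 2
      + (sobConst d).toReal * ‖u - uN‖ ^ 4) := by
  obtain ⟨i1, i2⟩ := integral_pow_four_le h.dim_le (u - uN)
  have i3 : Integrable fun x => toL2 d (u - uN) x ^ 2 := (Lp.memLp _).integrable_sq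
  rw [h.form_sub_eq huN hv, ← Real.norm_eq_abs]
  refine (norm_integral_le_of_norm_le (((i3.const_mul (3 * K + 1)).add i1).const_mul L) ?_).trans ?_
  · filter_upwards [hK, hL] with x e1 e2
    simp only [Pi.add_apply]
    rw [norm_mul, Real.norm_eq_abs, Real.norm_eq_abs, mul_comm]
    refine mul_le_mul e2 ?_ (abs_nonneg _) hL0
    generalize toL2 d (u - uN) x = s
    refine (abs_sub _ _).trans ?_
    rw [abs_mul, abs_mul, abs_of_pos (by norm_num : (0 : ℝ) < 3), abs_pow, abs_pow, sq_abs,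
      ← sq_abs s, (by rw [← abs_pow, abs_of_nonneg (by positivity)] : s ^ 4 = |s| ^ 4)]
    have h0 := abs_nonneg s
    nlinarith [mul_le_mul_of_nonneg_right e1 (sq_nonneg |s|),
      mul_nonneg (sq_nonneg |s|) (sq_nonneg (|s| - 1)), sq_nonneg |s|, sq_nonneg (|s| ^ 2)]
  · rw [integral_const_mul]
    refine mul_le_mul_of_nonneg_left ?_ hL0
    simp only [Pi.add_apply]
    rw [integral_add (i3.const_mul _) i1, integral_const_mul, ← norm_sq_eq_integral]
    gcongr

theorem memH2_mulOp_self (h : IsGroundState V u) : MemH2 (mulOp (toL2 d u) (toL2 d u)) :=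
  (h.memH2_ground.mul h.dim_le h.memH2_ground (coeFn_mulOp h.aeBdd (toL2 d u))).1

/-- The consistency error of the truncation. -/
theorem exists_consistency (h : IsGroundState V u) : ∃ C : ℝ, 0 ≤ C ∧ ∀ N : ℕ, 1 ≤ N →
    ∀ v ∈ fourierSpace d N, |form (effPot 3 V u) (u - fourierProj d N u) v|
      ≤ C * (((N : ℝ) ^ 3)⁻¹ * ‖u - fourierProj d N u‖ * √(h2Sq (toL2 d v))) := by
  refine ⟨√(16 * (sobConst d).toReal * h2Sq V) + 3 * √(16 * (sobConst d).toReal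
    * h2Sq (mulOp (toL2 d u) (toL2 d u))), by positivity, fun N hN v hv => ?_⟩
  have he : ∀ k : Fin d → ℤ, ∑ i, k i ^ 2 ≤ (N : ℤ) ^ 2 →
      fc (toL2 d (u - fourierProj d N u)) k = 0 := fun k hk => by
    rw [fc_sub_fourierProj, if_pos hk]
  have h1 := abs_inner_mulOp_high_le h.dim_le hN h.memH2 he (memH2_of_mem_fourierSpace hv)
  have h2 := abs_inner_mulOp_high_le h.dim_le hN h.memH2_mulOp_self he
    (memH2_of_mem_fourierSpace hv)
  -- The truncation error is orthogonal to `v` in `H¹` and in `L²`, so only the multiplications by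
  -- `V` and `3u²` remain.
  rw [h.form_effPot, form_eq_inner, inner_high_eq_zero he hv, inner_toL2_high_eq_zero he hv,
    sub_zero, zero_add, mul_zero, sub_zero]
  refine (abs_add_le _ _).trans ?_
  rw [abs_mul, abs_of_pos (by norm_num : (0 : ℝ) < 3), add_mul, mul_assoc 3]
  exact add_le_add h1 (mul_le_mul_of_nonneg_left h2 (by norm_num))

end IsGroundState

/-! ### The duality estimate and superconvergence -/

/-- Two passes with `n = N⁻¹`. The crude bound `δ₀ ≤ Q E` first gives `e₀ ≤ A n E`, hence `δ₀ ≤ (A +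
1) n E`. Reinserting this makes `δ₀²` of order `n² E² ≤ H n³ E`; the quartic term is already of
order `n³ E`. -/
theorem bootstrap {n E δ₀ δ₁ e₀ ε₀ H C Q : ℝ} (hn0 : 0 ≤ n) (hn1 : n ≤ 1) (hE0 : 0 ≤ E)
    (hδ₀ : 0 ≤ δ₀) (hC : 0 ≤ C) (hH : 0 ≤ H) (hE : E ≤ H * n) (h01 : δ₀ ≤ δ₁)
    (hδ₁ : δ₁ ≤ Q * E) (hε : ε₀ ≤ n * E) (hδ : δ₀ ≤ e₀ + ε₀)
    (he : e₀ ≤ C * (δ₀ ^ 2 + δ₁ ^ 4 + n ^ 3 * E)) :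
    e₀ ≤ C * ((C * (Q ^ 2 * H + Q ^ 4 * H ^ 3 + 1) + 1) ^ 2 * H + Q ^ 4 * H ^ 3 + 1)
      * (n ^ 3 * E) := by
  have h4 : δ₁ ^ 4 ≤ Q ^ 4 * H ^ 3 * (n ^ 3 * E) := by
    calc δ₁ ^ 4 ≤ (Q * E) ^ 4 := pow_le_pow_left₀ (hδ₀.trans h01) hδ₁ 4
      _ = Q ^ 4 * (E ^ 3 * E) := by ring
      _ ≤ Q ^ 4 * ((H * n) ^ 3 * E) := by gcongr
      _ = _ := by ring
  have hn3 : n ^ 3 * E ≤ n * E :=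
    mul_le_mul_of_nonneg_right (pow_le_of_le_one hn0 hn1 (by norm_num)) hE0
  set A := C * (Q ^ 2 * H + Q ^ 4 * H ^ 3 + 1)
  have hA : 0 ≤ A := by positivity
  have h5 : e₀ ≤ A * (n * E) := by
    have h2 : δ₀ ^ 2 ≤ Q ^ 2 * H * (n * E) := by
      calc δ₀ ^ 2 ≤ (Q * E) ^ 2 := pow_le_pow_left₀ hδ₀ (h01.trans hδ₁) 2
        _ = Q ^ 2 * (E * E) := by ring
        _ ≤ Q ^ 2 * (H * n * E) := by gcongr
        _ = _ := by ring
    calc e₀ ≤ C * (Q ^ 2 * H * (n * E) + Q ^ 4 * H ^ 3 * (n * E) + n * E) :=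
          he.trans (mul_le_mul_of_nonneg_left (add_le_add (add_le_add h2
            (h4.trans (mul_le_mul_of_nonneg_left hn3 (by positivity)))) hn3) hC)
      _ = _ := by ring
  have h6 : δ₀ ^ 2 ≤ (A + 1) ^ 2 * H * (n ^ 3 * E) := by
    calc δ₀ ^ 2 ≤ ((A + 1) * (n * E)) ^ 2 := pow_le_pow_left₀ hδ₀ (by linarith) 2
      _ = (A + 1) ^ 2 * n ^ 2 * (E * E) := by ring
      _ ≤ (A + 1) ^ 2 * n ^ 2 * (H * n * E) := by gcongr
      _ = _ := by ring
  calc e₀ ≤ C * ((A + 1) ^ 2 * H * (n ^ 3 * E) + Q ^ 4 * H ^ 3 * (n ^ 3 * E) + n ^ 3 * E) :=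
        he.trans (mul_le_mul_of_nonneg_left (by gcongr) hC)
    _ = _ := by ring

namespace IsGroundState

variable {V : L2 d} {u : H1 d}

/-- The duality argument for the distance between the discrete minimiser and the projection. -/
theorem exists_duality_estimate (h : IsGroundState V u) : ∃ C : ℝ, 0 ≤ C ∧ ∀ N : ℕ, 1 ≤ N →
    ∀ uN : H1 d, IsConstrainedMinimiser V (fourierSpace d N) uN →
      0 ≤ inner ℝ (toL2 d uN) (toL2 d u) → ‖toL2 d (fourierProj d N u - uN)‖
        ≤ C * (‖toL2 d (u - uN)‖ ^ 2 + ‖u - uN‖ ^ 4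
          + ((N : ℝ) ^ 3)⁻¹ * ‖u - fourierProj d N u‖) := by
  obtain ⟨Q, hQ, hquasi⟩ := h.exists_quasiOptimal
  set U := ‖u‖ + Q * (2 * ‖u‖)
  have hU : 0 ≤ U := by positivity
  obtain ⟨C₁, hC₁, hdual⟩ := h.exists_dual U
  obtain ⟨C₂, hC₂, hcons⟩ := h.exists_consistency
  obtain ⟨K, hK0, hK⟩ := h.aeBdd.exists_nonneg
  obtain ⟨B, hB0, hB⟩ := (h.aeBdd_effPot 3).exists_nonneg
  have hb := h.aeBdd_effPot 3
  set b := effPot 3 V u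
  set S := (sobConst d).toReal
  have hS : 0 ≤ S := ENNReal.toReal_nonneg
  refine ⟨1 / 2 + C₁ * (√S * (3 * K + 1 + S) + C₂ + 1 / 2 * ((2 + B) * U)), by positivity,
    fun N hN uN huN hpos => ?_⟩
  set w := fourierProj d N u with hw
  have hwmem : w ∈ fourierSpace d N := fourierProj_mem N u
  have hwn : ‖w‖ ≤ ‖u‖ := norm_fourierProj_le N u
  -- An `H¹` bound uniform in `N`, as the constant of the dual problem requires.
  have huNU : ‖uN‖ ≤ U := by
    have h1 : ‖uN‖ ≤ ‖u‖ + ‖uN - u‖ := by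
      simpa using norm_add_le u (uN - u)
    have h2 : ‖w - u‖ ≤ 2 * ‖u‖ := (norm_sub_le _ _).trans (by linarith)
    exact h1.trans (add_le_add_right ((hquasi N uN huN hpos).trans (by gcongr)) _)
  set x := ‖toL2 d (u - uN)‖ ^ 2 with hx
  set α := inner ℝ (toL2 d uN) (toL2 d (w - uN)) with hα
  have hself : inner ℝ (toL2 d uN) (toL2 d uN) = 1 := by
    rw [real_inner_self_eq_norm_sq, huN.2.1, one_pow]
  -- Since `u - w` is `L²`-orthogonal to `uN`, `α = (uN, u) - 1`, which equals `-½ ‖u - uN‖²` for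
  -- unit vectors.
  have hαx : α = -(1 / 2 * x) := by
    have h1 : inner ℝ (toL2 d (u - w)) (toL2 d uN) = 0 := inner_toL2_high_eq_zero
      (fun k hk => by rw [hw, fc_sub_fourierProj, if_pos hk]) huN.1
    rw [map_sub, inner_sub_left, real_inner_comm, real_inner_comm (toL2 d uN)] at h1
    rw [hx, hα, map_sub, map_sub, norm_sub_sq_real, inner_sub_right, hself, h.isMin.2.1,
      huN.2.1, real_inner_comm (toL2 d uN) (toL2 d u)]
    linarith
  have hx0 : 0 ≤ x := sq_nonneg _
  set e := w - uN - α • uN with he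
  have hemem : e ∈ orthFourier N (toL2 d uN) := by
    refine mem_orthFourier.2 ⟨Submodule.sub_mem _ (Submodule.sub_mem _ hwmem huN.1)
      (Submodule.smul_mem _ _ huN.1), ?_⟩
    rw [he, map_sub, inner_sub_right, map_smul, real_inner_smul_right, hself, ← hα]
    ring
  obtain ⟨ψ, hψ, hψv, hψ1, hψ2⟩ := hdual N uN huN.1 huN.2.1 huNU (toL2 d e)
  set t := ‖toL2 d e‖ with ht
  have ht0 : 0 ≤ t := norm_nonneg _
  set y := ‖u - uN‖ ^ 4
  set z := ((N : ℝ) ^ 3)⁻¹ * ‖u - w‖ with hz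
  have hy0 : 0 ≤ y := by positivity
  have hz0 : 0 ≤ z := by positivity
  have k1 : |form b (u - uN) ψ| ≤ √S * (C₁ * t) * ((3 * K + 1) * x + S * y) := by
    refine h.abs_form_sub_le (by positivity) hK huN hψ ?_
    filter_upwards [(memH2_of_mem_fourierSpace hψ.1).ae_abs_le h.dim_le] with p hp
    refine hp.trans ?_
    rw [Real.sqrt_mul hS]
    gcongr
  have k2 : |form b (u - w) ψ| ≤ C₂ * (z * (C₁ * t)) :=
    (hcons N hN ψ hψ.1).trans (by gcongr)
  have k3 : |form b uN ψ| ≤ (2 + B) * (U * (C₁ * t)) :=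
    (abs_form_le hB0 hB uN ψ).trans (by gcongr)
  -- The dual equation tested with `e = (u - uN) - (u - w) - α uN`, using symmetry of the form.
  have k4 : t * t = form b (u - uN) ψ - form b (u - w) ψ - α * form b uN ψ := by
    have h1 := hψv e hemem
    rw [real_inner_self_eq_norm_mul_norm, form_comm hb, he, form_sub_left, form_smul_left,
      form_sub_left] at h1
    rw [form_sub_left, form_sub_left]
    linarith
  have k5 : t ≤ C₁ * (√S * ((3 * K + 1) * x + S * y) + C₂ * z + 1 / 2 * x * ((2 + B) * U)) := by
    have h1 : |α * form b uN ψ| ≤ 1 / 2 * x * ((2 + B) * (U * (C₁ * t))) := by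
      rw [abs_mul, hαx, abs_neg, abs_of_nonneg (by positivity)]
      gcongr
    have h2 : t * t ≤ t * (C₁ * (√S * ((3 * K + 1) * x + S * y) + C₂ * z
        + 1 / 2 * x * ((2 + B) * U))) := by
      rw [k4]
      linarith [(abs_le.1 k1).2, (abs_le.1 k2).1, (abs_le.1 h1).1]
    rcases ht0.eq_or_lt with h0 | h0
    · rw [← h0]; positivity
    · exact le_of_mul_le_mul_left h2 h0
  have k6 : ‖toL2 d (w - uN)‖ ≤ t + 1 / 2 * x := by
    have h1 : toL2 d (w - uN) = toL2 d e + α • toL2 d uN := by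
      rw [he, map_sub _ (w - uN), map_smul, sub_add_cancel]
    rw [h1]
    refine (norm_add_le _ _).trans ?_
    rw [norm_smul, huN.2.1, mul_one, hαx, norm_neg, Real.norm_of_nonneg (by positivity)]
  have k7 : C₁ * (√S * ((3 * K + 1) * x + S * y) + C₂ * z + 1 / 2 * x * ((2 + B) * U))
      ≤ C₁ * ((√S * (3 * K + 1 + S) + C₂ + 1 / 2 * ((2 + B) * U)) * (x + y + z)) := by
    refine mul_le_mul_of_nonneg_left ?_ hC₁.le
    have q1 : √S * ((3 * K + 1) * x + S * y) ≤ √S * (3 * K + 1 + S) * (x + y + z) := by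
      rw [mul_assoc]
      refine mul_le_mul_of_nonneg_left ?_ (Real.sqrt_nonneg S)
      have := mul_nonneg (by positivity : 0 ≤ 3 * K + 1) (add_nonneg hy0 hz0)
      have := mul_nonneg hS (add_nonneg hx0 hz0)
      linarith
    have q2 : C₂ * z ≤ C₂ * (x + y + z) := by gcongr; linarith
    have q3 : 1 / 2 * x * ((2 + B) * U) ≤ 1 / 2 * ((2 + B) * U) * (x + y + z) := by
      rw [mul_right_comm]
      gcongr
      linarith
    linarith
  linarith

/-- The superconvergence estimate between the discrete minimiser and the projection. -/
theorem exists_superconvergence (h : IsGroundState V u) : ∃ C : ℝ, 0 < C ∧ ∀ N : ℕ, 1 ≤ N →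
    ∀ uN : H1 d, IsConstrainedMinimiser V (fourierSpace d N) uN →
      0 ≤ inner ℝ (toL2 d uN) (toL2 d u) →
        ‖toL2 d (fourierProj d N u - uN)‖ + (N : ℝ)⁻¹ * ‖fourierProj d N u - uN‖
          ≤ C * ((N : ℝ) ^ 3)⁻¹ * ‖fourierProj d N u - u‖ := by
  obtain ⟨Q, hQ, hquasi⟩ := h.exists_quasiOptimal
  obtain ⟨C, hC, hdual⟩ := h.exists_duality_estimate
  set H := √(h2Sq (toL2 d u))
  have hH : 0 ≤ H := Real.sqrt_nonneg _
  set D := C * ((C * (Q ^ 2 * H + Q ^ 4 * H ^ 3 + 1) + 1) ^ 2 * H + Q ^ 4 * H ^ 3 + 1)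
  have hD : 0 ≤ D := by positivity
  -- One `D` bounds the `L²` term and seven, from the inverse inequality, the `H¹` term; the `1`
  -- secures positivity.
  refine ⟨8 * D + 1, by positivity, fun N hN uN huN hpos => ?_⟩
  have hN0 : (0 : ℝ) < N := by exact_mod_cast hN
  have hN1 : (1 : ℝ) ≤ N := by exact_mod_cast hN
  have h1 := hdual N hN uN huN hpos
  set w := fourierProj d N u with hw
  have he : ∀ k : Fin d → ℤ, ∑ i, k i ^ 2 ≤ (N : ℤ) ^ 2 → fc (toL2 d (u - w)) k = 0 :=
    fun k hk => by rw [hw, fc_sub_fourierProj, if_pos hk]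
  have hE : ‖u - w‖ ≤ H * (N : ℝ)⁻¹ := by
    rw [← div_eq_mul_inv, le_div_iff₀ hN0, mul_comm]
    refine norm_le_of_high h.memH2_ground he fun k => ?_
    rw [hw, fc_sub_fourierProj]
    split_ifs <;> simp
  have hε : ‖toL2 d (u - w)‖ ≤ (N : ℝ)⁻¹ * ‖u - w‖ := by
    rw [inv_mul_eq_div, le_div_iff₀ hN0, mul_comm]
    exact norm_toL2_le_of_high he
  have hδ : ‖toL2 d (u - uN)‖ ≤ ‖toL2 d (w - uN)‖ + ‖toL2 d (u - w)‖ := by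
    rw [← sub_add_sub_cancel u w uN, map_add, add_comm]
    exact norm_add_le _ _
  have hδ₁ : ‖u - uN‖ ≤ Q * ‖u - w‖ := by
    rw [norm_sub_rev u, norm_sub_rev u]
    exact hquasi N uN huN hpos
  rw [← inv_pow] at h1 ⊢
  have h2 := bootstrap (inv_nonneg.2 hN0.le) (inv_le_one_of_one_le₀ hN1) (norm_nonneg (u - w))
    (norm_nonneg _) hC hH hE (norm_toL2_le (u - uN)) hδ₁ hε hδ h1
  have h3 := norm_le_of_mem_fourierSpace hN
    (Submodule.sub_mem _ (fourierProj_mem N u) huN.1 : w - uN ∈ fourierSpace d N)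
  have h4 : (N : ℝ)⁻¹ * ‖w - uN‖ ≤ 7 * ‖toL2 d (w - uN)‖ := by
    rw [inv_mul_le_iff₀ hN0]
    linarith
  rw [norm_sub_rev w u, mul_assoc]
  have h5 : 0 ≤ (N : ℝ)⁻¹ ^ 3 * ‖u - w‖ := by positivity
  change ‖toL2 d (w - uN)‖ ≤ D * _ at h2
  linarith

end IsGroundState

/-! ### Passage from the potential to its `L²` class -/

theorem energy_congr {V W : Torus d → ℝ} (h : V =ᵐ[volume] W) (v : H1 d) :
    energy V v = energy W v := by
  rw [energy, energy, integral_congr_ae (h.mono fun x hx => by beta_reduce; rw [hx] :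
    (fun x => V x * toL2 d v x ^ 2) =ᵐ[volume] fun x => W x * toL2 d v x ^ 2)]

theorem IsConstrainedMinimiser.congr {V W : Torus d → ℝ} (h : V =ᵐ[volume] W)
    {S : Submodule ℝ (H1 d)} {u : H1 d} (hu : IsConstrainedMinimiser V S u) :
    IsConstrainedMinimiser W S u :=
  ⟨hu.1, hu.2.1, fun v hv hv1 => by
    rw [← energy_congr h, ← energy_congr h]
    exact hu.2.2 v hv hv1⟩

theorem MemSobolev.memH2 {r : ℝ} (hr : 2 ≤ r) {V : Torus d → ℝ} (hV : MemSobolev r V) :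
    MemH2 (hV.1.toLp : L2 d) := by
  refine hV.2.of_nonneg_of_le (fun k => by positivity) fun k => ?_
  have h1 : fc (hV.1.toLp : L2 d) k = mFourierCoeff (fun x => (V x : ℂ)) k := by
    rw [fc_eq_mFourierCoeff]
    refine integral_congr_ae ?_
    filter_upwards [hV.1.coeFn_toLp] with x hx
    rw [hx]
  rw [h1, ← Real.rpow_natCast]
  exact mul_le_mul_of_nonneg_right (Real.rpow_le_rpow_of_exponent_le (one_le_wt k)
    (by exact_mod_cast hr)) (sq_nonneg _)

end GrossPitaevskii

theorem mainTheorem3 (d : ℕ) (hd1 : 1 ≤ d) (hd3 : d ≤ 3) (r : ℝ) (hr : 2 ≤ r)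
    (V : Torus d → ℝ) (hV : MemSobolev r V)
    (hVmin : ∃ Vmin : ℝ, 0 < Vmin ∧ ∀ᵐ x, Vmin ≤ V x)
    (u : H1 d) (hu : IsConstrainedMinimiser V ⊤ u) (hpos : ∀ᵐ x, 0 < toL2 d u x) :
    ∃ C : ℝ, 0 < C ∧ ∀ N : ℕ, 1 ≤ N → ∀ uN : H1 d,
      IsConstrainedMinimiser V (fourierSpace d N) uN → 0 ≤ inner ℝ (toL2 d uN) (toL2 d u) →
        ‖toL2 d (fourierProj d N u - uN)‖ + (N : ℝ)⁻¹ * ‖fourierProj d N u - uN‖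
          ≤ C * ((N : ℝ) ^ 3)⁻¹ * ‖fourierProj d N u - u‖ := by
  have hVL := hV.1.coeFn_toLp
  have hg : IsGroundState (hV.1.toLp : L2 d) u :=
    { dim_le := hd3
      memH2 := hV.memH2 hr
      potential_pos := by
        obtain ⟨c, hc, hcV⟩ := hVmin
        filter_upwards [hVL, hcV] with x e1 e2
        rw [e1]
        exact hc.trans_le e2
      isMin := hu.congr hVL.symm
      pos := hpos }
  obtain ⟨C, hC, hmain⟩ := hg.exists_superconvergence
  exact ⟨C, hC, fun N hN uN huN => hmain N hN uN (huN.congr hVL.symm)⟩
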